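/- **Setting.** Spin-$j$ objects have components labelled by $m=-j,\dots,j$; put $c^j_m=\sqrt{(j+m)!(j-m)!/(2j)!}$. For a non-zero quaternion $q=q_0+q_1\mathbf i+q_2\mathbf j+q_3\mathbf k$ let $v=q_3+iq_0$, $w=q_1+iq_2$ and let $D^j(q)$ be the Wigner matrix $$D^j_{mm'}(q)=\frac{\sqrt{(j+m)!(j-m)!(j+m')!(j-m')!}}{i^{2j}(|v|^2+|w|^2)^j}\sum_s\frac{w^s\,\bar w^{\,m-m'+s}\,v^{\,j+m'-s}\,(-\bar v)^{j-m-s}}{s!\,(m-m'+s)!\,(j+m'-s)!\,(j-m-s)!},$$ the sum being over all $s$ for which no exponent is negative. Let $H(\eta,\zeta)$ be a (possibly multivalued) holomorphic function and $$L(x)=\oint\frac{d\zeta}{2\pi i\zeta}\,H\Big(\sum_{m=-2}^{2}x_m\zeta^{-m},\zeta\Big)$$ the associated function of five complex variables $x_m$, assumed real when $\bar x_m=(-1)^mx_{-m}$. Let $M$ be a smooth 4-manifold with smooth complex functions $x_m$ such that $\bar x_m=(-1)^mx_{-m}$ and $L_{x_0}=0$, and on which $z=x_2$ and $u=iL_{x_1}$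 form local complex coordinates. The $j=2$ generalized Legendre transform symplectic forms on $M$ are the coefficients of $\omega_N(\zeta)=dp_N(\zeta)\wedge dx_N(\zeta)=\omega_++\omega_0\zeta+\omega_-\zeta^2$, where $x_N=z+x_1\zeta+\cdots$, $p_N=u+p_{-2}\zeta+\cdots$, $p_{-2}=iL_{x_2}$, i.e. $$\omega_+=du\wedge dz,\qquad \omega_0=dp_{-2}\wedge dz+du\wedge dx_1,\qquad \omega_-=-\overline{\omega_+}.$$ Writing $\omega_\pm=\pm\frac12(\omega_1\pm i\omega_2)$, $\omega_0=\omega_3$, the hyperkähler metric is $g(X,Y)=-\omega_a(X,I_aY)$ ($a=1,2,3$), with complex structures $I_1=\omega_3^{-1}\omega_2$, $I_2=\omega_1^{-1}\omega_3$, $I_3=\omega_2^{-1}\omega_1$ (the wedge product is normalized by $\alpha\wedge\beta=\frac12(\alpha\otimes\beta-\beta\otimes\alpha)$). It may be indefinite. **Quaternionic parameters.** For real $e_1\ge e_2\ge e_3$ with $e_1+e_2+e_3=0$ put $\rho=e_1-e_3$ and let $\mathring x$ be the reference spinor $\mathring x_{\pm2}=\frac14(e_1-e_3)$, $\mathring x_{\pm1}=0$,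 $\mathring x_0=\frac64(e_1+e_3)$. 1. Every $(x_m)$ with $\bar x_m=(-1)^mx_{-m}$ can be written as $$c^2_mx_m=\sum_{m'}D^2_{mm'}(q)\,c^2_{m'}\mathring x_{m'}$$ for some $q\neq0$ and $e_1\ge e_2\ge e_3$ as above. In any such representation $X^3-g_2X-g_3=(X-e_1)(X-e_2)(X-e_3)$, where $g_2=4\cdot\frac12\sum_m|c^2_mx_m|^2$ and $$g_3=16\begin{vmatrix}x_2&x_1/4&x_0/6\\x_1/4&x_0/6&x_{-1}/4\\x_0/6&x_{-1}/4&x_{-2}\end{vmatrix}.$$ On $M$, near every point where $4g_2^3-27g_3^2\ne0$, the parameters $q,e_1,e_2,e_3$ can be chosen to be smooth functions with $e_1>e_2>e_3$. 2. On an open set of $M$ let such smooth $q$ and $e_1>e_2>e_3$ be given, write $q^{-1}dq=\sigma_0+\sigma_1\mathbf i+\sigma_2\mathbf j+\sigma_3\mathbf k$, and consider any point at which $d\rho,\sigma_1,\sigma_2,\sigma_3$ are linearly independent. Put $h_m=\overline{L_{x_0x_m}}$ and define $\mathring h_m$ by $(c^2_m)^{-1}\mathring h_m=\sum_{m'}D^2_{mm'}(q^{-1})(c^2_{m'})^{-1}h_{m'}$.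 Let $$r_2(\mathring h)=\tfrac12\big[|\mathring h_2|^2+4|\mathring h_1|^2+6\mathring h_0^2+4|\mathring h_{-1}|^2+|\mathring h_{-2}|^2\big],\qquad r_3(\mathring h)=\begin{vmatrix}\mathring h_2&\mathring h_1&\mathring h_0\\\mathring h_1&\mathring h_0&\mathring h_{-1}\\\mathring h_0&\mathring h_{-1}&\mathring h_{-2}\end{vmatrix},$$ $\mathring H_2=\mathring h_2\mathring h_0-\mathring h_1^2$, $\mathring H_1=\frac12\mathring h_2\mathring h_{-1}-\frac12\mathring h_1\mathring h_0$, $\mathring H_0=\frac16\mathring h_2\mathring h_{-2}+\frac13\mathring h_1\mathring h_{-1}-\frac12\mathring h_0^2$, $\mathring H_{-m}=(-1)^m\overline{\mathring H_m}$, and $\mathring H_0'=\mathring H_0-\frac16r_2(\mathring h)$. Then the matrices of the two successive linear changes of frame $$\begin{pmatrix}\chi_2\\\chi_1\\\chi_{-1}\\\chi_{-2}\end{pmatrix}=\begin{pmatrix}\frac14&0&0&-i\rho\\0&3ie_2-i\rho&3e_2+\rho&0\\0&3ie_2-i\rho&-3e_2-\rho&0\\\frac14&0&0&i\rho\end{pmatrix}\begin{pmatrix}d\rho\\\sigma_1\\\sigma_2\\\sigma_3\end{pmatrix},\qquad\begin{pmatrix}\chi_2\\\chi_1\\\chi_{-1}\\\chi_{-2}\end{pmatrix}=\begin{pmatrix}\mathring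 H_0'&0&0&0\\2\mathring H_{-1}&\mathring H_0'&\mathring H_2&0\\0&\mathring H_{-2}&\mathring H_0'&2\mathring H_1\\0&0&0&\mathring H_0'\end{pmatrix}\begin{pmatrix}\theta_2\\\theta_1\\\theta_{-1}\\\theta_{-2}\end{pmatrix}$$ are invertible, $\lambda=r_3(\mathring h)\mathring H_0'$ is real, and, with the $\theta$-frame so defined, the forms $\omega_m$ above satisfy $$c^1_m\omega_m=\sum_{m'=-1}^1D^1_{mm'}(q)\,c^1_{m'}\mathring\omega_{m'},$$ $$\mathring\omega_{+1}=\lambda i\,\theta_2\wedge\bar\theta_1,\qquad\mathring\omega_0=\lambda i\,(\theta_1\wedge\bar\theta_1-\theta_2\wedge\bar\theta_2),\qquad\mathring\omega_{-1}=\lambda i\,\bar\theta_2\wedge\theta_1,$$ and the hyperkähler metric exists, is unique, and equals $$g=\lambda\,(|\theta_1|^2+|\theta_2|^2).$$ -/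

import Mathlib

open Quaternion ComplexConjugate Manifold ContDiff
open scoped Matrix Nat

noncomputable section

namespace GLT

/-! ### Conventions
A spin-`j` object has components labelled by `m = -j, …, j`; the component with label `m` is stored
at position `a = j + m` of `Fin (2 * j + 1)`.  For `j = 2` the positions `0, 1, 2, 3, 4` carry the
labels `-2, -1, 0, 1, 2`; for `j = 1` the positions `0, 1, 2` carry the labels `-1, 0, 1`. -/

/-! ### Wigner matrices and spherical normalizations -/

/-- The Wigner matrix `D^j(q)`, written with `v = q₃ + i q₀` and `w = q₁ + i q₂`.  In terms of the
positions `a = j + m`, `b = j + m'` the exponents of `w`, `w̄`, `v`, `-v̄` are `s`, `m - m' + s`,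
`j + m' - s`, `j - m - s`, and the sum is over all `s` for which these are non-negative. -/
def wignerD (j : ℕ) (q : ℍ[ℝ]) : Matrix (Fin (2 * j + 1)) (Fin (2 * j + 1)) ℂ :=
  let v : ℂ := ⟨q.imK, q.re⟩
  let w : ℂ := ⟨q.imI, q.imJ⟩
  Matrix.of fun i k =>
    let a : ℕ := i
    let b : ℕ := k
    ((√((a ! * (2 * j - a)! * b ! * (2 * j - b)! : ℕ) : ℝ) : ℝ) : ℂ)
        / (((‖v‖ ^ 2 + ‖w‖ ^ 2) ^ j : ℝ) : ℂ) * (Complex.I ^ (2 * j))⁻¹ *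
      ∑ s ∈ (Finset.range (2 * j + 1)).filter (fun s => b ≤ a + s ∧ s ≤ b ∧ a + s ≤ 2 * j),
        w ^ s / (s ! : ℂ)
          * (conj w ^ (a + s - b) / ((a + s - b)! : ℂ))
          * (v ^ (b - s) / ((b - s)! : ℂ))
          * ((-conj v) ^ (2 * j - a - s) / ((2 * j - a - s)! : ℂ))

/-- The normalization factor `c^j_m = √((j+m)! (j-m)! / (2j)!)`. -/
def sphNorm (j : ℕ) (a : Fin (2 * j + 1)) : ℝ :=
  √((((a : ℕ)! * (2 * j - (a : ℕ))! : ℕ) : ℝ) / ((2 * j)! : ℝ))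

/-- `x^j_m = c^j_m x_m`. -/
def normalize (j : ℕ) (x : Fin (2 * j + 1) → ℂ) : Fin (2 * j + 1) → ℂ :=
  fun a => sphNorm j a * x a

/-- `h^j_m = (c^j_m)⁻¹ h_m`. -/
def dualNormalize (j : ℕ) (h : Fin (2 * j + 1) → ℂ) : Fin (2 * j + 1) → ℂ :=
  fun a => (sphNorm j a : ℂ)⁻¹ * h a

/-! ### Spin-2 objects, invariants and the Weierstrass cubic -/

/-- The alternating reality property `x̄_m = (-1)^m x_{-m}` of a spin-2 object. -/
def IsAltReal (x : Fin 5 → ℂ) : Prop :=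
  ∀ a : Fin 5, conj (x a) = (-1) ^ (a : ℕ) * x (Fin.rev a)

/-- The quadratic invariant, as a function of *normalized* components `y_m`. -/
def r₂ (y : Fin 5 → ℂ) : ℝ := (1 / 2) * ∑ a, ‖y a‖ ^ 2

/-- The cubic invariant, as a function of *normalized* components `y_m`: the Hankel determinant in
`c_m y_m`.  With `y_m = c_m x_m` its entries are `x_{±2}`, `x_{±1} / 4`, `x_0 / 6`, and with
`y_m = h_m / c_m` its entries are the `h_m`. -/
def r₃ (y : Fin 5 → ℂ) : ℂ :=
  let t := normalize 2 y
  Matrix.det !![t 4, t 3, t 2;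
                t 3, t 2, t 1;
                t 2, t 1, t 0]

/-- `g₂ = 4 r₂(x)`. -/
def g₂ (x : Fin 5 → ℂ) : ℂ := 4 * (r₂ (normalize 2 x) : ℂ)

/-- `g₃ = 16 r₃(x)`. -/
def g₃ (x : Fin 5 → ℂ) : ℂ := 16 * r₃ (normalize 2 x)

/-- The discriminant `4 g₂³ - 27 g₃²` of the cubic `X³ - g₂ X - g₃`. -/
def discr (x : Fin 5 → ℂ) : ℂ := 4 * g₂ x ^ 3 - 27 * g₃ x ^ 2

/-- The reference spinor. -/
def refSpinor (e₁ e₃ : ℝ) : Fin 5 → ℂ :=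
  ![((e₁ - e₃) / 4 : ℝ), 0, (6 * (e₁ + e₃) / 4 : ℝ), 0, ((e₁ - e₃) / 4 : ℝ)]

/-- `(q, e₁, e₂, e₃)` are quaternionic parameters of the coefficients `x`: the normalized
coefficients are the `D²(q)`-rotation of the normalized reference spinor. -/
structure IsQuatParam (x : Fin 5 → ℂ) (q : ℍ[ℝ]) (e₁ e₂ e₃ : ℝ) : Prop where
  q_ne : q ≠ 0
  sum_eq : e₁ + e₂ + e₃ = 0
  le₁₂ : e₂ ≤ e₁
  le₂₃ : e₃ ≤ e₂
  rot : normalize 2 x = wignerD 2 q *ᵥ normalize 2 (refSpinor e₁ e₃)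

/-- The rotated components `h̊_m`, given by `h̊^2 = D²(q⁻¹) h^2`, unnormalized. -/
def ringed (q : ℍ[ℝ]) (h : Fin 5 → ℂ) : Fin 5 → ℂ :=
  normalize 2 (wignerD 2 q⁻¹ *ᵥ dualNormalize 2 h)

/-- The composite components `H_m`, quadratic in the `h_m`. -/
def composite (h : Fin 5 → ℂ) : Fin 5 → ℂ :=
  let Hp2 := h 4 * h 2 - h 3 * h 3
  let Hp1 := h 4 * h 1 / 2 - h 3 * h 2 / 2
  let H0 := h 4 * h 0 / 6 + h 3 * h 1 / 3 - h 2 * h 2 / 2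
  ![conj Hp2, -conj Hp1, H0, Hp1, Hp2]

/-- `H'_0 = H_0 - r₂(h) / 6`. -/
def Hprime (h : Fin 5 → ℂ) : ℂ := composite h 2 - (r₂ (dualNormalize 2 h) : ℂ) / 6

/-! ### The two changes of frame
Rows and columns of the `χ`- and `θ`-frames are ordered by the labels `+2, +1, -1, -2`. -/

/-- `(χ₂, χ₁, χ₋₁, χ₋₂)ᵀ = quatToChi ρ e₂ · (dρ, σ₁, σ₂, σ₃)ᵀ`. -/
def quatToChi (ρ e₂ : ℝ) : Matrix (Fin 4) (Fin 4) ℂ :=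
  !![1 / 4, 0, 0, -Complex.I * ρ;
     0, 3 * Complex.I * e₂ - Complex.I * ρ, 3 * e₂ + ρ, 0;
     0, 3 * Complex.I * e₂ - Complex.I * ρ, -3 * e₂ - ρ, 0;
     1 / 4, 0, 0, Complex.I * ρ]

/-- `(χ₂, χ₁, χ₋₁, χ₋₂)ᵀ = thetaToChi h̊ · (θ₂, θ₁, θ₋₁, θ₋₂)ᵀ`. -/
def thetaToChi (h : Fin 5 → ℂ) : Matrix (Fin 4) (Fin 4) ℂ :=
  let H := composite h
  !![Hprime h, 0, 0, 0;
     2 * H 1, Hprime h, H 4, 0;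
     0, H 0, Hprime h, 2 * H 3;
     0, 0, 0, Hprime h]

/-! ### The contour-integral potential -/

/-- The tropical component `x_NS(ζ) = ζ⁻² x_N(ζ) = ∑ x_m ζ^{-m}` of a section of `𝒪(4)`. -/
def tropical (x : Fin 5 → ℂ) (ζ : ℂ) : ℂ := ∑ a : Fin 5, x a * ζ ^ (2 - (a : ℤ))

/-- A piece of an integration contour, together with the branch `H(x_NS, ζ)` of the (possibly
multivalued) holomorphic function that is integrated along it. -/
structure ContourArc where
  γ : ℝ → ℂ
  H : ℂ → ℂ → ℂ

/-- The arc is `C¹`, avoids `ζ = 0`, and `H` is holomorphic near all `(x_NS(ζ), ζ)`, `ζ` on the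
arc. -/
structure ContourArc.Admissible (A : ContourArc) (x : Fin 5 → ℂ) : Prop where
  smooth : ContDiff ℝ 1 A.γ
  ne_zero : ∀ t ∈ Set.Icc (0 : ℝ) 1, A.γ t ≠ 0
  holo : ∀ t ∈ Set.Icc (0 : ℝ) 1,
    AnalyticAt ℂ (fun P : ℂ × ℂ => A.H P.1 P.2) (tropical x (A.γ t), A.γ t)

/-- `∫ dζ / (2πiζ) H(x_NS(ζ), ζ)` along the arc. -/
def ContourArc.integral (A : ContourArc) (x : Fin 5 → ℂ) : ℂ :=
  ∫ t in (0 : ℝ)..1,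
    deriv A.γ t / (2 * Real.pi * Complex.I * A.γ t) * A.H (tropical x (A.γ t)) (A.γ t)

/-- `L = ∮ dζ / (2πiζ) H(x_NS(ζ), ζ)` on the open set `U` of coefficients `x`.  Near each point of
`U` the contour can be chosen fixed; it consists of finitely many arcs carrying branches of `H`. -/
def IsContourPotential (U : Set (Fin 5 → ℂ)) (L : (Fin 5 → ℂ) → ℂ) : Prop :=
  ∀ x₀ ∈ U, ∃ (n : ℕ) (A : Fin n → ContourArc),
    ∀ᶠ x in nhds x₀, (∀ k, (A k).Admissible x) ∧ L x = ∑ k, (A k).integral x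

/-- The partial derivative `L_{x_m}`, the five variables being independent complex variables. -/
def pd (L : (Fin 5 → ℂ) → ℂ) (a : Fin 5) (x : Fin 5 → ℂ) : ℂ := fderiv ℂ L x (Pi.single a 1)

/-- The functions `h_m`, `m = -2, …, 2`: the complex conjugates of `h̄_m = L_{x_0 x_m}`. -/
def hfun (L : (Fin 5 → ℂ) → ℂ) (x : Fin 5 → ℂ) : Fin 5 → ℂ := fun a => conj (pd (pd L 2) a x)

/-! ### Differential forms at a point -/

/-- The wedge product of complex-valued 1-forms on a vector space, normalized as
`α ∧ β = (α ⊗ β - β ⊗ α) / 2`. -/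
def wedge {T : Type*} (α β : T → ℂ) (X Y : T) : ℂ := (α X * β Y - β X * α Y) / 2

/-- `g` is the hyperkähler metric of the triplet `Ω = (ω₋, ω₀, ω₊)` of 2-forms on a real vector
space.  Here `ω_± = ±(ω₁ ± i ω₂)/2` and `ω₀ = ω₃` with real forms `ω₁, ω₂, ω₃`, the endomorphisms
`I₁ = ω₃⁻¹ω₂`, `I₂ = ω₁⁻¹ω₃`, `I₃ = ω₂⁻¹ω₁` obey the algebra of imaginary quaternions, and
`g(X, Y) = -ω₁(X, I₁Y) = -ω₂(X, I₂Y) = -ω₃(X, I₃Y)`. -/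
def IsHyperkahlerMetric {T : Type*} [AddCommGroup T] [Module ℝ T]
    (Ω : Fin 3 → T → T → ℂ) (g : T → T → ℝ) : Prop :=
  ∃ (ω₁ ω₂ ω₃ : T → T → ℝ) (I₁ I₂ I₃ : T →ₗ[ℝ] T),
    (∀ X Y, Ω 2 X Y = (ω₁ X Y + Complex.I * ω₂ X Y) / 2) ∧
    (∀ X Y, Ω 1 X Y = ω₃ X Y) ∧
    (∀ X Y, Ω 0 X Y = -(ω₁ X Y - Complex.I * ω₂ X Y) / 2) ∧
    (∀ X Y, ω₃ (I₁ X) Y = ω₂ X Y) ∧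
    (∀ X Y, ω₁ (I₂ X) Y = ω₃ X Y) ∧
    (∀ X Y, ω₂ (I₃ X) Y = ω₁ X Y) ∧
    I₁ ∘ₗ I₁ = -LinearMap.id ∧ I₂ ∘ₗ I₂ = -LinearMap.id ∧ I₃ ∘ₗ I₃ = -LinearMap.id ∧
    I₁ ∘ₗ I₂ = I₃ ∧
    (∀ X Y, g X Y = -ω₁ X (I₁ Y)) ∧
    (∀ X Y, g X Y = -ω₂ X (I₂ Y)) ∧
    (∀ X Y, g X Y = -ω₃ X (I₃ Y))

/-- The canonical triplet `(ω̊₋, ω̊₀, ω̊₊)` built from two complex 1-forms `θ₁`, `θ₂`. -/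
def canonicalForms {T : Type*} (lam : ℝ) (θ₁ θ₂ : T → ℂ) : Fin 3 → T → T → ℂ :=
  let cθ₁ : T → ℂ := fun X => conj (θ₁ X)
  let cθ₂ : T → ℂ := fun X => conj (θ₂ X)
  ![fun X Y => lam * Complex.I * wedge cθ₂ θ₁ X Y,
    fun X Y => lam * Complex.I * (wedge θ₁ cθ₁ X Y - wedge θ₂ cθ₂ X Y),
    fun X Y => lam * Complex.I * wedge θ₂ cθ₁ X Y]

/-! ### The generalized Legendre transform in real dimension four, `j = 2` -/

variable {M : Type*} [TopologicalSpace M] [ChartedSpace (EuclideanSpace ℝ (Fin 4)) M]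

/-- The differential at `p` of a function on `M` with values in a normed space. -/
def d {F : Type*} [NormedAddCommGroup F] [NormedSpace ℝ F] (f : M → F) (p : M) :
    TangentSpace (𝓡 4) p →L[ℝ] F :=
  mfderiv (𝓡 4) 𝓘(ℝ, F) f p

/-- The holomorphic coordinate `z = x₂`. -/
def zCoord (x : M → Fin 5 → ℂ) (p : M) : ℂ := x p 4

/-- The holomorphic coordinate `u = p₋₁`, from `L_{x_1} = -i u`. -/
def uCoord (L : (Fin 5 → ℂ) → ℂ) (x : M → Fin 5 → ℂ) (p : M) : ℂ := Complex.I * pd L 3 (x p)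

/-- The next Taylor coefficient `p₋₂` of the coordinate conjugate to `x_N`, from
`L_{x_2} = -i p₋₂`. -/
def pNext (L : (Fin 5 → ℂ) → ℂ) (x : M → Fin 5 → ℂ) (p : M) : ℂ := Complex.I * pd L 4 (x p)

/-- `M` is a space obtained from the potential `L` by the `j = 2` generalized Legendre transform:
`L` is a contour integral, real on real coefficients; `x_m` are smooth functions on the 4-manifold
`M` with the reality property and subject to `L_{x_0} = 0`; and `(z, u)` are local complex
coordinates on `M`. -/
structure IsGLTSpace (U : Set (Fin 5 → ℂ)) (L : (Fin 5 → ℂ) → ℂ) (x : M → Fin 5 → ℂ) :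
    Prop where
  isOpen : IsOpen U
  contour : IsContourPotential U L
  real : ∀ y ∈ U, IsAltReal y → (L y).im = 0
  smooth : ContMDiff (𝓡 4) 𝓘(ℝ, Fin 5 → ℂ) ∞ x
  mem : ∀ p, x p ∈ U
  altReal : ∀ p, IsAltReal (x p)
  constraint : ∀ p, pd L 2 (x p) = 0
  coords : ∀ p, Function.Bijective fun X : TangentSpace (𝓡 4) p =>
    (d (zCoord x) p X, d (uCoord L x) p X)

/-- The hyperkähler symplectic forms `(ω₋, ω₀, ω₊)` of the construction at `p`: the coefficients of
`ω_N(ζ) = dp_N(ζ) ∧ dx_N(ζ) = ω₊ + ω₀ ζ + ω₋ ζ²`, where `p_N = u + p₋₂ ζ + …` and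
`x_N = z + x₁ ζ + …`, so that `ω₊ = du ∧ dz`, `ω₀ = dp₋₂ ∧ dz + du ∧ dx₁`, and
`ω₋ = -conj ω₊`. -/
def gltForms (L : (Fin 5 → ℂ) → ℂ) (x : M → Fin 5 → ℂ) (p : M) :
    Fin 3 → TangentSpace (𝓡 4) p → TangentSpace (𝓡 4) p → ℂ :=
  let dz := d (zCoord x) p
  let du := d (uCoord L x) p
  let dp := d (pNext L x) p
  let dx₁ := d (fun r => x r 3) p
  ![fun X Y => -conj (wedge du dz X Y),
    fun X Y => wedge dp dz X Y + wedge du dx₁ X Y,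
    fun X Y => wedge du dz X Y]

/-- A smooth quaternionic parametrization, with distinct `e_i`, of the coefficients `x` over an
open set `V`. -/
structure IsQuatFrameOn (V : Set M) (x : M → Fin 5 → ℂ) (q : M → ℍ[ℝ]) (e₁ e₂ e₃ : M → ℝ) :
    Prop where
  isOpen : IsOpen V
  param : ∀ p ∈ V, IsQuatParam (x p) (q p) (e₁ p) (e₂ p) (e₃ p)
  lt₁₂ : ∀ p ∈ V, e₂ p < e₁ p
  lt₂₃ : ∀ p ∈ V, e₃ p < e₂ p
  smooth_q : ContMDiffOn (𝓡 4) 𝓘(ℝ, ℍ[ℝ]) ∞ q V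
  smooth_e₁ : ContMDiffOn (𝓡 4) 𝓘(ℝ, ℝ) ∞ e₁ V
  smooth_e₂ : ContMDiffOn (𝓡 4) 𝓘(ℝ, ℝ) ∞ e₂ V
  smooth_e₃ : ContMDiffOn (𝓡 4) 𝓘(ℝ, ℝ) ∞ e₃ V

/-- The real 1-forms `(dρ, σ₁, σ₂, σ₃)` at `p`, where `q⁻¹ dq = σ₀ + σ₁ i + σ₂ j + σ₃ k`. -/
def quatFrame (q : M → ℍ[ℝ]) (ρ : M → ℝ) (p : M) : Fin 4 → TangentSpace (𝓡 4) p → ℝ :=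
  ![fun X => d ρ p X,
    fun X => ((q p)⁻¹ * d q p X).imI,
    fun X => ((q p)⁻¹ * d q p X).imJ,
    fun X => ((q p)⁻¹ * d q p X).imK]

/-- The 1-forms `(θ₂, θ₁, θ₋₁, θ₋₂)` at `p`, obtained from `(dρ, σ₁, σ₂, σ₃)` by the two successive
changes of frame. -/
def thetaFrame (h : Fin 5 → ℂ) (q : M → ℍ[ℝ]) (ρ e₂ : M → ℝ) (p : M)
    (X : TangentSpace (𝓡 4) p) : Fin 4 → ℂ :=
  (thetaToChi h)⁻¹ *ᵥ (quatToChi (ρ p) (e₂ p) *ᵥ fun a => (quatFrame q ρ p a X : ℂ))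

end GLT

end

noncomputable section

namespace GLT

/-! Everything is equivariant under rotations, so the computation is moved to the frame in which the
coefficients are diagonal. A real spin-2 object is a symmetric traceless real 3×3 matrix A
(`spinor`); D²(q) acts on it by A ↦ R A Rᵀ with R = `rot q` (`wignerD_two_mulVec`), and D¹(q) acts
on real vectors by R (`wignerE_one_spinVec`). The reference spinor is diag(e₃, e₁, e₂). Quaternionic
parameters are therefore an orthogonal diagonalization with ordered eigenvalues, and the Weierstrass
cubic is the characteristic polynomial of A, because g₂ = tr A² / 2 and g₃ = det A. For distinct
eigenvalues the inverse function theorem makes the parameters smooth, once the scale of q is fixed.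

Each derivative ∂/∂x_m under the contour integral multiplies by ζ^{-m}, so second derivatives of L
depend only on the sum of the labels (`IsContourPotential.pd_pd_eq`). Hence the five functions h
determine the symplectic forms, which at a point are `spinForms h (dx X) (dx Y)` with dx subject to
the linear constraint d(L_{x_0}) = 0. Modulo this constraint the forms are a covariant matrix
expression (`spinForms_eq`), so they can be computed from h̊ and from the differential in the
rotated frame (`frameMatrix`), whose components with m ≠ 0 are the χ's (`quatToChi_mulVec`).
Eliminating the component m = 0 by the constraint and inserting the θ's gives the canonical triplet,
by the Desnanot–Jacobi identity for the Hankel matrix of h̊.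

Non-degeneracy has two sources. If h̊_0 = 0, the constraint is a linear relation among dρ, σ₁, σ₂,
σ₃, so h̊ = 0 and all forms vanish. If r₃(h̊) = 0, all products ω_j ∧ ω_k vanish. Both contradict
that ω₊ = du ∧ dz comes from complex coordinates. Finally H'_0 = -(|h̊_1|² + h̊_0²) is non-zero.

The canonical triplet is the flat metric of ℂ², scaled by λ, composed with three quaternionic units.
Rotating the triplet by R only rotates the units, so the metric does not see q; it is unique because
the forms are non-degenerate (`isHyperkahlerMetric_canonicalForms_iff`). -/

/-! ### Wigner matrices without square roots. -/

/-- The polynomial in the entries of a 2×2 matrix that underlies a Wigner matrix entry, in the basis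
of unnormalized components. -/
def wignerSum (j : ℕ) (v w v' w' : ℂ) (a b : ℕ) : ℂ :=
  ((b ! * (2 * j - b)! : ℕ) : ℂ) *
    ∑ s ∈ (Finset.range (2 * j + 1)).filter (fun s => b ≤ a + s ∧ s ≤ b ∧ a + s ≤ 2 * j),
      w ^ s / (s ! : ℂ) * (w' ^ (a + s - b) / ((a + s - b)! : ℂ)) *
        (v ^ (b - s) / ((b - s)! : ℂ)) * ((-v') ^ (2 * j - a - s) / ((2 * j - a - s)! : ℂ))

/-- The Wigner matrix in the basis of unnormalized components. -/
def wignerE (j : ℕ) (q : ℍ[ℝ]) : Matrix (Fin (2 * j + 1)) (Fin (2 * j + 1)) ℂ :=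
  let v : ℂ := ⟨q.imK, q.re⟩
  let w : ℂ := ⟨q.imI, q.imJ⟩
  ((((‖v‖ ^ 2 + ‖w‖ ^ 2) ^ j : ℝ) : ℂ)⁻¹ * (Complex.I ^ (2 * j))⁻¹) •
    Matrix.of fun i k : Fin (2 * j + 1) => wignerSum j v w (conj v) (conj w) i k

lemma sphNorm_pos (j : ℕ) (a : Fin (2 * j + 1)) : 0 < sphNorm j a := by
  unfold sphNorm
  positivity

lemma sqrt_factorials_mul_sphNorm (j : ℕ) (a b : Fin (2 * j + 1)) :
    √((((a : ℕ)! * (2 * j - a)! * (b : ℕ)! * (2 * j - b)! : ℕ) : ℝ)) * sphNorm j b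
      = sphNorm j a * (((b : ℕ)! * (2 * j - b)! : ℕ) : ℝ) := by
  have h : (((a : ℕ)! * (2 * j - a)! * (b : ℕ)! * (2 * j - b)! : ℕ) : ℝ)
      = (((a : ℕ)! * (2 * j - a)! : ℕ) : ℝ) * (((b : ℕ)! * (2 * j - b)! : ℕ) : ℝ) := by
    push_cast; ring
  unfold sphNorm
  rw [h, Real.sqrt_mul (by positivity), Real.sqrt_div (by positivity), Real.sqrt_div (by positivity)]
  have := Real.mul_self_sqrt (show 0 ≤ (((b : ℕ)! * (2 * j - b)! : ℕ) : ℝ) by positivity)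
  linear_combination √(((a : ℕ)! * (2 * j - a)! : ℕ) : ℝ) / √((2 * j)! : ℝ) * this

/-- The square roots in D^j come only from conjugation by the diagonal matrix of the c^j_m. Removing
it leaves entries polynomial in v, w and their conjugates, up to a scalar, which `ring` can handle.
-/
lemma wignerD_mulVec_normalize (j : ℕ) (q : ℍ[ℝ]) (x : Fin (2 * j + 1) → ℂ) :
    wignerD j q *ᵥ normalize j x = normalize j (wignerE j q *ᵥ x) := by
  ext a
  simp only [Matrix.mulVec, dotProduct, normalize, Finset.mul_sum]
  refine Finset.sum_congr rfl fun b _ => ?_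
  have h := congrArg (fun r : ℝ => (r : ℂ)) (sqrt_factorials_mul_sphNorm j a b)
  simp only [Complex.ofReal_mul, Complex.ofReal_natCast] at h
  simp only [wignerD, wignerE, wignerSum, Matrix.of_apply, Matrix.smul_apply, smul_eq_mul,
    div_eq_mul_inv]
  linear_combination ((((‖(⟨q.imK, q.re⟩ : ℂ)‖ ^ 2 + ‖(⟨q.imI, q.imJ⟩ : ℂ)‖ ^ 2) ^ j : ℝ) : ℂ)⁻¹ *
    (Complex.I ^ (2 * j))⁻¹ * (∑ s ∈ (Finset.range (2 * j + 1)).filter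
      (fun s => (b : ℕ) ≤ a + s ∧ s ≤ b ∧ a + s ≤ 2 * j), _)) * x b * h

/-! ### Spin 1 and spin 2 as vectors and symmetric matrices. -/

/-- The squared norm of a quaternion, as a polynomial. -/
def qn (q : ℍ[ℝ]) : ℝ := q.re ^ 2 + q.imI ^ 2 + q.imJ ^ 2 + q.imK ^ 2

/-- The rotation matrix of a quaternion in the basis adapted to the spinor components. -/
def rot (q : ℍ[ℝ]) : Matrix (Fin 3) (Fin 3) ℝ :=
  (qn q)⁻¹ • !![q.re ^ 2 + q.imI ^ 2 - q.imJ ^ 2 - q.imK ^ 2,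
      -(2 * (q.imI * q.imJ - q.re * q.imK)), -(2 * (q.imI * q.imK + q.re * q.imJ));
    -(2 * (q.imI * q.imJ + q.re * q.imK)), q.re ^ 2 - q.imI ^ 2 + q.imJ ^ 2 - q.imK ^ 2,
      2 * (q.imJ * q.imK - q.re * q.imI);
    -(2 * (q.imI * q.imK - q.re * q.imJ)), 2 * (q.imJ * q.imK + q.re * q.imI),
      q.re ^ 2 - q.imI ^ 2 - q.imJ ^ 2 + q.imK ^ 2]

/-- The spin-2 object with the alternating reality property of a real 3×3 matrix. -/
def spinor (A : Matrix (Fin 3) (Fin 3) ℝ) : Fin 5 → ℂ :=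
  ![⟨-(A 0 0 - A 1 1) / 4, (A 0 1 + A 1 0) / 4⟩,
    ⟨(A 0 2 + A 2 0) / 2, -(A 1 2 + A 2 1) / 2⟩,
    ⟨(A 0 0 + A 1 1) / 2 - A 2 2, 0⟩,
    ⟨-(A 0 2 + A 2 0) / 2, -(A 1 2 + A 2 1) / 2⟩,
    ⟨-(A 0 0 - A 1 1) / 4, -(A 0 1 + A 1 0) / 4⟩]

/-- The spin-1 object of a real vector. -/
def spinVec (n : Fin 3 → ℝ) : Fin 3 → ℂ :=
  ![⟨-n 0 / 2, n 1 / 2⟩, ⟨n 2, 0⟩, ⟨n 0 / 2, n 1 / 2⟩]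

lemma qn_pos {q : ℍ[ℝ]} (hq : q ≠ 0) : 0 < qn q := by
  have h : qn q = Quaternion.normSq q := by rw [Quaternion.normSq_def']; rfl
  rw [h]
  exact lt_of_le_of_ne Quaternion.normSq_nonneg (Ne.symm (by simpa using hq))

lemma norm_sq_add_norm_sq (q : ℍ[ℝ]) :
    ‖(⟨q.imK, q.re⟩ : ℂ)‖ ^ 2 + ‖(⟨q.imI, q.imJ⟩ : ℂ)‖ ^ 2 = qn q := by
  rw [Complex.sq_norm, Complex.sq_norm, Complex.normSq_mk, Complex.normSq_mk, qn]; ring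

lemma wignerSum_one (v w v' w' : ℂ) :
    (Matrix.of fun i k : Fin 3 => wignerSum 1 v w v' w' i k) =
      !![v' ^ 2, -w * v', w ^ 2;
        -2 * v' * w', w * w' - v * v', 2 * v * w;
        w' ^ 2, v * w', v ^ 2] := by
  ext a b
  fin_cases a <;> fin_cases b <;>
  · conv_lhs => simp [wignerSum, Finset.sum_filter, Finset.sum_range_succ, Nat.factorial]
    simp only [Fin.zero_eta, Fin.mk_one, Fin.reduceFinMk, Matrix.of_apply, Matrix.cons_val]
    try ring

set_option maxHeartbeats 1000000 in
lemma wignerSum_two (v w v' w' : ℂ) :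
    (Matrix.of fun i k : Fin 5 => wignerSum 2 v w v' w' i k) =
      !![v' ^ 4, -w * v' ^ 3, w ^ 2 * v' ^ 2, - w ^ 3 * v', w ^ 4;
        -4 * v' ^ 3 * w', -v * v' ^ 3 + 3 * w * w' * v' ^ 2,
          2 * w * v * v' ^ 2 - 2 * w ^ 2 * w' * v', -3 * w ^ 2 * v * v' + w ^ 3 * w',
          4 * w ^ 3 * v;
        6 * v' ^ 2 * w' ^ 2, 3 * v * v' ^ 2 * w' - 3 * w * w' ^ 2 * v',
          v ^ 2 * v' ^ 2 - 4 * v * w * v' * w' + w ^ 2 * w' ^ 2,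
          -3 * v ^ 2 * w * v' + 3 * v * w ^ 2 * w', 6 * v ^ 2 * w ^ 2;
        -4 * v' * w' ^ 3, -3 * v * v' * w' ^ 2 + w * w' ^ 3,
          -2 * v ^ 2 * v' * w' + 2 * v * w * w' ^ 2, -v ^ 3 * v' + 3 * v ^ 2 * w * w',
          4 * v ^ 3 * w;
        w' ^ 4, v * w' ^ 3, v ^ 2 * w' ^ 2, v ^ 3 * w', v ^ 4] := by
  ext a b
  fin_cases a <;> fin_cases b <;>
  · conv_lhs => simp [wignerSum, Finset.sum_filter, Finset.sum_range_succ, Nat.factorial]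
    simp only [Fin.zero_eta, Fin.mk_one, Fin.reduceFinMk, Matrix.of_apply, Matrix.cons_val]
    try ring

lemma wignerE_one (q : ℍ[ℝ]) :
    wignerE 1 q = (-(qn q : ℂ)⁻¹) • (Matrix.of fun i k : Fin 3 =>
      wignerSum 1 ⟨q.imK, q.re⟩ ⟨q.imI, q.imJ⟩ ⟨q.imK, -q.re⟩ ⟨q.imI, -q.imJ⟩ i k) := by
  have hI : (Complex.I ^ (2 * 1))⁻¹ = -1 := by rw [pow_mul, Complex.I_sq]; norm_num
  rw [wignerE, norm_sq_add_norm_sq, hI, pow_one, mul_neg_one]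
  rfl

lemma wignerE_two (q : ℍ[ℝ]) :
    wignerE 2 q = ((qn q : ℂ)⁻¹ ^ 2) • (Matrix.of fun i k : Fin 5 =>
      wignerSum 2 ⟨q.imK, q.re⟩ ⟨q.imI, q.imJ⟩ ⟨q.imK, -q.re⟩ ⟨q.imI, -q.imJ⟩ i k) := by
  have hI : (Complex.I ^ (2 * 2))⁻¹ = 1 := by rw [pow_mul, Complex.I_sq]; norm_num
  rw [wignerE, norm_sq_add_norm_sq, hI, mul_one, Complex.ofReal_pow, inv_pow]
  rfl

/-- Spin 1 is the vector representation. With these signs `rot q` is the usual rotation matrix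
conjugated by diag(-1, 1, 1). -/
lemma wignerE_one_spinVec (q : ℍ[ℝ]) (n : Fin 3 → ℝ) :
    wignerE 1 q *ᵥ spinVec n = spinVec (rot q *ᵥ n) := by
  rw [wignerE_one, wignerSum_one, Matrix.smul_mulVec]
  simp only [rot]
  rw [← Complex.ofReal_inv]
  generalize (qn q)⁻¹ = N
  ext i
  fin_cases i <;> apply Complex.ext <;>
  · simp [spinVec, Matrix.mulVec, dotProduct, Fin.sum_univ_succ, pow_two]
    first | ring1 | (ring_nf; simp)

/-- Multiplication of quadratic forms in the basis of unnormalized components. -/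
def quadMul (a b : Fin 3 → ℂ) : Fin 5 → ℂ :=
  ![a 0 * b 0, a 0 * b 1 + a 1 * b 0, a 0 * b 2 + a 1 * b 1 + a 2 * b 0,
    a 1 * b 2 + a 2 * b 1, a 2 * b 2]

set_option maxHeartbeats 1000000 in
-- In unnormalized components the Wigner matrices act on binary forms by linear substitution, which
-- respects products. This reduces spin 2 to spin 1.
lemma wignerE_two_quadMul (q : ℍ[ℝ]) (a b : Fin 3 → ℂ) :
    wignerE 2 q *ᵥ quadMul a b = quadMul (wignerE 1 q *ᵥ a) (wignerE 1 q *ᵥ b) := by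
  rw [wignerE_two, wignerSum_two, wignerE_one, wignerSum_one]
  generalize (qn q : ℂ)⁻¹ = N
  ext i
  fin_cases i <;>
  · simp [quadMul, Matrix.mulVec, dotProduct, Fin.sum_univ_succ]
    ring

lemma spinor_eq_sum (A : Matrix (Fin 3) (Fin 3) ℝ) :
    spinor A = -∑ i, ∑ j, (A i j : ℂ) •
      quadMul (spinVec (Pi.single i 1)) (spinVec (Pi.single j 1)) := by
  ext k
  fin_cases k <;> apply Complex.ext <;>
  · simp [spinor, quadMul, spinVec, Fin.sum_univ_succ]
    try ring

lemma spinVec_mulVec_single (R : Matrix (Fin 3) (Fin 3) ℝ) (j : Fin 3) :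
    spinVec (R *ᵥ Pi.single j 1) = ∑ i, (R i j : ℂ) • spinVec (Pi.single i 1) := by
  ext k
  fin_cases k <;> apply Complex.ext <;>
  · simp [spinVec, Fin.sum_univ_succ]
    try ring

lemma quadMul_sum_smul (c c' : Fin 3 → ℂ) (a : Fin 3 → Fin 3 → ℂ) :
    quadMul (∑ i, c i • a i) (∑ j, c' j • a j) = ∑ i, ∑ j, (c i * c' j) • quadMul (a i) (a j) := by
  ext k
  fin_cases k <;>
  · simp [quadMul, Fin.sum_univ_succ]
    ring

/-- A spinor is minus the contraction of the matrix with products of spin-1 basis vectors, and each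
factor of such a product is rotated by `rot q`. -/
lemma wignerE_two_spinor (q : ℍ[ℝ]) (A : Matrix (Fin 3) (Fin 3) ℝ) :
    wignerE 2 q *ᵥ spinor A = spinor (rot q * A * (rot q)ᵀ) := by
  have h (i j : Fin 3) : wignerE 2 q *ᵥ quadMul (spinVec (Pi.single i 1)) (spinVec (Pi.single j 1))
      = ∑ k, ∑ l, ((rot q k i : ℂ) * rot q l j) •
          quadMul (spinVec (Pi.single k 1)) (spinVec (Pi.single l 1)) := by
    rw [wignerE_two_quadMul, wignerE_one_spinVec, wignerE_one_spinVec, spinVec_mulVec_single,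
      spinVec_mulVec_single, quadMul_sum_smul]
  rw [spinor_eq_sum, spinor_eq_sum, Matrix.mulVec_neg, Matrix.mulVec_sum]
  simp_rw [Matrix.mulVec_sum, Matrix.mulVec_smul, h, Finset.smul_sum, smul_smul]
  congr 1
  ext m
  generalize rot q = R
  generalize (fun i => spinVec (Pi.single i 1)) = e
  simp only [Fin.sum_univ_three, Matrix.mul_apply, Matrix.transpose_apply, Complex.ofReal_add,
    Complex.ofReal_mul, Pi.add_apply, Pi.smul_apply, smul_eq_mul]
  ring

lemma wignerD_two_mulVec (q : ℍ[ℝ]) (A : Matrix (Fin 3) (Fin 3) ℝ) :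
    wignerD 2 q *ᵥ normalize 2 (spinor A) = normalize 2 (spinor (rot q * A * (rot q)ᵀ)) := by
  rw [wignerD_mulVec_normalize, wignerE_two_spinor]

lemma rot_mul_transpose {q : ℍ[ℝ]} (hq : q ≠ 0) : rot q * (rot q)ᵀ = 1 := by
  have h : (qn q)⁻¹ * qn q = 1 := inv_mul_cancel₀ (qn_pos hq).ne'
  have h2 : (qn q)⁻¹ ^ 2 * qn q ^ 2 = 1 := by rw [← mul_pow, h, one_pow]
  rw [rot]
  unfold qn at h2 ⊢
  generalize (_ : ℝ)⁻¹ = N at h2 ⊢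
  ext i j
  fin_cases i <;> fin_cases j <;>
  · simp [Matrix.mul_apply, Fin.sum_univ_succ]
    first | ring1 | linear_combination h2

lemma det_rot {q : ℍ[ℝ]} (hq : q ≠ 0) : (rot q).det = 1 := by
  have h : (qn q)⁻¹ * qn q = 1 := inv_mul_cancel₀ (qn_pos hq).ne'
  have h2 : (qn q)⁻¹ ^ 3 * qn q ^ 3 = 1 := by rw [← mul_pow, h, one_pow]
  rw [rot]
  unfold qn at h2 ⊢
  generalize (_ : ℝ)⁻¹ = N at h2 ⊢
  simp [Matrix.det_fin_three]
  linear_combination h2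

lemma qn_mul (p q : ℍ[ℝ]) : qn (p * q) = qn p * qn q := by
  simp [qn]; ring

lemma rot_mul (p q : ℍ[ℝ]) : rot (p * q) = rot p * rot q := by
  rw [rot, rot, rot, qn_mul, mul_inv]
  generalize (qn p)⁻¹ = N
  generalize (qn q)⁻¹ = N'
  ext i j
  fin_cases i <;> fin_cases j <;>
  · simp [Matrix.mul_apply, Fin.sum_univ_succ]
    ring

lemma rot_inv (q : ℍ[ℝ]) (hq : q ≠ 0) : rot q⁻¹ = (rot q)ᵀ := by
  have h : rot q⁻¹ * rot q = 1 := by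
    rw [← rot_mul, inv_mul_cancel₀ hq]
    ext i j
    fin_cases i <;> fin_cases j <;> simp [rot, qn]
  calc rot q⁻¹ = rot q⁻¹ * (rot q * (rot q)ᵀ) := by rw [rot_mul_transpose hq, mul_one]
    _ = (rot q)ᵀ := by rw [← mul_assoc, h, one_mul]

/-! ### Symmetric traceless matrices and the dual normalization. -/

/-- Symmetric traceless real 3×3 matrices. -/
structure IsSymTraceless (A : Matrix (Fin 3) (Fin 3) ℝ) : Prop where
  symm : Aᵀ = A
  trace : A.trace = 0

lemma IsSymTraceless.exists_eq {A : Matrix (Fin 3) (Fin 3) ℝ} (h : IsSymTraceless A) :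
    ∃ a b c d e : ℝ, A = !![a, b, c; b, d, e; c, e, -a - d] := by
  refine ⟨A 0 0, A 0 1, A 0 2, A 1 1, A 1 2, ?_⟩
  have h1 (i j) : A i j = A j i := congrFun (congrFun h.symm j) i
  have h2 := h.trace
  rw [Matrix.trace_fin_three] at h2
  ext i j
  fin_cases i <;> fin_cases j <;> simp [h1 1 0, h1 2 0, h1 2 1]
  linarith

lemma isSymTraceless_of (a b c d e : ℝ) :
    IsSymTraceless !![a, b, c; b, d, e; c, e, -a - d] := by
  refine ⟨?_, by simp [Matrix.trace_fin_three]⟩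
  ext i j
  fin_cases i <;> fin_cases j <;> rfl

lemma IsSymTraceless.conj {A R : Matrix (Fin 3) (Fin 3) ℝ} (h : IsSymTraceless A)
    (hR : Rᵀ * R = 1) : IsSymTraceless (R * A * Rᵀ) := by
  refine ⟨?_, ?_⟩
  · rw [Matrix.transpose_mul, Matrix.transpose_mul, Matrix.transpose_transpose, h.symm, mul_assoc]
  · rw [Matrix.trace_mul_comm, ← mul_assoc, hR, one_mul, h.trace]

/-- The spin-2 object in the dual normalization of a real 3×3 matrix. -/
def dualSpinor (B : Matrix (Fin 3) (Fin 3) ℝ) : Fin 5 → ℂ :=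
  normalize 2 (normalize 2 (spinor B))

lemma sphNorm_two_sq :
    (fun a => sphNorm 2 a ^ 2) = ![1, 1 / 4, 1 / 6, 1 / 4, 1] := by
  ext a
  unfold sphNorm
  rw [Real.sq_sqrt (by positivity)]
  fin_cases a <;> simp [Nat.factorial] <;> norm_num

lemma dualSpinor_eq (B : Matrix (Fin 3) (Fin 3) ℝ) :
    dualSpinor B = ![⟨-(B 0 0 - B 1 1) / 4, (B 0 1 + B 1 0) / 4⟩,
      ⟨(B 0 2 + B 2 0) / 8, -(B 1 2 + B 2 1) / 8⟩,
      ⟨((B 0 0 + B 1 1) / 2 - B 2 2) / 6, 0⟩,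
      ⟨-(B 0 2 + B 2 0) / 8, -(B 1 2 + B 2 1) / 8⟩,
      ⟨-(B 0 0 - B 1 1) / 4, -(B 0 1 + B 1 0) / 4⟩] := by
  ext a
  have h : dualSpinor B a = ((sphNorm 2 a ^ 2 : ℝ) : ℂ) * spinor B a := by
    simp only [dualSpinor, normalize]; push_cast; ring
  rw [h, congrFun sphNorm_two_sq a]
  fin_cases a <;> apply Complex.ext <;> simp [spinor] <;> ring

lemma dualNormalize_dualSpinor (B : Matrix (Fin 3) (Fin 3) ℝ) :
    dualNormalize 2 (dualSpinor B) = normalize 2 (spinor B) := by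
  ext a
  have h : (sphNorm 2 a : ℂ) ≠ 0 := by exact_mod_cast (sphNorm_pos 2 a).ne'
  simp only [dualNormalize, dualSpinor]
  rw [normalize, inv_mul_cancel_left₀ h]

/-- The two factors c_m in `dualSpinor` are placed so that dividing by one c_m leaves a normalized
spinor. Passing from h to h̊ is then conjugation by the inverse rotation. -/
lemma ringed_dualSpinor {q : ℍ[ℝ]} (hq : q ≠ 0) (B : Matrix (Fin 3) (Fin 3) ℝ) :
    ringed q (dualSpinor B) = dualSpinor ((rot q)ᵀ * B * rot q) := by
  rw [ringed, dualNormalize_dualSpinor, wignerD_two_mulVec, rot_inv q hq,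
    Matrix.transpose_transpose, dualSpinor]

/-! ### Covariance of the symplectic forms. -/

/-- The symplectic forms of the construction, evaluated on two values of the differential of the
coefficients. -/
def spinForms (h x y : Fin 5 → ℂ) : Fin 3 → ℂ :=
  let h' : Fin 5 → ℂ := fun a => conj (h a)
  let du : (Fin 5 → ℂ) → ℂ := fun z =>
    Complex.I * (h' 1 * z 0 + h' 2 * z 1 + h' 3 * z 2 + h' 4 * z 3)
  let dp : (Fin 5 → ℂ) → ℂ := fun z => Complex.I * (h' 2 * z 0 + h' 3 * z 1 + h' 4 * z 2)
  ![-conj (wedge du (fun z => z 4) x y), wedge dp (fun z => z 4) x y + wedge du (fun z => z 3) x y,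
    wedge du (fun z => z 4) x y]

/-- The equivariant antisymmetric matrix underlying the symplectic forms. -/
def formMatrix (B A C : Matrix (Fin 3) (Fin 3) ℝ) : Matrix (Fin 3) (Fin 3) ℝ :=
  (1 / 16 : ℝ) • ((3 : ℝ) • (A * B * C - C * B * A) - (A * C - C * A) * B - B * (A * C - C * A))

/-- The axial vector of an antisymmetric matrix. -/
def axial (W : Matrix (Fin 3) (Fin 3) ℝ) : Fin 3 → ℝ := ![W 2 1, W 0 2, W 1 0]

lemma conj_mk (a b : ℝ) : conj (⟨a, b⟩ : ℂ) = ⟨a, -b⟩ := rfl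

lemma spinForms_zero (h x y : Fin 5 → ℂ) : spinForms h x y 0 = -conj (spinForms h x y 2) := rfl

set_option maxHeartbeats 1000000 in
-- `spinForms` singles out particular components and is not visibly covariant. On the hyperplane cut
-- out by the two trace conditions it agrees with the axial vector of a matrix polynomial, and
-- covariance can be read off there. The multipliers of `hBA` and `hBC` in the proof measure the
-- discrepancy away from the hyperplane.
lemma spinForms_eq {B A C : Matrix (Fin 3) (Fin 3) ℝ} (hB : IsSymTraceless B)
    (hA : IsSymTraceless A) (hC : IsSymTraceless C) (hBA : (B * A).trace = 0)
    (hBC : (B * C).trace = 0) :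
    spinForms (dualSpinor B) (spinor A) (spinor C) = spinVec (axial (formMatrix B A C)) := by
  have h2 : spinForms (dualSpinor B) (spinor A) (spinor C) 2
      = spinVec (axial (formMatrix B A C)) 2 := by
    obtain ⟨b₁, b₂, b₃, b₄, b₅, rfl⟩ := hB.exists_eq
    obtain ⟨a₁, a₂, a₃, a₄, a₅, rfl⟩ := hA.exists_eq
    obtain ⟨c₁, c₂, c₃, c₄, c₅, rfl⟩ := hC.exists_eq
    rw [dualSpinor_eq]
    simp [Matrix.trace_fin_three] at hBA hBC
    apply Complex.ext <;>
      simp [spinForms, spinVec, spinor, axial, formMatrix, wedge, conj_mk]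
    · linear_combination (-1/16) * (c₅ * hBA - a₅ * hBC)
    · linear_combination (1/16) * (c₃ * hBA - a₃ * hBC)
  ext k
  fin_cases k
  · change spinForms _ _ _ 0 = _
    rw [spinForms_zero, h2]
    simp [spinVec, conj_mk, Complex.ext_iff, neg_div]
  · obtain ⟨b₁, b₂, b₃, b₄, b₅, rfl⟩ := hB.exists_eq
    obtain ⟨a₁, a₂, a₃, a₄, a₅, rfl⟩ := hA.exists_eq
    obtain ⟨c₁, c₂, c₃, c₄, c₅, rfl⟩ := hC.exists_eq
    rw [dualSpinor_eq]
    simp [Matrix.trace_fin_three] at hBA hBC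
    apply Complex.ext <;>
      simp [spinForms, spinVec, spinor, axial, formMatrix, wedge, conj_mk]
    · ring
    · linear_combination (3/32) * ((a₁ + a₄) * hBC - (c₁ + c₄) * hBA)
  · exact h2

lemma formMatrix_conj {R : Matrix (Fin 3) (Fin 3) ℝ} (hR : Rᵀ * R = 1)
    (B A C : Matrix (Fin 3) (Fin 3) ℝ) :
    formMatrix (R * B * Rᵀ) (R * A * Rᵀ) (R * C * Rᵀ) = R * formMatrix B A C * Rᵀ := by
  have h2 (X Y : Matrix (Fin 3) (Fin 3) ℝ) : (R * X * Rᵀ) * (R * Y * Rᵀ) = R * (X * Y) * Rᵀ := by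
    calc _ = R * X * (Rᵀ * R) * Y * Rᵀ := by simp only [mul_assoc]
      _ = _ := by rw [hR, mul_one]; simp only [mul_assoc]
  have hs (X Y : Matrix (Fin 3) (Fin 3) ℝ) : R * X * Rᵀ - R * Y * Rᵀ = R * (X - Y) * Rᵀ := by
    rw [Matrix.mul_sub, Matrix.sub_mul]
  have hm (c : ℝ) (X : Matrix (Fin 3) (Fin 3) ℝ) : c • (R * X * Rᵀ) = R * (c • X) * Rᵀ := by
    rw [Matrix.mul_smul, Matrix.smul_mul]
  simp only [formMatrix, h2, hs, hm]

/-- For a rotation the adjugate equals the transpose, so the 2×2 minors of R are its entries. This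
is the invariance of the cross product. -/
lemma axial_conj {R : Matrix (Fin 3) (Fin 3) ℝ} (hR : Rᵀ * R = 1) (hd : R.det = 1)
    {W : Matrix (Fin 3) (Fin 3) ℝ} (hW : Wᵀ = -W) :
    axial (R * W * Rᵀ) = R *ᵥ axial W := by
  have had : R.adjugate = Rᵀ := by
    calc R.adjugate = Rᵀ * R * R.adjugate := by rw [hR, one_mul]
      _ = Rᵀ := by rw [mul_assoc, Matrix.mul_adjugate, hd, one_smul, mul_one]
  rw [Matrix.adjugate_fin_three] at had
  have hc (i j) := congrFun (congrFun had i) j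
  have hw (i j) : W i j = -W j i := congrFun (congrFun hW j) i
  have h0 (i) : W i i = 0 := by linarith [hw i i]
  have h00 := hc 0 0
  have h01 := hc 0 1
  have h02 := hc 0 2
  have h10 := hc 1 0
  have h11 := hc 1 1
  have h12 := hc 1 2
  have h20 := hc 2 0
  have h21 := hc 2 1
  have h22 := hc 2 2
  simp only [Matrix.of_apply, Matrix.cons_val, Matrix.transpose_apply] at h00 h01 h02 h10 h11 h12 h20 h21 h22
  obtain ⟨a, b, c, rfl⟩ : ∃ a b c : ℝ, W = !![0, -c, b; c, 0, -a; -b, a, 0] := by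
    refine ⟨W 2 1, W 0 2, W 1 0, ?_⟩
    ext i j
    fin_cases i <;> fin_cases j <;> first | rfl | exact h0 _ | exact hw _ _
  ext i
  simp only [axial, Matrix.mul_apply, Matrix.mulVec, dotProduct, Fin.sum_univ_three,
    Matrix.transpose_apply, Matrix.of_apply, Matrix.cons_val]
  fin_cases i <;> simp only [Matrix.cons_val, Fin.zero_eta, Fin.mk_one, Fin.reduceFinMk]
  · linear_combination a * h00 + b * h10 + c * h20
  · linear_combination a * h01 + b * h11 + c * h21
  · linear_combination a * h02 + b * h12 + c * h22

lemma formMatrix_transpose {B A C : Matrix (Fin 3) (Fin 3) ℝ} (hB : IsSymTraceless B)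
    (hA : IsSymTraceless A) (hC : IsSymTraceless C) :
    (formMatrix B A C)ᵀ = -formMatrix B A C := by
  simp only [formMatrix, Matrix.transpose_smul, Matrix.transpose_sub, Matrix.transpose_mul,
    hA.symm, hB.symm, hC.symm, ← smul_neg]
  congr 1
  simp only [smul_sub, neg_sub, sub_mul, mul_sub, mul_assoc]
  abel

lemma spinForms_rot {q : ℍ[ℝ]} (hq : q ≠ 0) {B A C : Matrix (Fin 3) (Fin 3) ℝ}
    (hB : IsSymTraceless B) (hA : IsSymTraceless A) (hC : IsSymTraceless C)
    (hBA : (B * A).trace = 0) (hBC : (B * C).trace = 0) :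
    spinForms (dualSpinor (rot q * B * (rot q)ᵀ)) (spinor (rot q * A * (rot q)ᵀ))
        (spinor (rot q * C * (rot q)ᵀ))
      = spinVec (rot q *ᵥ axial (formMatrix B A C)) := by
  have hR := mul_eq_one_comm.1 (rot_mul_transpose hq)
  have ht {X : Matrix (Fin 3) (Fin 3) ℝ} (h : (B * X).trace = 0) :
      (rot q * B * (rot q)ᵀ * (rot q * X * (rot q)ᵀ)).trace = 0 := by
    rw [← h, Matrix.trace_mul_comm B X]
    calc _ = (rot q * B * ((rot q)ᵀ * rot q) * X * (rot q)ᵀ).trace := by simp only [mul_assoc]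
      _ = _ := by rw [hR, mul_one, Matrix.trace_mul_comm, ← mul_assoc, ← mul_assoc, hR, one_mul,
        Matrix.trace_mul_comm]
  rw [spinForms_eq (hB.conj hR) (hA.conj hR) (hC.conj hR) (ht hBA) (ht hBC), formMatrix_conj hR,
    axial_conj hR (det_rot hq) (formMatrix_transpose hB hA hC)]

/-! ### Reality and the invariants of `h`. -/

lemma IsAltReal.conj_four {h : Fin 5 → ℂ} (hh : IsAltReal h) : conj (h 4) = h 0 := by
  have := hh 4; norm_num [Fin.rev] at this; exact this

lemma IsAltReal.conj_three {h : Fin 5 → ℂ} (hh : IsAltReal h) : conj (h 3) = -h 1 := by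
  have := hh 3; simpa [Fin.rev, pow_succ] using this

lemma IsAltReal.conj_two {h : Fin 5 → ℂ} (hh : IsAltReal h) : conj (h 2) = h 2 := by
  have := hh 2; simpa [Fin.rev] using this

lemma IsAltReal.conj_one {h : Fin 5 → ℂ} (hh : IsAltReal h) : conj (h 1) = -h 3 := by
  have := hh 1; simpa [Fin.rev] using this

lemma IsAltReal.conj_zero {h : Fin 5 → ℂ} (hh : IsAltReal h) : conj (h 0) = h 4 := by
  have := hh 0; simpa [Fin.rev] using this

lemma isAltReal_iff {h : Fin 5 → ℂ} :
    IsAltReal h ↔ conj (h 4) = h 0 ∧ conj (h 3) = -h 1 ∧ conj (h 2) = h 2 := by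
  refine ⟨fun hh => ⟨hh.conj_four, hh.conj_three, hh.conj_two⟩, fun ⟨h4, h3, h2⟩ a => ?_⟩
  fin_cases a
  · simp [Fin.rev, ← h4]
  · have := congrArg conj h3
    simp only [Complex.conj_conj, map_neg] at this
    simp [Fin.rev, this]
  · simp [Fin.rev, h2]
  · simp [Fin.rev, h3, pow_succ]
  · norm_num [Fin.rev]
    exact h4

lemma isAltReal_spinor (A : Matrix (Fin 3) (Fin 3) ℝ) : IsAltReal (spinor A) := by
  rw [isAltReal_iff]
  refine ⟨?_, ?_, ?_⟩ <;> simp [spinor, Complex.ext_iff] <;> ring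

lemma isAltReal_dualSpinor (A : Matrix (Fin 3) (Fin 3) ℝ) : IsAltReal (dualSpinor A) := by
  rw [isAltReal_iff, dualSpinor_eq]
  refine ⟨?_, ?_, ?_⟩ <;> simp [Complex.ext_iff] <;> ring

/-- The Hankel determinant of a spin-2 object. -/
def hankelDet (h : Fin 5 → ℂ) : ℂ :=
  h 4 * h 2 * h 0 + 2 * h 3 * h 2 * h 1 - h 2 ^ 3 - h 4 * h 1 ^ 2 - h 3 ^ 2 * h 0

lemma r₃_dualNormalize (h : Fin 5 → ℂ) : r₃ (dualNormalize 2 h) = hankelDet h := by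
  have e : normalize 2 (dualNormalize 2 h) = h := by
    ext a
    have h : (sphNorm 2 a : ℂ) ≠ 0 := by exact_mod_cast (sphNorm_pos 2 a).ne'
    rw [normalize, dualNormalize, mul_inv_cancel_left₀ h]
  rw [r₃, e]
  simp [Matrix.det_fin_three, hankelDet]
  ring

/-- Reality turns the Hermitian norm into the holomorphic quadratic invariant of the quartic, so
that later identities are polynomial in the components. -/
lemma r₂_dualNormalize {h : Fin 5 → ℂ} (hh : IsAltReal h) :
    (r₂ (dualNormalize 2 h) : ℂ) = h 4 * h 0 - 4 * h 1 * h 3 + 3 * h 2 ^ 2 := by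
  have hn (z : ℂ) : ((‖z‖ ^ 2 : ℝ) : ℂ) = z * conj z := by
    rw [Complex.mul_conj, Complex.normSq_eq_norm_sq]
  have hs (a : Fin 5) : ((‖dualNormalize 2 h a‖ ^ 2 : ℝ) : ℂ)
      = ((sphNorm 2 a ^ 2 : ℝ) : ℂ)⁻¹ * (h a * conj (h a)) := by
    rw [hn, dualNormalize, map_mul, map_inv₀, Complex.conj_ofReal]
    push_cast
    ring
  have hq (a : Fin 5) := congrFun sphNorm_two_sq a
  rw [r₂]
  push_cast
  simp only [← Complex.ofReal_pow, hs, hq, Fin.sum_univ_five, hh.conj_zero, hh.conj_one,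
    hh.conj_two, hh.conj_three, hh.conj_four]
  simp
  ring

lemma composite_eq {h : Fin 5 → ℂ} (hh : IsAltReal h) :
    composite h = ![h 0 * h 2 - h 1 ^ 2, (h 0 * h 3 - h 1 * h 2) / 2,
      h 4 * h 0 / 6 + h 3 * h 1 / 3 - h 2 * h 2 / 2, (h 4 * h 1 - h 3 * h 2) / 2,
      h 4 * h 2 - h 3 ^ 2] := by
  ext a
  fin_cases a <;>
  · simp [composite, hh.conj_one, hh.conj_two, hh.conj_three, hh.conj_four, Complex.conj_ofNat]
    try ring

lemma Hprime_eq {h : Fin 5 → ℂ} (hh : IsAltReal h) : Hprime h = h 1 * h 3 - h 2 ^ 2 := by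
  rw [Hprime, r₂_dualNormalize hh, composite_eq hh]
  simp
  ring

/-- This is the Desnanot–Jacobi identity for the Hankel matrix: the corner minors are H_2, H_{-2}
and twice H'_0, and the central entry is h_0. -/
lemma Hprime_sq_sub (h : Fin 5 → ℂ) :
    (h 1 * h 3 - h 2 ^ 2) ^ 2 - (h 4 * h 2 - h 3 ^ 2) * (h 0 * h 2 - h 1 ^ 2)
      = -h 2 * hankelDet h := by
  rw [hankelDet]; ring

/-- By reality h_1 h_{-1} - h_0² is minus a sum of two squared norms. -/
lemma Hprime_ne_zero {h : Fin 5 → ℂ} (hh : IsAltReal h) (h2 : h 2 ≠ 0) : Hprime h ≠ 0 := by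
  rw [Hprime_eq hh]
  have h1 : h 1 * h 3 - h 2 ^ 2 = ((-(‖h 3‖ ^ 2 + ‖h 2‖ ^ 2) : ℝ) : ℂ) := by
    have e3 : (h 3) * conj (h 3) = ((‖h 3‖ ^ 2 : ℝ) : ℂ) := by
      rw [Complex.mul_conj, Complex.normSq_eq_norm_sq]
    have e2 : (h 2) * conj (h 2) = ((‖h 2‖ ^ 2 : ℝ) : ℂ) := by
      rw [Complex.mul_conj, Complex.normSq_eq_norm_sq]
    rw [hh.conj_three] at e3
    rw [hh.conj_two] at e2
    rw [Complex.ofReal_neg, Complex.ofReal_add, ← e3, ← e2]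
    ring
  rw [h1]
  have : 0 < ‖h 2‖ := norm_pos_iff.2 h2
  exact_mod_cast (neg_lt_zero.2 (by positivity : 0 < ‖h 3‖ ^ 2 + ‖h 2‖ ^ 2)).ne

lemma conj_Hprime {h : Fin 5 → ℂ} (hh : IsAltReal h) : conj (Hprime h) = Hprime h := by
  rw [Hprime_eq hh]
  simp [hh.conj_one, hh.conj_three, hh.conj_two]
  ring

lemma conj_hankelDet {h : Fin 5 → ℂ} (hh : IsAltReal h) : conj (hankelDet h) = hankelDet h := by
  simp [hankelDet, hh.conj_one, hh.conj_three, hh.conj_two, hh.conj_four, hh.conj_zero,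
    Complex.conj_ofNat]
  ring

/-- The outer rows contribute H'_0 twice; the middle 2×2 block has determinant H'_0² - H_2 H_{-2},
evaluated by `Hprime_sq_sub`. -/
lemma det_thetaToChi {h : Fin 5 → ℂ} (hh : IsAltReal h) :
    (thetaToChi h).det = -(Hprime h ^ 2 * (h 2 * hankelDet h)) := by
  have hK := Hprime_sq_sub h
  rw [← Hprime_eq hh] at hK
  simp [thetaToChi, Matrix.det_succ_row_zero, Fin.sum_univ_succ, Fin.succAbove, composite_eq hh]
  linear_combination Hprime h ^ 2 * hK

/-! ### The constraint and the θ-frame. -/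

/-- The pairing of spin-2 objects that expresses the constraint on the differential of the
coefficients. -/
def Constraint (h x : Fin 5 → ℂ) : Prop := ∑ a, conj (h a) * x a = 0

lemma Constraint.eq {h x : Fin 5 → ℂ} (hx : Constraint h x) (hh : IsAltReal h) :
    h 4 * x 0 - h 3 * x 1 + h 2 * x 2 - h 1 * x 3 + h 0 * x 4 = 0 := by
  rw [Constraint, Fin.sum_univ_five, hh.conj_zero, hh.conj_one, hh.conj_two, hh.conj_three,
    hh.conj_four] at hx
  linear_combination hx

section Frame

variable {h x y : Fin 5 → ℂ} {t s : Fin 4 → ℂ}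

lemma thetaToChi_mulVec (hh : IsAltReal h) (hx : thetaToChi h *ᵥ t = ![x 4, x 3, x 1, x 0]) :
    x 4 = Hprime h * t 0 ∧
    x 3 = (h 0 * h 3 - h 1 * h 2) * t 0 + Hprime h * t 1 + (h 4 * h 2 - h 3 ^ 2) * t 2 ∧
    x 1 = (h 0 * h 2 - h 1 ^ 2) * t 1 + Hprime h * t 2 + (h 4 * h 1 - h 3 * h 2) * t 3 ∧
    x 0 = Hprime h * t 3 := by
  have h0 := congrFun hx 0
  have h1 := congrFun hx 1
  have h2 := congrFun hx 2
  have h3 := congrFun hx 3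
  simp [thetaToChi, composite_eq hh, Matrix.mulVec, dotProduct, Fin.sum_univ_four] at h0 h1 h2 h3
  refine ⟨h0.symm, ?_, ?_, h3.symm⟩
  · linear_combination -h1
  · linear_combination -h2

/-- The outer rows give the first relation, as H'_0 is real and non-zero. Conjugating the row of x_1
and comparing with that of x_{-1} gives a homogeneous 2×2 system for the defect in the second
relation, with determinant H'_0² - H_2 H_{-2} ≠ 0. -/
lemma theta_reality (hh : IsAltReal h) (hxr : IsAltReal x) (hd : (thetaToChi h).det ≠ 0)
    (hx : thetaToChi h *ᵥ t = ![x 4, x 3, x 1, x 0]) : t 3 = conj (t 0) ∧ t 2 = -conj (t 1) := by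
  rw [det_thetaToChi hh] at hd
  have hP : Hprime h ≠ 0 := fun h0 => hd (by rw [h0]; ring)
  have hK := Hprime_sq_sub h
  rw [← Hprime_eq hh] at hK
  obtain ⟨e4, e3, e1, e0⟩ := thetaToChi_mulVec hh hx
  have h3 : t 3 = conj (t 0) := by
    have := congrArg conj e4
    rw [hxr.conj_four, e0, map_mul, conj_Hprime hh] at this
    exact mul_left_cancel₀ hP this
  refine ⟨h3, ?_⟩
  have c3 := congrArg conj e3
  simp only [map_add, map_mul, map_sub, map_pow, conj_Hprime hh, hh.conj_zero, hh.conj_one,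
    hh.conj_two, hh.conj_three, hh.conj_four, hxr.conj_three, ← h3] at c3
  have hd1 : (h 0 * h 2 - h 1 ^ 2) * (t 1 + conj (t 2)) + Hprime h * (t 2 + conj (t 1)) = 0 := by
    linear_combination -e1 - c3
  have hd2 := congrArg conj hd1
  -- The conjugate of `hd1` is the second equation of the system; eliminating t₁ + conj t₂ leaves
  -- the determinant times t₂ + conj t₁.
  simp only [map_add, map_mul, map_sub, map_pow, conj_Hprime hh, hh.conj_zero, hh.conj_one,
    hh.conj_two, Complex.conj_conj, map_zero] at hd2
  have : Hprime h ^ 2 * (h 2 * hankelDet h) * (t 2 + conj (t 1)) = 0 := by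
    linear_combination (-Hprime h ^ 3) * hd1 + Hprime h ^ 2 * (h 0 * h 2 - h 1 ^ 2) * hd2 +
      (Hprime h ^ 2 * (t 2 + conj (t 1))) * hK
  have h' := (mul_eq_zero.1 this).resolve_left (neg_ne_zero.1 hd)
  linear_combination h'

/-- The symplectic form of weight `+1`, eliminating the component `x_0`. -/
lemma spinForms_two_mul (hh : IsAltReal h) (hx : Constraint h x) (hy : Constraint h y) :
    h 2 * spinForms h x y 2 = Complex.I / 2 *
      ((h 4 * h 1 - h 3 * h 2) * (x 0 * y 4 - y 0 * x 4) -
        (h 1 * h 3 - h 2 ^ 2) * (x 1 * y 4 - y 1 * x 4) +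
        (h 0 * h 2 - h 1 ^ 2) * (x 3 * y 4 - y 3 * x 4)) := by
  simp only [spinForms, wedge, hh.conj_one, hh.conj_two, hh.conj_three, hh.conj_four,
    Matrix.cons_val]
  linear_combination Complex.I / 2 * (-h 1) * (hx.eq hh * y 4 - hy.eq hh * x 4)

lemma spinForms_one_mul (hh : IsAltReal h) (hx : Constraint h x) (hy : Constraint h y) :
    h 2 * spinForms h x y 1 = Complex.I / 2 *
      ((h 2 ^ 2 - h 0 * h 4) * (x 0 * y 4 - y 0 * x 4) +
        (h 0 * h 3 - h 1 * h 2) * (x 1 * y 4 - y 1 * x 4) +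
        (h 4 * h 1 - h 3 * h 2) * (x 0 * y 3 - y 0 * x 3) -
        (h 1 * h 3 - h 2 ^ 2) * (x 1 * y 3 - y 1 * x 3)) := by
  simp only [spinForms, wedge, hh.conj_one, hh.conj_two, hh.conj_three, hh.conj_four,
    Matrix.cons_val]
  linear_combination Complex.I / 2 * (h 0 * (hx.eq hh * y 4 - hy.eq hh * x 4) -
    h 1 * (hx.eq hh * y 3 - hy.eq hh * x 3))

lemma spinForms_zero_mul (hh : IsAltReal h) (hxr : IsAltReal x) (hyr : IsAltReal y)
    (hx : Constraint h x) (hy : Constraint h y) :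
    h 2 * spinForms h x y 0 = Complex.I / 2 *
      ((h 0 * h 3 - h 1 * h 2) * (x 0 * y 4 - y 0 * x 4) -
        (h 1 * h 3 - h 2 ^ 2) * (x 0 * y 3 - y 0 * x 3) +
        (h 4 * h 2 - h 3 ^ 2) * (x 0 * y 1 - y 0 * x 1)) := by
  have := congrArg conj (spinForms_two_mul hh hx hy)
  rw [spinForms_zero]
  simp only [map_add, map_mul, map_sub, map_pow, map_div₀, Complex.conj_I, Complex.conj_ofNat,
    hh.conj_zero, hh.conj_one, hh.conj_two, hh.conj_three, hh.conj_four, hxr.conj_zero,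
    hxr.conj_one, hxr.conj_three, hxr.conj_four, hyr.conj_zero, hyr.conj_one, hyr.conj_three,
    hyr.conj_four] at this
  linear_combination -this

lemma spinForms_two_eq (hh : IsAltReal h) (h2 : h 2 ≠ 0) (hx : Constraint h x)
    (hy : Constraint h y) (hxt : thetaToChi h *ᵥ t = ![x 4, x 3, x 1, x 0])
    (hys : thetaToChi h *ᵥ s = ![y 4, y 3, y 1, y 0]) :
    spinForms h x y 2 =
      -(hankelDet h * Hprime h) * Complex.I * ((t 0 * s 2 - s 0 * t 2) / 2) := by
  apply mul_left_cancel₀ h2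
  rw [spinForms_two_mul hh hx hy]
  obtain ⟨e4, e3, e1, e0⟩ := thetaToChi_mulVec hh hxt
  obtain ⟨f4, f3, f1, f0⟩ := thetaToChi_mulVec hh hys
  rw [e4, e3, e1, e0, f4, f3, f1, f0, Hprime_eq hh, hankelDet]
  ring

/-- Multiplication by h_0 clears the denominator left by eliminating the component of label 0. After
inserting the θ's all other products cancel, and the common factor h_0 r₃ H'_0 remains. -/
lemma spinForms_one_eq (hh : IsAltReal h) (h2 : h 2 ≠ 0) (hx : Constraint h x)
    (hy : Constraint h y) (hxt : thetaToChi h *ᵥ t = ![x 4, x 3, x 1, x 0])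
    (hys : thetaToChi h *ᵥ s = ![y 4, y 3, y 1, y 0]) :
    spinForms h x y 1 = -(hankelDet h * Hprime h) * Complex.I *
      ((t 1 * s 2 - s 1 * t 2) / 2 + (t 0 * s 3 - s 0 * t 3) / 2) := by
  apply mul_left_cancel₀ h2
  rw [spinForms_one_mul hh hx hy]
  obtain ⟨e4, e3, e1, e0⟩ := thetaToChi_mulVec hh hxt
  obtain ⟨f4, f3, f1, f0⟩ := thetaToChi_mulVec hh hys
  rw [e4, e3, e1, e0, f4, f3, f1, f0, Hprime_eq hh, hankelDet]
  ring

end Frame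

lemma spinForms_eq_canonicalForms {T : Type*} {h : Fin 5 → ℂ} {ξ : T → Fin 5 → ℂ}
    {t : T → Fin 4 → ℂ} {lam : ℝ} (hh : IsAltReal h) (h2 : h 2 ≠ 0)
    (hd : (thetaToChi h).det ≠ 0) (hξr : ∀ X, IsAltReal (ξ X)) (hξ : ∀ X, Constraint h (ξ X))
    (ht : ∀ X, thetaToChi h *ᵥ t X = ![ξ X 4, ξ X 3, ξ X 1, ξ X 0])
    (hlam : (lam : ℂ) = hankelDet h * Hprime h) (X Y : T) (m : Fin 3) :
    spinForms h (ξ X) (ξ Y) m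
      = canonicalForms lam (fun X => t X 1) (fun X => t X 0) m X Y := by
  have hr (X) := theta_reality hh (hξr X) hd (ht X)
  have e2 : spinForms h (ξ X) (ξ Y) 2
      = canonicalForms lam (fun X => t X 1) (fun X => t X 0) 2 X Y := by
    rw [spinForms_two_eq hh h2 (hξ X) (hξ Y) (ht X) (ht Y), (hr X).2, (hr Y).2]
    simp only [canonicalForms, wedge, Matrix.cons_val, hlam]
    ring
  fin_cases m
  · change spinForms h (ξ X) (ξ Y) 0 = _
    rw [spinForms_zero, e2]
    simp only [canonicalForms, wedge, Matrix.cons_val, map_mul, map_sub, map_div₀,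
      Complex.conj_I, Complex.conj_ofNat, Complex.conj_conj, Complex.conj_ofReal]
    simp
  · change spinForms h (ξ X) (ξ Y) 1 = _
    rw [spinForms_one_eq hh h2 (hξ X) (hξ Y) (ht X) (ht Y), (hr X).2, (hr Y).2, (hr X).1, (hr Y).1]
    simp only [canonicalForms, wedge, Matrix.cons_val, hlam, Fin.mk_one]
    ring
  · exact e2

/-! ### Vanishing of all products of the forms when the Hankel determinant is zero. -/

/-- The pairing `η ∧ η'` of 2-forms, evaluated on four vectors. -/
def pfaffianPairing {T : Type*} (e : Fin 4 → T) (η η' : T → T → ℂ) : ℂ :=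
  η (e 0) (e 1) * η' (e 2) (e 3) - η (e 0) (e 2) * η' (e 1) (e 3) +
    η (e 0) (e 3) * η' (e 1) (e 2) + η (e 1) (e 2) * η' (e 0) (e 3) -
    η (e 1) (e 3) * η' (e 0) (e 2) + η (e 2) (e 3) * η' (e 0) (e 1)

/-- The 2-form with given Plücker coordinates in a coframe of four 1-forms. -/
def plueckerForm {T : Type*} (c : Fin 6 → ℂ) (α β γ δ : T → ℂ) (X Y : T) : ℂ :=
  c 0 * (α X * β Y - α Y * β X) + c 1 * (α X * γ Y - α Y * γ X) +
    c 2 * (α X * δ Y - α Y * δ X) + c 3 * (β X * γ Y - β Y * γ X) +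
    c 4 * (β X * δ Y - β Y * δ X) + c 5 * (γ X * δ Y - γ Y * δ X)

/-- The product of two 2-forms spanned by four 1-forms is the Plücker pairing of their coefficients
times the determinant of those 1-forms on the four vectors. -/
lemma pfaffianPairing_plueckerForm_eq_zero {T : Type*} (e : Fin 4 → T) (α β γ δ : T → ℂ)
    {c c' : Fin 6 → ℂ} (h : c 0 * c' 5 - c 1 * c' 4 + c 2 * c' 3 + c 3 * c' 2 - c 4 * c' 1 +
      c 5 * c' 0 = 0) :
    pfaffianPairing e (plueckerForm c α β γ δ) (plueckerForm c' α β γ δ) = 0 := by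
  rw [← zero_mul (Matrix.det !![α (e 0), α (e 1), α (e 2), α (e 3);
    β (e 0), β (e 1), β (e 2), β (e 3); γ (e 0), γ (e 1), γ (e 2), γ (e 3);
    δ (e 0), δ (e 1), δ (e 2), δ (e 3)]), ← h]
  simp [Matrix.det_succ_row_zero, Fin.sum_univ_succ, Fin.succAbove, pfaffianPairing, plueckerForm]
  ring

/-- After elimination of the component of label 0, every Plücker pairing of two of the three forms
is a numerical multiple of r₃ / h_0. Hence a non-zero product anywhere forces r₃ ≠ 0. -/
lemma pfaffianPairing_spinForms_eq_zero {T : Type*} {h : Fin 5 → ℂ} {ξ : T → Fin 5 → ℂ}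
    (hh : IsAltReal h) (h2 : h 2 ≠ 0) (hξr : ∀ X, IsAltReal (ξ X))
    (hξ : ∀ X, Constraint h (ξ X)) (h0 : hankelDet h = 0) (e : Fin 4 → T) (j k : Fin 3) :
    pfaffianPairing e (fun X Y => spinForms h (ξ X) (ξ Y) j)
      (fun X Y => spinForms h (ξ X) (ξ Y) k) = 0 := by
  obtain ⟨c, hc, hq⟩ : ∃ c : Fin 3 → Fin 6 → ℂ,
      (∀ j, (fun X Y => spinForms h (ξ X) (ξ Y) j) = plueckerForm (c j) (fun X => ξ X 0)
        (fun X => ξ X 1) (fun X => ξ X 3) (fun X => ξ X 4)) ∧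
      ∀ j k, c j 0 * c k 5 - c j 1 * c k 4 + c j 2 * c k 3 + c j 3 * c k 2 - c j 4 * c k 1 +
        c j 5 * c k 0 = 0 := by
    refine ⟨fun j => ((h 2)⁻¹ * (Complex.I / 2)) • ![![h 4 * h 2 - h 3 ^ 2,
      -(h 1 * h 3 - h 2 ^ 2), h 0 * h 3 - h 1 * h 2, 0, 0, 0],
      ![0, h 4 * h 1 - h 3 * h 2, h 2 ^ 2 - h 0 * h 4, -(h 1 * h 3 - h 2 ^ 2),
        h 0 * h 3 - h 1 * h 2, 0],
      ![0, 0, h 4 * h 1 - h 3 * h 2, 0, -(h 1 * h 3 - h 2 ^ 2), h 0 * h 2 - h 1 ^ 2]] j, ?_, ?_⟩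
    · intro j
      ext X Y
      apply mul_left_cancel₀ h2
      fin_cases j
      · change h 2 * spinForms h (ξ X) (ξ Y) 0 = _
        rw [spinForms_zero_mul hh (hξr X) (hξr Y) (hξ X) (hξ Y)]
        simp [plueckerForm]
        field_simp
        ring
      · change h 2 * spinForms h (ξ X) (ξ Y) 1 = _
        rw [spinForms_one_mul hh (hξ X) (hξ Y)]
        simp [plueckerForm]
        field_simp
        ring
      · change h 2 * spinForms h (ξ X) (ξ Y) 2 = _
        rw [spinForms_two_mul hh (hξ X) (hξ Y)]
        simp [plueckerForm]
        field_simp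
        ring
    · rw [hankelDet] at h0
      intro j k
      generalize (h 2)⁻¹ * (Complex.I / 2) = N
      have h1 := congrArg (N ^ 2 * h 2 * ·) h0
      simp only [mul_zero] at h1
      fin_cases j <;> fin_cases k <;> simp <;> first
        | ring1
        | linear_combination h1
        | linear_combination -h1
        | linear_combination (2 : ℂ) * h1
        | linear_combination (-2 : ℂ) * h1
  rw [hc, hc]
  exact pfaffianPairing_plueckerForm_eq_zero e _ _ _ _ (hq j k)

/-! ### From the canonical triplet to the metric. -/

/-- Each real form is b(X, J_a Y). Non-degeneracy of b makes I₁ = ω₃⁻¹ω₂ equal to J₁, and then g =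
-ω₁(·, I₁ ·) has no choice but b. -/
lemma isHyperkahlerMetric_iff {T : Type*} [AddCommGroup T] [Module ℝ T] {Ω : Fin 3 → T → T → ℂ}
    {b : T →ₗ[ℝ] T →ₗ[ℝ] ℝ} (hb : ∀ X, (∀ Y, b X Y = 0) → X = 0)
    {J₁ J₂ J₃ : T →ₗ[ℝ] T} (h₁ : ∀ X, J₁ (J₁ X) = -X) (h₂ : ∀ X, J₂ (J₂ X) = -X)
    (h₃ : ∀ X, J₃ (J₃ X) = -X) (h₁₂ : ∀ X, J₁ (J₂ X) = J₃ X) (h₁₃ : ∀ X, J₁ (J₃ X) = -J₂ X)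
    (h₂₁ : ∀ X, J₂ (J₁ X) = -J₃ X) (h₃₂ : ∀ X, J₃ (J₂ X) = -J₁ X)
    (s₁ : ∀ X Y, b (J₁ X) Y = -b X (J₁ Y)) (s₂ : ∀ X Y, b (J₂ X) Y = -b X (J₂ Y))
    (s₃ : ∀ X Y, b (J₃ X) Y = -b X (J₃ Y))
    (hΩ : ∀ X Y, (fun m => Ω m X Y) = spinVec ![b X (J₁ Y), b X (J₂ Y), b X (J₃ Y)])
    (g : T → T → ℝ) : IsHyperkahlerMetric Ω g ↔ ∀ X Y, g X Y = b X Y := by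
  have e0 (X Y) : Ω 0 X Y = ⟨-b X (J₁ Y) / 2, b X (J₂ Y) / 2⟩ := congrFun (hΩ X Y) 0
  have e1 (X Y) : Ω 1 X Y = ⟨b X (J₃ Y), 0⟩ := congrFun (hΩ X Y) 1
  have e2 (X Y) : Ω 2 X Y = ⟨b X (J₁ Y) / 2, b X (J₂ Y) / 2⟩ := congrFun (hΩ X Y) 2
  constructor
  · rintro ⟨ω₁, ω₂, ω₃, I₁, I₂, I₃, w2, w1, -, i1, -, -, -, -, -, -, g1, -, -⟩ X Y
    have r1 (X Y) : ω₁ X Y = b X (J₁ Y) := by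
      have := congrArg Complex.re (w2 X Y)
      rw [e2] at this
      simp at this
      linarith
    have r2 (X Y) : ω₂ X Y = b X (J₂ Y) := by
      have := congrArg Complex.im (w2 X Y)
      rw [e2] at this
      simp at this
      linarith
    have r3 (X Y) : ω₃ X Y = b X (J₃ Y) := by
      have := congrArg Complex.re (w1 X Y)
      rw [e1] at this
      simp at this
      linarith
    have hI (X) : I₁ X = J₁ X := by
      rw [← sub_eq_zero]
      refine hb _ fun Y => ?_
      -- The argument -J₃Y turns ω₃(I₁X, ·) into b(I₁X, Y), and ω₂(X, ·) into -b(X, J₂J₃Y) = b(J₁X,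
      -- Y).
      have := i1 X (-J₃ Y)
      rw [r3, r2, map_neg, h₃, neg_neg, map_neg] at this
      have h4 : J₂ (J₃ Y) = J₁ Y := by
        have := congrArg J₁ (h₁₃ (J₃ Y))
        rw [h₃, map_neg, map_neg, map_neg] at this
        have h5 := h₁₂ (J₃ Y)
        rw [h₃] at h5
        have h6 := congrArg J₁ h5
        rw [h₁, map_neg] at h6
        exact neg_injective h6
      rw [h4, map_neg] at this
      rw [map_sub, LinearMap.sub_apply, this, s₁, sub_self]
    rw [g1, r1, hI, h₁, map_neg, neg_neg]
  · intro h
    refine ⟨fun X Y => b X (J₁ Y), fun X Y => b X (J₂ Y), fun X Y => b X (J₃ Y), J₁, J₂, J₃,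
      ?_, ?_, ?_, ?_, ?_, ?_, ?_, ?_, ?_, ?_, ?_, ?_, ?_⟩
    · intro X Y; rw [e2]; simp [Complex.ext_iff]
    · intro X Y; rw [e1]; simp [Complex.ext_iff]
    · intro X Y; rw [e0]; simp [Complex.ext_iff, neg_div]
    · intro X Y; simp only; rw [s₁, h₁₃, map_neg, neg_neg]
    · intro X Y; simp only; rw [s₂, h₂₁, map_neg, neg_neg]
    · intro X Y; simp only; rw [s₃, h₃₂, map_neg, neg_neg]
    · ext X; simp [h₁]
    · ext X; simp [h₂]
    · ext X; simp [h₃]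
    · ext X; simp [h₁₂]
    · intro X Y; simp [h, h₁]
    · intro X Y; simp [h, h₂]
    · intro X Y; simp [h, h₃]

/-- The action of the imaginary quaternions on `ℂ²`. -/
def quatAct (a : Fin 3 → ℝ) : ℂ × ℂ →ₗ[ℝ] ℂ × ℂ where
  toFun z := (-(a 0 * Complex.I * z.2) - a 1 * z.2 - a 2 * Complex.I * z.1,
    -(a 0 * Complex.I * z.1) + a 1 * z.1 + a 2 * Complex.I * z.2)
  map_add' z z' := by ext <;> simp <;> ring
  map_smul' r z := by
    refine Prod.ext ?_ ?_ <;> simp only [Prod.smul_fst, Prod.smul_snd, Complex.real_smul,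
      RingHom.id_apply] <;> ring

/-- This is the product rule for imaginary quaternions: minus the dot product plus the cross
product. -/
lemma quatAct_quatAct (a b : Fin 3 → ℝ) (z : ℂ × ℂ) :
    quatAct a (quatAct b z) = -(a 0 * b 0 + a 1 * b 1 + a 2 * b 2) • z
      + quatAct ![a 1 * b 2 - a 2 * b 1, a 2 * b 0 - a 0 * b 2, a 0 * b 1 - a 1 * b 0] z := by
  have hI := Complex.I_mul_I
  refine Prod.ext ?_ ?_
  · simp only [quatAct, LinearMap.coe_mk, AddHom.coe_mk, Prod.fst_add, Prod.smul_fst,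
      Complex.real_smul, Matrix.cons_val]
    push_cast
    linear_combination ((a 0 : ℂ) * b 0 * z.1 - a 0 * b 2 * z.2 + a 2 * b 0 * z.2 +
      a 2 * b 2 * z.1) * hI
  · simp only [quatAct, LinearMap.coe_mk, AddHom.coe_mk, Prod.snd_add, Prod.smul_snd,
      Complex.real_smul, Matrix.cons_val]
    push_cast
    linear_combination ((a 0 : ℂ) * b 0 * z.2 + a 0 * b 2 * z.1 - a 2 * b 0 * z.1 +
      a 2 * b 2 * z.2) * hI

/-- The flat metric of `ℂ²`, scaled by a real factor. -/
def flatForm (lam : ℝ) : ℂ × ℂ →ₗ[ℝ] ℂ × ℂ →ₗ[ℝ] ℝ :=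
  LinearMap.mk₂ ℝ (fun z z' => lam * (z.1 * conj z'.1 + z.2 * conj z'.2).re)
    (by intro a b c; simp; ring) (by intro r a b; simp; ring)
    (by intro a b c; simp; ring) (by intro r a b; simp; ring)

lemma flatForm_apply (lam : ℝ) (z z' : ℂ × ℂ) :
    flatForm lam z z' = lam * (z.1 * conj z'.1 + z.2 * conj z'.2).re := rfl

lemma flatForm_quatAct (lam : ℝ) (a : Fin 3 → ℝ) (z z' : ℂ × ℂ) :
    flatForm lam (quatAct a z) z' = -flatForm lam z (quatAct a z') := by
  simp [flatForm_apply, quatAct]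
  ring

lemma eq_zero_of_flatForm {lam : ℝ} (hl : lam ≠ 0) (z : ℂ × ℂ) (hz : ∀ z', flatForm lam z z' = 0) :
    z = 0 := by
  have h := hz z
  rw [flatForm_apply, Complex.mul_conj, Complex.mul_conj] at h
  have h' := (mul_eq_zero.1 h).resolve_left hl
  rw [Complex.add_re, Complex.ofReal_re, Complex.ofReal_re] at h'
  have h1 := Complex.normSq_nonneg z.1
  have h2 := Complex.normSq_nonneg z.2
  exact Prod.ext (Complex.normSq_eq_zero.1 (by linarith)) (Complex.normSq_eq_zero.1 (by linarith))

lemma canonicalForms_eq_spinVec {T : Type*} (lam : ℝ) (θ : T → ℂ × ℂ) (X Y : T) :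
    (fun m => canonicalForms lam (fun X => (θ X).1) (fun X => (θ X).2) m X Y) =
      spinVec fun i => flatForm lam (θ X) (quatAct (Pi.single i 1) (θ Y)) := by
  ext m
  fin_cases m <;> apply Complex.ext <;>
  · simp [canonicalForms, wedge, spinVec, flatForm_apply, quatAct]
    try ring

/-- Rotating the triplet by R replaces the three units by the units along the rows of R. The rows
are an oriented orthonormal basis, so the quaternion relations persist, and the flat form itself is
unchanged. -/
lemma isHyperkahlerMetric_canonicalForms_iff {T : Type*} [AddCommGroup T] [Module ℝ T]
    {Ω : Fin 3 → T → T → ℂ} {lam : ℝ} (hl : lam ≠ 0) (θ : T ≃ₗ[ℝ] ℂ × ℂ) {q : ℍ[ℝ]} (hq : q ≠ 0)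
    (hΩ : ∀ X Y, (fun m => Ω m X Y) = wignerE 1 q *ᵥ
      fun m => canonicalForms lam (fun X => (θ X).1) (fun X => (θ X).2) m X Y)
    (g : T → T → ℝ) :
    IsHyperkahlerMetric Ω g ↔
      ∀ X Y, g X Y = lam * ((θ X).1 * conj (θ Y).1 + (θ X).2 * conj (θ Y).2).re := by
  have hR := rot_mul_transpose hq
  have had : (rot q).adjugate = (rot q)ᵀ := by
    calc (rot q).adjugate = (rot q)ᵀ * rot q * (rot q).adjugate := by
          rw [mul_eq_one_comm.1 hR, one_mul]
      _ = (rot q)ᵀ := by rw [mul_assoc, Matrix.mul_adjugate, det_rot hq, one_smul, mul_one]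
  rw [Matrix.adjugate_fin_three] at had
  generalize hRq : rot q = R at *
  have hdot (i j) : R i 0 * R j 0 + R i 1 * R j 1 + R i 2 * R j 2 = if i = j then 1 else 0 := by
    have := congrFun (congrFun hR i) j
    rwa [Matrix.mul_apply, Fin.sum_univ_three, Matrix.one_apply] at this
  have hc (i j) := congrFun (congrFun had i) j
  have hcr (i j k : Fin 3) (hijk : (i = 0 ∧ j = 1 ∧ k = 2) ∨ (i = 1 ∧ j = 2 ∧ k = 0) ∨
      (i = 2 ∧ j = 0 ∧ k = 1)) : ![R i 1 * R j 2 - R i 2 * R j 1, R i 2 * R j 0 - R i 0 * R j 2,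
        R i 0 * R j 1 - R i 1 * R j 0] = R k := by
    ext l
    have h := hc l k
    rcases hijk with ⟨rfl, rfl, rfl⟩ | ⟨rfl, rfl, rfl⟩ | ⟨rfl, rfl, rfl⟩ <;> fin_cases l <;>
    · simp at h ⊢
      linear_combination h
  have hcr' (i j k : Fin 3) (hijk : (j = 0 ∧ i = 1 ∧ k = 2) ∨ (j = 1 ∧ i = 2 ∧ k = 0) ∨
      (j = 2 ∧ i = 0 ∧ k = 1)) : ![R i 1 * R j 2 - R i 2 * R j 1, R i 2 * R j 0 - R i 0 * R j 2,
        R i 0 * R j 1 - R i 1 * R j 0] = -R k := by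
    rw [← hcr j i k hijk]
    ext l
    fin_cases l <;> simp <;> ring
  have hneg (a : Fin 3 → ℝ) (z : ℂ × ℂ) : quatAct (-a) z = -quatAct a z := by
    refine Prod.ext ?_ ?_ <;> simp [quatAct] <;> ring
  have h0 (z : ℂ × ℂ) : quatAct ![0, 0, 0] z = 0 := by
    refine Prod.ext ?_ ?_ <;> simp [quatAct]
  have hsq (i : Fin 3) (z : ℂ × ℂ) : quatAct (R i) (quatAct (R i) z) = -z := by
    rw [quatAct_quatAct, hdot, if_pos rfl]
    have : ![R i 1 * R i 2 - R i 2 * R i 1, R i 2 * R i 0 - R i 0 * R i 2,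
        R i 0 * R i 1 - R i 1 * R i 0] = ![0, 0, 0] := by
      congr 1
      · ring
      · congr 1
        · ring
        · congr 1; ring
    rw [this, h0, add_zero, neg_smul, one_smul]
  have hp (i j k : Fin 3) (hijk : (i = 0 ∧ j = 1 ∧ k = 2) ∨ (i = 1 ∧ j = 2 ∧ k = 0) ∨
      (i = 2 ∧ j = 0 ∧ k = 1)) (z : ℂ × ℂ) : quatAct (R i) (quatAct (R j) z) = quatAct (R k) z := by
    have hij : i ≠ j := by rcases hijk with ⟨rfl, rfl, rfl⟩ | ⟨rfl, rfl, rfl⟩ | ⟨rfl, rfl, rfl⟩ <;> decide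
    rw [quatAct_quatAct, hdot, if_neg hij, neg_zero, zero_smul, zero_add, hcr i j k hijk]
  have hm (i j k : Fin 3) (hijk : (j = 0 ∧ i = 1 ∧ k = 2) ∨ (j = 1 ∧ i = 2 ∧ k = 0) ∨
      (j = 2 ∧ i = 0 ∧ k = 1)) (z : ℂ × ℂ) : quatAct (R i) (quatAct (R j) z) = -quatAct (R k) z := by
    have hij : i ≠ j := by rcases hijk with ⟨rfl, rfl, rfl⟩ | ⟨rfl, rfl, rfl⟩ | ⟨rfl, rfl, rfl⟩ <;> decide
    rw [quatAct_quatAct, hdot, if_neg hij, neg_zero, zero_smul, zero_add, hcr' i j k hijk, hneg]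
  let J (i : Fin 3) : T →ₗ[ℝ] T := θ.symm.toLinearMap ∘ₗ quatAct (R i) ∘ₗ θ.toLinearMap
  have hJ (i X) : J i X = θ.symm (quatAct (R i) (θ X)) := rfl
  have hlin (i : Fin 3) (z : ℂ × ℂ) :
      quatAct (R i) z = ∑ j, R i j • quatAct (Pi.single j 1) z := by
    refine Prod.ext ?_ ?_ <;> simp [quatAct, Fin.sum_univ_three] <;> ring
  refine isHyperkahlerMetric_iff (b := (flatForm lam).compl₁₂ θ.toLinearMap θ.toLinearMap)
    (J₁ := J 0) (J₂ := J 1) (J₃ := J 2) ?_ ?_ ?_ ?_ ?_ ?_ ?_ ?_ ?_ ?_ ?_ ?_ g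
  · intro X hX
    refine θ.map_eq_zero_iff.1 (eq_zero_of_flatForm hl _ fun z' => ?_)
    simpa using hX (θ.symm z')
  · intro X; simp [hJ, hsq]
  · intro X; simp [hJ, hsq]
  · intro X; simp [hJ, hsq]
  · intro X; simp [hJ, hp 0 1 2]
  · intro X; simp [hJ, hm 0 2 1]
  · intro X; simp [hJ, hm 1 0 2]
  · intro X; simp [hJ, hm 2 1 0]
  · intro X Y; simp [hJ, flatForm_quatAct]
  · intro X Y; simp [hJ, flatForm_quatAct]
  · intro X Y; simp [hJ, flatForm_quatAct]
  · intro X Y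
    rw [hΩ, canonicalForms_eq_spinVec lam θ, wignerE_one_spinVec, hRq]
    congr 1
    ext i
    have : ![(flatForm lam).compl₁₂ θ.toLinearMap θ.toLinearMap X (J 0 Y),
      (flatForm lam).compl₁₂ θ.toLinearMap θ.toLinearMap X (J 1 Y),
      (flatForm lam).compl₁₂ θ.toLinearMap θ.toLinearMap X (J 2 Y)] i
        = flatForm lam (θ X) (quatAct (R i) (θ Y)) := by
      fin_cases i <;> simp [hJ]
    rw [this, hlin, map_sum]
    simp [Matrix.mulVec, dotProduct]

/-! ### Differentiation of contour integrals. -/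

/-- The coordinate functional of a coefficient. -/
abbrev coeffProj (a : Fin 5) : (Fin 5 → ℂ) →L[ℂ] ℂ := ContinuousLinearMap.proj a

namespace ContourArc

/-- The integrand of the contour integral along an arc. -/
def integrand (A : ContourArc) (x : Fin 5 → ℂ) (t : ℝ) : ℂ :=
  deriv A.γ t / (2 * Real.pi * Complex.I * A.γ t) * A.H (tropical x (A.γ t)) (A.γ t)

/-- The arc carrying the integrand of the partial derivative with respect to a coefficient. -/
def partialDeriv (A : ContourArc) (a : Fin 5) : ContourArc where
  γ := A.γ
  H η ζ := ζ ^ (2 - (a : ℤ)) * fderiv ℂ (fun P : ℂ × ℂ => A.H P.1 P.2) (η, ζ) (1, 0)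

variable {A : ContourArc} {x : Fin 5 → ℂ}

lemma Admissible.partialDeriv (h : A.Admissible x) (a : Fin 5) :
    (A.partialDeriv a).Admissible x where
  smooth := h.smooth
  ne_zero := h.ne_zero
  holo t ht := by
    have h1 : AnalyticAt ℂ (fun P : ℂ × ℂ => fderiv ℂ (fun P : ℂ × ℂ => A.H P.1 P.2) P)
        (tropical x (A.γ t), A.γ t) := (h.holo t ht).fderiv
    have h2 : AnalyticAt ℂ (fun P : ℂ × ℂ => P.2 ^ (2 - (a : ℤ)))
        (tropical x (A.γ t), A.γ t) := analyticAt_snd.zpow (h.ne_zero t ht)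
    exact h2.mul (((ContinuousLinearMap.apply ℂ ℂ ((1, 0) : ℂ × ℂ)).analyticAt _).comp h1)

lemma Admissible.continuousAt_integrand (h : A.Admissible x) {t : ℝ} (ht : t ∈ Set.Icc (0 : ℝ) 1) :
    ContinuousAt (fun P : (Fin 5 → ℂ) × ℝ => A.integrand P.1 P.2) (x, t) := by
  have hγ : ContinuousAt (fun P : (Fin 5 → ℂ) × ℝ => A.γ P.2) (x, t) :=
    (h.smooth.continuous.comp continuous_snd).continuousAt
  have hγ' : ContinuousAt (fun P : (Fin 5 → ℂ) × ℝ => deriv A.γ P.2) (x, t) :=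
    ((h.smooth.continuous_deriv le_rfl).comp continuous_snd).continuousAt
  have h0 := h.ne_zero t ht
  have htr : ContinuousAt (fun P : (Fin 5 → ℂ) × ℝ => tropical P.1 (A.γ P.2)) (x, t) := by
    unfold tropical
    refine tendsto_finsetSum _ fun a _ => ?_
    exact ContinuousAt.mul (by fun_prop) (hγ.zpow₀ _ (Or.inl h0))
  have hH := (h.holo t ht).continuousAt
  refine (hγ'.div (continuousAt_const.mul hγ) ?_).mul
    (ContinuousAt.comp (f := fun P : (Fin 5 → ℂ) × ℝ => (tropical P.1 (A.γ P.2), A.γ P.2))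
      (g := fun P : ℂ × ℂ => A.H P.1 P.2) hH (htr.prodMk hγ))
  exact mul_ne_zero (by simp [Real.pi_ne_zero]) h0

lemma Admissible.continuousOn_integrand (h : A.Admissible x) :
    ContinuousOn (A.integrand x) (Set.Icc 0 1) := fun t ht =>
  (ContinuousAt.comp (f := fun t : ℝ => (x, t)) (h.continuousAt_integrand ht)
    (by fun_prop)).continuousWithinAt

lemma hasFDerivAt_tropical (x : Fin 5 → ℂ) (ζ : ℂ) :
    HasFDerivAt (fun x => tropical x ζ)
      (∑ a : Fin 5, ζ ^ (2 - (a : ℤ)) • coeffProj a) x := by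
  unfold tropical
  refine HasFDerivAt.fun_sum fun a _ => ?_
  simpa using (hasFDerivAt_apply (𝕜 := ℂ) a x).mul_const (ζ ^ (2 - (a : ℤ)))

lemma Admissible.hasFDerivAt_integrand (h : A.Admissible x) {t : ℝ}
    (ht : t ∈ Set.Icc (0 : ℝ) 1) :
    HasFDerivAt (fun x => A.integrand x t) (∑ a, (A.partialDeriv a).integrand x t •
      coeffProj a) x := by
  have h1 := (h.holo t ht).differentiableAt.hasFDerivAt
  have h2 : HasFDerivAt (fun x => A.H (tropical x (A.γ t)) (A.γ t)) _ x :=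
    HasFDerivAt.comp (f := fun x => (tropical x (A.γ t), A.γ t)) x h1
      ((hasFDerivAt_tropical x (A.γ t)).prodMk (hasFDerivAt_const (A.γ t) x))
  refine (h2.const_mul (deriv A.γ t / (2 * Real.pi * Complex.I * A.γ t))).congr_fderiv ?_
  ext a
  simp only [ContinuousLinearMap.comp_apply, ContinuousLinearMap.prod_apply, zero_apply,
    smul_apply, sum_apply, ContinuousLinearMap.proj_apply, smul_eq_mul]
  have e (z : ℂ) : ((z, 0) : ℂ × ℂ) = z • ((1, 0) : ℂ × ℂ) := by simp
  rw [e, map_smul, smul_eq_mul, Finset.sum_mul, Finset.mul_sum]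
  refine Finset.sum_congr rfl fun b _ => ?_
  simp only [integrand, ContourArc.partialDeriv]
  ring

/-- Differentiation under the contour integral. -/
lemma hasFDerivAt_integral (h : ∀ᶠ y in nhds x, A.Admissible y) :
    HasFDerivAt A.integral (∑ a, (A.partialDeriv a).integral x •
      coeffProj a) x := by
  obtain ⟨ε, hε, hball⟩ := Metric.eventually_nhds_iff_ball.1 h
  have hcb : ∀ y ∈ Metric.closedBall x (ε / 2), A.Admissible y := fun y hy =>
    hball y (Metric.closedBall_subset_ball (by linarith) hy)
  -- The partial integrands are jointly continuous on a compact product of a closed ball with [0,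
  -- 1]; their maximum there is the dominating constant.
  have hbd (a : Fin 5) : ∃ C, ∀ P ∈ Metric.closedBall x (ε / 2) ×ˢ Set.Icc (0 : ℝ) 1,
      ‖(A.partialDeriv a).integrand P.1 P.2‖ ≤ C :=
    ((isCompact_closedBall x (ε / 2)).prod isCompact_Icc).exists_bound_of_continuousOn
      fun P hP => (((hcb P.1 hP.1).partialDeriv a).continuousAt_integrand hP.2).continuousWithinAt
  choose C hC using hbd
  have hI : Set.uIoc (0 : ℝ) 1 ⊆ Set.Icc 0 1 := by
    rw [Set.uIoc_of_le zero_le_one]; exact Set.Ioc_subset_Icc_self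
  have hx := hcb x (Metric.mem_closedBall_self (by linarith))
  have hmeas {f : ℝ → ℂ} (hf : ContinuousOn f (Set.Icc 0 1)) :
      MeasureTheory.AEStronglyMeasurable f (MeasureTheory.volume.restrict (Set.uIoc (0 : ℝ) 1)) :=
    (hf.mono hI).aestronglyMeasurable measurableSet_uIoc
  have hint (a : Fin 5) : IntervalIntegrable ((A.partialDeriv a).integrand x)
      MeasureTheory.volume 0 1 := by
    refine ContinuousOn.intervalIntegrable ?_
    rw [Set.uIcc_of_le zero_le_one]
    exact (hx.partialDeriv a).continuousOn_integrand
  have key := intervalIntegral.hasFDerivAt_integral_of_dominated_of_fderiv_le (𝕜 := ℂ)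
    (μ := MeasureTheory.volume) (a := 0) (b := 1) (s := Metric.closedBall x (ε / 2))
    (F := A.integrand) (F' := fun y t => ∑ a, (A.partialDeriv a).integrand y t •
      coeffProj a) (x₀ := x)
    (bound := fun _ => ∑ a, C a *
      ‖coeffProj a‖)
    (Metric.closedBall_mem_nhds x (by linarith))
    (h.mono fun y hy => hmeas hy.continuousOn_integrand)
    (by
      refine ContinuousOn.intervalIntegrable ?_
      rw [Set.uIcc_of_le zero_le_one]
      exact hx.continuousOn_integrand)
    (by
      refine (ContinuousOn.mono ?_ hI).aestronglyMeasurable measurableSet_uIoc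
      exact continuousOn_finsetSum _ fun a _ =>
        (hx.partialDeriv a).continuousOn_integrand.smul continuousOn_const)
    (by
      refine Filter.Eventually.of_forall fun t ht y hy => ?_
      refine (norm_sum_le _ _).trans (Finset.sum_le_sum fun a _ => ?_)
      rw [norm_smul]
      exact mul_le_mul_of_nonneg_right (hC a (y, t) ⟨hy, hI ht⟩) (norm_nonneg _))
    intervalIntegrable_const
    (Filter.Eventually.of_forall fun t ht y hy => (hcb y hy).hasFDerivAt_integrand (hI ht))
  refine key.congr_fderiv ?_
  rw [intervalIntegral.integral_finsetSum]
  · refine Finset.sum_congr rfl fun a _ => ?_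
    rw [intervalIntegral.integral_smul_const]
    rfl
  · intro a _
    exact ⟨(hint a).1.smul_const _, (hint a).2.smul_const _⟩

lemma pd_integral (h : ∀ᶠ y in nhds x, A.Admissible y) (a : Fin 5) :
    pd A.integral a x = (A.partialDeriv a).integral x := by
  rw [pd, (hasFDerivAt_integral h).fderiv]
  simp [sum_apply, Pi.single_apply]

/-- Both integrands are ζ to the power minus the sum of the labels times the second derivative of H
in its first argument; in positions the exponent is 4 - (a + b). -/
lemma integral_partialDeriv_partialDeriv (h : A.Admissible x) {a b c d : Fin 5}
    (he : (a : ℕ) + b = c + d) :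
    ((A.partialDeriv a).partialDeriv b).integral x
      = ((A.partialDeriv c).partialDeriv d).integral x := by
  refine intervalIntegral.integral_congr fun t ht => ?_
  rw [Set.uIcc_of_le zero_le_one] at ht
  have h0 := h.ne_zero t ht
  have key (a b : Fin 5) : ((A.partialDeriv a).partialDeriv b).H (tropical x (A.γ t)) (A.γ t)
      = (A.γ t) ^ (4 - ((a : ℤ) + b)) * fderiv ℂ (fun P : ℂ × ℂ =>
        fderiv ℂ (fun P : ℂ × ℂ => A.H P.1 P.2) P (1, 0)) (tropical x (A.γ t), A.γ t) (1, 0) := by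
    have h1 : AnalyticAt ℂ (fun P : ℂ × ℂ => fderiv ℂ (fun P : ℂ × ℂ => A.H P.1 P.2) P (1, 0))
        (tropical x (A.γ t), A.γ t) :=
      ((ContinuousLinearMap.apply ℂ ℂ ((1, 0) : ℂ × ℂ)).analyticAt _).comp (h.holo t ht).fderiv
    have h2 : DifferentiableAt ℂ (fun P : ℂ × ℂ => P.2 ^ (2 - (a : ℤ)))
        (tropical x (A.γ t), A.γ t) := (analyticAt_snd.zpow h0).differentiableAt
    have h3 : fderiv ℂ (fun P : ℂ × ℂ => P.2 ^ (2 - (a : ℤ))) (tropical x (A.γ t), A.γ t) (1, 0)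
        = 0 := by
      have h4 := HasFDerivAt.comp (f := fun P : ℂ × ℂ => P.2) (g := fun z : ℂ => z ^ (2 - (a : ℤ)))
        (tropical x (A.γ t), A.γ t)
        (hasDerivAt_zpow (2 - (a : ℤ)) (A.γ t) (Or.inl h0)).hasFDerivAt hasFDerivAt_snd
      change fderiv ℂ ((fun z : ℂ => z ^ (2 - (a : ℤ))) ∘ fun P : ℂ × ℂ => P.2) _ _ = 0
      rw [h4.fderiv]
      simp
    simp only [ContourArc.partialDeriv]
    rw [fderiv_fun_mul h2 h1.differentiableAt]
    simp only [add_apply, smul_apply, h3, smul_eq_mul,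
      mul_zero, add_zero]
    rw [← mul_assoc, ← zpow_add₀ h0]
    congr 2
    ring
  have hz : (a : ℤ) + b = c + d := by exact_mod_cast he
  have e : ((A.partialDeriv a).partialDeriv b).H (tropical x (A.γ t)) (A.γ t)
      = ((A.partialDeriv c).partialDeriv d).H (tropical x (A.γ t)) (A.γ t) := by
    rw [key, key, hz]
  exact congrArg (deriv A.γ t / (2 * Real.pi * Complex.I * A.γ t) * ·) e

end ContourArc

/-! ### Second derivatives of the potential and their reality. -/

section Potential

variable {U : Set (Fin 5 → ℂ)} {L : (Fin 5 → ℂ) → ℂ} {x : Fin 5 → ℂ}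

lemma IsContourPotential.exists_arcs (hL : IsContourPotential U L) (hx : x ∈ U) :
    ∃ (n : ℕ) (A : Fin n → ContourArc), (∀ k, ∀ᶠ y in nhds x, (A k).Admissible y) ∧
      L =ᶠ[nhds x] fun y => ∑ k, (A k).integral y := by
  obtain ⟨n, A, hA⟩ := hL x hx
  exact ⟨n, A, fun k => hA.mono fun y hy => hy.1 k, hA.mono fun y hy => hy.2⟩

lemma IsContourPotential.differentiableAt (hL : IsContourPotential U L) (hx : x ∈ U) :
    DifferentiableAt ℂ L x := by
  obtain ⟨n, A, hA, he⟩ := hL.exists_arcs hx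
  refine DifferentiableAt.congr_of_eventuallyEq ?_ he
  exact DifferentiableAt.fun_sum fun k _ =>
    (ContourArc.hasFDerivAt_integral (hA k)).differentiableAt

lemma exists_arcs_pd {n : ℕ} {A : Fin n → ContourArc}
    (hA : ∀ k, ∀ᶠ y in nhds x, (A k).Admissible y)
    (he : L =ᶠ[nhds x] fun y => ∑ k, (A k).integral y) (a : Fin 5) :
    (∀ k, ∀ᶠ y in nhds x, ((A k).partialDeriv a).Admissible y) ∧
      pd L a =ᶠ[nhds x] fun y => ∑ k, ((A k).partialDeriv a).integral y := by
  refine ⟨fun k => (hA k).mono fun y hy => hy.partialDeriv a, ?_⟩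
  filter_upwards [he.eventually_nhds, Filter.eventually_all.2 fun k => (hA k).eventually_nhds]
    with y hy hAy
  have hy : L =ᶠ[nhds y] fun y => ∑ k, (A k).integral y := hy
  rw [pd, hy.fderiv_eq, fderiv_fun_sum fun k _ =>
    (ContourArc.hasFDerivAt_integral (hAy k)).differentiableAt, sum_apply]
  exact Finset.sum_congr rfl fun k _ => ContourArc.pd_integral (hAy k) a

lemma IsContourPotential.differentiableAt_pd (hL : IsContourPotential U L) (hx : x ∈ U)
    (a : Fin 5) : DifferentiableAt ℂ (pd L a) x := by
  obtain ⟨n, A, hA, he⟩ := hL.exists_arcs hx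
  obtain ⟨hA', he'⟩ := exists_arcs_pd hA he a
  refine DifferentiableAt.congr_of_eventuallyEq ?_ he'
  exact DifferentiableAt.fun_sum fun k _ =>
    (ContourArc.hasFDerivAt_integral (hA' k)).differentiableAt

/-- The second derivatives of the potential only depend on the sum of the labels. -/
lemma IsContourPotential.pd_pd_eq (hL : IsContourPotential U L) (hx : x ∈ U)
    {a b c d : Fin 5} (h : (a : ℕ) + b = c + d) : pd (pd L a) b x = pd (pd L c) d x := by
  obtain ⟨n, A, hA, he⟩ := hL.exists_arcs hx
  have key (a b : Fin 5) :
      pd (pd L a) b x = ∑ k, (((A k).partialDeriv a).partialDeriv b).integral x := by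
    obtain ⟨hA', he'⟩ := exists_arcs_pd hA he a
    exact (exists_arcs_pd hA' he' b).2.self_of_nhds
  rw [key, key]
  exact Finset.sum_congr rfl fun k _ =>
    ContourArc.integral_partialDeriv_partialDeriv (hA k).self_of_nhds h

lemma fderiv_apply_eq_sum_pd (f : (Fin 5 → ℂ) → ℂ) (x v : Fin 5 → ℂ) :
    fderiv ℂ f x v = ∑ a, v a * pd f a x := by
  conv_lhs => rw [pi_eq_sum_univ' v, map_sum]
  refine Finset.sum_congr rfl fun a _ => ?_
  rw [map_smul, smul_eq_mul, pd]

/-- The derivative in a real direction of a function that is real on real coefficients is real. -/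
lemma fderiv_im_eq_zero (hU : IsOpen U) {f : (Fin 5 → ℂ) → ℂ}
    (hf : ∀ y ∈ U, IsAltReal y → (f y).im = 0) (hx : x ∈ U) (hxr : IsAltReal x)
    (hd : DifferentiableAt ℂ f x) {v : Fin 5 → ℂ} (hv : IsAltReal v) :
    (fderiv ℂ f x v).im = 0 := by
  have hline : HasDerivAt (fun s : ℝ => x + (s : ℂ) • v) v 0 := by
    have := ((hasDerivAt_id (0 : ℝ)).ofReal_comp.smul_const v).const_add x
    simpa using this
  have h1 : HasDerivAt (fun s : ℝ => f (x + (s : ℂ) • v)) (fderiv ℂ f x v) 0 := by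
    have h2 : HasFDerivAt f ((fderiv ℂ f x).restrictScalars ℝ) (x + ((0 : ℝ) : ℂ) • v) := by
      simpa using hd.hasFDerivAt.restrictScalars ℝ
    exact h2.comp_hasDerivAt (0 : ℝ) hline
  have h3 : HasDerivAt (fun s : ℝ => (f (x + (s : ℂ) • v)).im) (fderiv ℂ f x v).im 0 :=
    (Complex.imCLM.hasFDerivAt.comp_hasDerivAt (0 : ℝ) h1)
  have h4 : (fun s : ℝ => (f (x + (s : ℂ) • v)).im) =ᶠ[nhds 0] fun _ => 0 := by
    have hm : ∀ᶠ s : ℝ in nhds 0, x + (s : ℂ) • v ∈ U :=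
      hline.continuousAt.eventually (hU.mem_nhds (by simpa using hx))
    filter_upwards [hm] with s hs
    refine hf _ hs fun a => ?_
    simp only [Pi.add_apply, Pi.smul_apply, smul_eq_mul, map_add, map_mul, Complex.conj_ofReal,
      hxr a, hv a]
    ring
  exact h3.unique ((hasDerivAt_const (0 : ℝ) (0 : ℝ)).congr_of_eventuallyEq h4)

/-- The coordinate vector of x_0 is itself real, so L_{x_0} is real on real coefficients. Its
derivatives along five independent real directions are then real, and these five conditions are the
reality property of h. -/
lemma isAltReal_hfun (hU : IsOpen U) (hL : IsContourPotential U L)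
    (hr : ∀ y ∈ U, IsAltReal y → (L y).im = 0) (hx : x ∈ U) (hxr : IsAltReal x) :
    IsAltReal (hfun L x) := by
  have hs : IsAltReal (Pi.single 2 1 : Fin 5 → ℂ) := by
    rw [isAltReal_iff]; simp
  have h1 : ∀ y ∈ U, IsAltReal y → (pd L 2 y).im = 0 := fun y hy hyr =>
    fderiv_im_eq_zero hU hr hy hyr (hL.differentiableAt hy) hs
  have h2 {v : Fin 5 → ℂ} (hv : IsAltReal v) : (∑ a, v a * pd (pd L 2) a x).im = 0 := by
    rw [← fderiv_apply_eq_sum_pd]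
    exact fderiv_im_eq_zero hU h1 hx hxr (hL.differentiableAt_pd hx 2) hv
  have e1 := h2 (v := ![1, 0, 0, 0, 1]) (by rw [isAltReal_iff]; simp)
  have e2 := h2 (v := ![-Complex.I, 0, 0, 0, Complex.I]) (by rw [isAltReal_iff]; simp)
  have e3 := h2 (v := ![0, -1, 0, 1, 0]) (by rw [isAltReal_iff]; simp)
  have e4 := h2 (v := ![0, Complex.I, 0, Complex.I, 0]) (by rw [isAltReal_iff]; simp)
  have e5 := h2 hs
  simp [Fin.sum_univ_five, Pi.single_apply] at e1 e2 e3 e4 e5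
  rw [isAltReal_iff]
  refine ⟨?_, ?_, ?_⟩ <;> apply Complex.ext <;> simp [hfun] <;> linarith

lemma constraint_hfun_iff (x v : Fin 5 → ℂ) :
    Constraint (hfun L x) v ↔ fderiv ℂ (pd L 2) x v = 0 := by
  rw [fderiv_apply_eq_sum_pd, Constraint]
  simp only [hfun, Complex.conj_conj, mul_comm]

end Potential

/-! ### Existence of quaternionic parameters and the cubic. -/

/-- For a unit quaternion u the four numbers 1 ± R₀₀ ± R₁₁ ± R₂₂ (with an even number of minus
signs) are the 4u_k². They sum to 4, so one of them is non-zero. For that k the entries of R give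
4u_k u, a quaternion of squared norm 4s with s = 4u_k². -/
lemma exists_rot_eq {R : Matrix (Fin 3) (Fin 3) ℝ} (hR : R * Rᵀ = 1) (hd : R.det = 1) :
    ∃ q : ℍ[ℝ], q ≠ 0 ∧ rot q = R := by
  have hR' : Rᵀ * R = 1 := mul_eq_one_comm.1 hR
  have had : R.adjugate = Rᵀ := by
    calc R.adjugate = Rᵀ * R * R.adjugate := by rw [hR', one_mul]
      _ = Rᵀ := by rw [mul_assoc, Matrix.mul_adjugate, hd, one_smul, mul_one]
  rw [Matrix.adjugate_fin_three] at had
  obtain ⟨a, b, c, d, e, f, g, h, i, rfl⟩ :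
      ∃ a b c d e f g h i : ℝ, R = !![a, b, c; d, e, f; g, h, i] := by
    refine ⟨R 0 0, R 0 1, R 0 2, R 1 0, R 1 1, R 1 2, R 2 0, R 2 1, R 2 2, ?_⟩
    ext j k
    fin_cases j <;> fin_cases k <;> rfl
  have r00 := congrFun (congrFun hR 0) 0
  have r01 := congrFun (congrFun hR 0) 1
  have r02 := congrFun (congrFun hR 0) 2
  have r11 := congrFun (congrFun hR 1) 1
  have r12 := congrFun (congrFun hR 1) 2
  have r22 := congrFun (congrFun hR 2) 2
  have c00 := congrFun (congrFun hR' 0) 0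
  have c01 := congrFun (congrFun hR' 0) 1
  have c02 := congrFun (congrFun hR' 0) 2
  have c11 := congrFun (congrFun hR' 1) 1
  have c12 := congrFun (congrFun hR' 1) 2
  have c22 := congrFun (congrFun hR' 2) 2
  have a00 := congrFun (congrFun had 0) 0
  have a01 := congrFun (congrFun had 0) 1
  have a02 := congrFun (congrFun had 0) 2
  have a10 := congrFun (congrFun had 1) 0
  have a11 := congrFun (congrFun had 1) 1
  have a12 := congrFun (congrFun had 1) 2
  have a20 := congrFun (congrFun had 2) 0
  have a21 := congrFun (congrFun had 2) 1
  have a22 := congrFun (congrFun had 2) 2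
  simp [Matrix.mul_apply, Fin.sum_univ_three] at r00 r01 r02 r11 r12 r22 c00 c01 c02 c11 c12 c22
  simp at a00 a01 a02 a10 a11 a12 a20 a21 a22
  have key (q : ℍ[ℝ]) (s : ℝ) (hs : s ≠ 0) (hn : qn q = 4 * s)
      (h00 : q.re ^ 2 + q.imI ^ 2 - q.imJ ^ 2 - q.imK ^ 2 = 4 * s * a)
      (h11 : q.re ^ 2 - q.imI ^ 2 + q.imJ ^ 2 - q.imK ^ 2 = 4 * s * e)
      (h22 : q.re ^ 2 - q.imI ^ 2 - q.imJ ^ 2 + q.imK ^ 2 = 4 * s * i)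
      (h01 : -(2 * (q.imI * q.imJ - q.re * q.imK)) = 4 * s * b)
      (h02 : -(2 * (q.imI * q.imK + q.re * q.imJ)) = 4 * s * c)
      (h10 : -(2 * (q.imI * q.imJ + q.re * q.imK)) = 4 * s * d)
      (h12 : 2 * (q.imJ * q.imK - q.re * q.imI) = 4 * s * f)
      (h20 : -(2 * (q.imI * q.imK - q.re * q.imJ)) = 4 * s * g)
      (h21 : 2 * (q.imJ * q.imK + q.re * q.imI) = 4 * s * h) :
      ∃ q : ℍ[ℝ], q ≠ 0 ∧ rot q = !![a, b, c; d, e, f; g, h, i] := by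
    refine ⟨q, ?_, ?_⟩
    · rintro rfl
      simp [qn] at hn
      exact hs hn
    · rw [rot, hn, h00, h01, h02, h10, h11, h12, h20, h21, h22]
      ext j k
      fin_cases j <;> fin_cases k <;> simp <;> field_simp
  by_cases s0 : 1 + a + e + i = 0
  · by_cases s1 : 1 + a - e - i = 0
    · by_cases s2 : 1 - a + e - i = 0
      · have s3 : 1 - a - e + i ≠ 0 := fun s3 => by linarith
        refine key ⟨b - d, -(c + g), f + h, 1 - a - e + i⟩ _ s3 ?_ ?_ ?_ ?_ ?_ ?_ ?_ ?_ ?_ ?_ <;>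
          simp only [qn] <;> linarith
      · refine key ⟨g - c, -(b + d), 1 - a + e - i, f + h⟩ _ s2 ?_ ?_ ?_ ?_ ?_ ?_ ?_ ?_ ?_ ?_ <;>
          simp only [qn] <;> linarith
    · refine key ⟨h - f, 1 + a - e - i, -(b + d), -(c + g)⟩ _ s1 ?_ ?_ ?_ ?_ ?_ ?_ ?_ ?_ ?_ ?_ <;>
        simp only [qn] <;> linarith
  · refine key ⟨1 + a + e + i, h - f, g - c, b - d⟩ _ s0 ?_ ?_ ?_ ?_ ?_ ?_ ?_ ?_ ?_ ?_ <;>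
      simp only [qn] <;> linarith

/-- The diagonal matrix of the reference spinor. -/
def refMatrix (e₁ e₂ e₃ : ℝ) : Matrix (Fin 3) (Fin 3) ℝ := !![e₃, 0, 0; 0, e₁, 0; 0, 0, e₂]

lemma isSymTraceless_refMatrix {e₁ e₂ e₃ : ℝ} (h : e₁ + e₂ + e₃ = 0) :
    IsSymTraceless (refMatrix e₁ e₂ e₃) := by
  have : refMatrix e₁ e₂ e₃ = !![e₃, 0, 0; 0, e₁, 0; 0, 0, -e₃ - e₁] := by
    rw [refMatrix, show e₂ = -e₃ - e₁ by linarith]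
  rw [this]
  exact isSymTraceless_of _ _ _ _ _

lemma spinor_refMatrix {e₁ e₂ e₃ : ℝ} (h : e₁ + e₂ + e₃ = 0) :
    spinor (refMatrix e₁ e₂ e₃) = refSpinor e₁ e₃ := by
  obtain rfl : e₂ = -e₁ - e₃ := by linarith
  ext a
  fin_cases a <;> apply Complex.ext <;>
    simp [spinor, refMatrix, refSpinor, -Complex.ofReal_add, -Complex.ofReal_sub,
      -Complex.ofReal_div, -Complex.ofReal_mul]
  all_goals ring

lemma normalize_injective (j : ℕ) : Function.Injective (normalize j) := by
  intro x y h
  ext a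
  have h0 : (sphNorm j a : ℂ) ≠ 0 := by exact_mod_cast (sphNorm_pos j a).ne'
  exact mul_left_cancel₀ h0 (congrFun h a)

lemma eq_spinor_of_isQuatParam {y : Fin 5 → ℂ} {q : ℍ[ℝ]} {e₁ e₂ e₃ : ℝ}
    (h : IsQuatParam y q e₁ e₂ e₃) : y = spinor (rot q * refMatrix e₁ e₂ e₃ * (rot q)ᵀ) := by
  apply normalize_injective 2
  rw [h.rot, ← spinor_refMatrix h.sum_eq, wignerD_two_mulVec]

lemma isQuatParam_of_eq_spinor {y : Fin 5 → ℂ} {q : ℍ[ℝ]} {e₁ e₂ e₃ : ℝ} (hq : q ≠ 0)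
    (hs : e₁ + e₂ + e₃ = 0) (h₁₂ : e₂ ≤ e₁) (h₂₃ : e₃ ≤ e₂)
    (h : y = spinor (rot q * refMatrix e₁ e₂ e₃ * (rot q)ᵀ)) : IsQuatParam y q e₁ e₂ e₃ :=
  ⟨hq, hs, h₁₂, h₂₃, by rw [h, ← wignerD_two_mulVec, spinor_refMatrix hs]⟩

/-- The symmetric traceless matrix of a real spin-2 object. -/
def spinorMatrix (y : Fin 5 → ℂ) : Matrix (Fin 3) (Fin 3) ℝ :=
  !![(y 2).re / 3 - 2 * (y 4).re, -2 * (y 4).im, -(y 3).re;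
    -2 * (y 4).im, (y 2).re / 3 + 2 * (y 4).re, -(y 3).im;
    -(y 3).re, -(y 3).im, -((y 2).re / 3 - 2 * (y 4).re) - ((y 2).re / 3 + 2 * (y 4).re)]

lemma isSymTraceless_spinorMatrix (y : Fin 5 → ℂ) : IsSymTraceless (spinorMatrix y) :=
  isSymTraceless_of _ _ _ _ _

lemma spinor_spinorMatrix {y : Fin 5 → ℂ} (hy : IsAltReal y) : spinor (spinorMatrix y) = y := by
  have h4 := hy.conj_four
  have h3 := hy.conj_three
  have h2 := hy.conj_two
  rw [Complex.ext_iff] at h4 h3 h2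
  simp at h4 h3 h2
  ext a
  fin_cases a <;> apply Complex.ext <;> simp [spinor, spinorMatrix] <;> linarith

lemma spinorMatrix_spinor {A : Matrix (Fin 3) (Fin 3) ℝ} (hA : IsSymTraceless A) :
    spinorMatrix (spinor A) = A := by
  obtain ⟨a, b, c, d, e, rfl⟩ := hA.exists_eq
  ext i j
  fin_cases i <;> fin_cases j <;> simp [spinor, spinorMatrix] <;> ring

/-- A real symmetric 3×3 matrix is diagonalized, with ordered eigenvalues, by a rotation. -/
lemma exists_rot_mul_refMatrix {A : Matrix (Fin 3) (Fin 3) ℝ} (hA : Aᵀ = A) :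
    ∃ (q : ℍ[ℝ]) (e₁ e₂ e₃ : ℝ), q ≠ 0 ∧ e₂ ≤ e₁ ∧ e₃ ≤ e₂ ∧
      A = rot q * refMatrix e₁ e₂ e₃ * (rot q)ᵀ := by
  have hH : A.IsHermitian := by
    rw [Matrix.IsHermitian, Matrix.conjTranspose_eq_transpose_of_trivial, hA]
  have hspec := hH.spectral_theorem
  rw [Unitary.conjStarAlgAut_apply] at hspec
  set O : Matrix (Fin 3) (Fin 3) ℝ := (hH.eigenvectorUnitary : Matrix (Fin 3) (Fin 3) ℝ) with hO
  have hstar : star O = Oᵀ := by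
    rw [Matrix.star_eq_conjTranspose, Matrix.conjTranspose_eq_transpose_of_trivial]
  have hOO : O * Oᵀ = 1 := by
    rw [← hstar]
    exact Unitary.mul_star_self_of_mem hH.eigenvectorUnitary.2
  set f := hH.eigenvalues
  obtain ⟨σ, hσ⟩ : ∃ σ : Equiv.Perm (Fin 3), Monotone (f ∘ σ) := ⟨_, Tuple.monotone_sort f⟩
  -- columns reordered as in the reference matrix
  let τ : Equiv.Perm (Fin 3) := (Equiv.swap 1 2).trans σ
  have hperm : ∃ R : Matrix (Fin 3) (Fin 3) ℝ, R * Rᵀ = 1 ∧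
      A = R * refMatrix (f (σ 2)) (f (σ 1)) (f (σ 0)) * Rᵀ := by
    refine ⟨O.submatrix id τ, ?_, ?_⟩
    · rw [Matrix.transpose_submatrix, Matrix.submatrix_mul_equiv, hOO, Matrix.submatrix_id_id]
    · have hd : refMatrix (f (σ 2)) (f (σ 1)) (f (σ 0))
          = (Matrix.diagonal f).submatrix τ τ := by
        ext i j
        fin_cases i <;> fin_cases j <;>
          simp [refMatrix, τ, Equiv.swap_apply_def]
      rw [hd, Matrix.transpose_submatrix, Matrix.submatrix_mul_equiv, Matrix.submatrix_mul_equiv,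
        Matrix.submatrix_id_id, ← hstar]
      exact hspec
  obtain ⟨R, hR, hAR⟩ := hperm
  have hdet : R.det * R.det = 1 := by
    have := congrArg Matrix.det hR
    rwa [Matrix.det_mul, Matrix.det_transpose, Matrix.det_one] at this
  have h₁₂ : f (σ 1) ≤ f (σ 2) := hσ (by decide)
  have h₂₃ : f (σ 0) ≤ f (σ 1) := hσ (by decide)
  rcases mul_self_eq_one_iff.1 hdet with h1 | h1
  · obtain ⟨q, hq, rfl⟩ := exists_rot_eq hR h1
    exact ⟨q, _, _, _, hq, h₁₂, h₂₃, hAR⟩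
  -- In odd dimension -R has determinant 1, and it conjugates in the same way as R.
  · obtain ⟨q, hq, hqR⟩ := exists_rot_eq (R := -R) (by simpa using hR)
      (by rw [Matrix.det_neg, h1]; simp [pow_succ])
    refine ⟨q, _, _, _, hq, h₁₂, h₂₃, ?_⟩
    rw [hqR, hAR]
    simp

theorem exists_isQuatParam {y : Fin 5 → ℂ} (hy : IsAltReal y) :
    ∃ (q : ℍ[ℝ]) (e₁ e₂ e₃ : ℝ), IsQuatParam y q e₁ e₂ e₃ := by
  obtain ⟨q, e₁, e₂, e₃, hq, h₁₂, h₂₃, h⟩ :=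
    exists_rot_mul_refMatrix (isSymTraceless_spinorMatrix y).symm
  refine ⟨q, e₁, e₂, e₃, isQuatParam_of_eq_spinor hq ?_ h₁₂ h₂₃ ?_⟩
  · have := (isSymTraceless_spinorMatrix y).trace
    rw [h, Matrix.trace_mul_comm, ← mul_assoc, mul_eq_one_comm.1 (rot_mul_transpose hq), one_mul,
      refMatrix, Matrix.trace_fin_three] at this
    simp at this
    linarith
  · rw [← h, spinor_spinorMatrix hy]

lemma g₂_spinor {A : Matrix (Fin 3) (Fin 3) ℝ} (hA : IsSymTraceless A) :
    g₂ (spinor A) = (((A * A).trace / 2 : ℝ) : ℂ) := by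
  have hs (a : Fin 5) : ‖normalize 2 (spinor A) a‖ ^ 2
      = sphNorm 2 a ^ 2 * Complex.normSq (spinor A a) := by
    rw [normalize, norm_mul, mul_pow, Complex.normSq_eq_norm_sq, Complex.norm_real,
      Real.norm_eq_abs, sq_abs]
  have hq (a : Fin 5) := congrFun sphNorm_two_sq a
  obtain ⟨a, b, c, d, e, rfl⟩ := hA.exists_eq
  rw [g₂, r₂, ← Complex.ofReal_ofNat, ← Complex.ofReal_mul]
  congr 1
  simp only [hs, hq, Fin.sum_univ_five, Matrix.trace_fin_three]
  simp [spinor, Complex.normSq_mk, Matrix.mul_apply, Fin.sum_univ_three]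
  ring

/-- Together with `g₂_spinor`, this makes the Weierstrass cubic the characteristic polynomial of the
traceless matrix A. -/
lemma g₃_spinor {A : Matrix (Fin 3) (Fin 3) ℝ} (hA : IsSymTraceless A) :
    g₃ (spinor A) = ((A.det : ℝ) : ℂ) := by
  have h : r₃ (normalize 2 (spinor A)) = hankelDet (dualSpinor A) := by
    rw [← r₃_dualNormalize, dualNormalize_dualSpinor]
  rw [g₃, h, dualSpinor_eq]
  obtain ⟨a, b, c, d, e, rfl⟩ := hA.exists_eq
  apply Complex.ext <;>
  · simp [hankelDet, Matrix.det_fin_three, pow_succ]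
    ring

theorem cubic_eq_of_isQuatParam {y : Fin 5 → ℂ} {q : ℍ[ℝ]} {e₁ e₂ e₃ : ℝ}
    (h : IsQuatParam y q e₁ e₂ e₃) (X : ℂ) :
    X ^ 3 - g₂ y * X - g₃ y = (X - e₁) * (X - e₂) * (X - e₃) := by
  have hR := mul_eq_one_comm.1 (rot_mul_transpose h.q_ne)
  have hA := (isSymTraceless_refMatrix h.sum_eq).conj hR
  rw [eq_spinor_of_isQuatParam h, g₂_spinor hA, g₃_spinor hA]
  have h2 : (rot q * refMatrix e₁ e₂ e₃ * (rot q)ᵀ * (rot q * refMatrix e₁ e₂ e₃ * (rot q)ᵀ)).trace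
      = e₁ ^ 2 + e₂ ^ 2 + e₃ ^ 2 := by
    calc _ = (rot q * refMatrix e₁ e₂ e₃ * ((rot q)ᵀ * rot q) * refMatrix e₁ e₂ e₃ *
          (rot q)ᵀ).trace := by simp only [mul_assoc]
      _ = (refMatrix e₁ e₂ e₃ * refMatrix e₁ e₂ e₃).trace := by
        rw [hR, mul_one, Matrix.trace_mul_comm, ← mul_assoc, ← mul_assoc, hR, one_mul]
      _ = _ := by
        simp [refMatrix, Matrix.trace_fin_three]
        ring
  have h3 : (rot q * refMatrix e₁ e₂ e₃ * (rot q)ᵀ).det = e₁ * e₂ * e₃ := by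
    rw [Matrix.det_mul, Matrix.det_mul, Matrix.det_transpose, det_rot h.q_ne]
    simp [refMatrix, Matrix.det_fin_three]
    ring
  rw [h2, h3]
  have hs : (e₃ : ℂ) = -e₁ - e₂ := by
    have : e₃ = -e₁ - e₂ := by linarith [h.sum_eq]
    exact_mod_cast this
  push_cast
  rw [hs]
  ring

/-! ### Smooth choice of the parameters. -/

lemma spinor_add (A B : Matrix (Fin 3) (Fin 3) ℝ) : spinor (A + B) = spinor A + spinor B := by
  ext a
  fin_cases a <;> apply Complex.ext <;> simp [spinor] <;> ring

lemma spinor_smul (r : ℝ) (A : Matrix (Fin 3) (Fin 3) ℝ) : spinor (r • A) = r • spinor A := by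
  ext a
  fin_cases a <;> apply Complex.ext <;> simp [spinor] <;> ring

/-- The spinor of a conjugated matrix, as a linear function of the entries of the matrix. -/
def conjSpinor (R : Matrix (Fin 3) (Fin 3) ℝ) : (Fin 3 → Fin 3 → ℝ) →ₗ[ℝ] Fin 5 → ℂ where
  toFun A := spinor (R * Matrix.of A * Rᵀ)
  map_add' A B := by rw [← Matrix.of_add_of, mul_add, add_mul, spinor_add]
  map_smul' r A := by
    rw [← Matrix.smul_of, Matrix.mul_smul, Matrix.smul_mul, spinor_smul, RingHom.id_apply]

/-- The spin-2 object with given quaternionic parameters. -/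
def paramSpinor (P : ℍ[ℝ] × ℝ × ℝ) : Fin 5 → ℂ :=
  spinor (rot P.1 * refMatrix P.2.1 (-P.2.1 - P.2.2) P.2.2 * (rot P.1)ᵀ)

/-- The components of a quaternion, as a linear map. -/
def quatComponents : ℍ[ℝ] →ₗ[ℝ] Fin 4 → ℝ where
  toFun q := ![q.re, q.imI, q.imJ, q.imK]
  map_add' p q := by ext i; fin_cases i <;> simp
  map_smul' r q := by ext i; fin_cases i <;> simp

lemma contDiff_quatComponents {n : WithTop ℕ∞} : ContDiff ℝ n quatComponents :=
  (LinearMap.toContinuousLinearMap quatComponents).contDiff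

lemma contDiffAt_rot {n : WithTop ℕ∞} {q : ℍ[ℝ]} (hq : q ≠ 0) (i j : Fin 3) :
    ContDiffAt ℝ n (fun q => rot q i j) q := by
  have h (k : Fin 4) : ContDiffAt ℝ n (fun q => quatComponents q k) q :=
    (contDiff_pi.1 contDiff_quatComponents k).contDiffAt
  have h0 : ContDiffAt ℝ n (fun q : ℍ[ℝ] => q.re) q := h 0
  have h1 : ContDiffAt ℝ n (fun q : ℍ[ℝ] => q.imI) q := h 1
  have h2 : ContDiffAt ℝ n (fun q : ℍ[ℝ] => q.imJ) q := h 2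
  have h3 : ContDiffAt ℝ n (fun q : ℍ[ℝ] => q.imK) q := h 3
  have hn : ContDiffAt ℝ n (fun q : ℍ[ℝ] => (qn q)⁻¹) q := by
    refine ContDiffAt.inv ?_ (qn_pos hq).ne'
    unfold qn
    fun_prop
  unfold rot
  simp only [Matrix.smul_apply, smul_eq_mul]
  refine hn.mul ?_
  fin_cases i <;> fin_cases j <;>
  · simp only [Fin.zero_eta, Fin.mk_one, Fin.reduceFinMk, Matrix.of_apply, Matrix.cons_val]
    fun_prop

lemma contDiffAt_paramSpinor {n : WithTop ℕ∞} {P : ℍ[ℝ] × ℝ × ℝ} (hP : P.1 ≠ 0) :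
    ContDiffAt ℝ n paramSpinor P := by
  have hr (i j : Fin 3) : ContDiffAt ℝ n (fun P : ℍ[ℝ] × ℝ × ℝ => rot P.1 i j) P :=
    (contDiffAt_rot hP i j).comp P contDiff_fst.contDiffAt
  have hd (i j : Fin 3) : ContDiffAt ℝ n (fun P : ℍ[ℝ] × ℝ × ℝ =>
      refMatrix P.2.1 (-P.2.1 - P.2.2) P.2.2 i j) P := by
    unfold refMatrix
    fin_cases i <;> fin_cases j <;>
    · simp only [Fin.zero_eta, Fin.mk_one, Fin.reduceFinMk, Matrix.of_apply, Matrix.cons_val]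
      fun_prop
  have hA : ContDiffAt ℝ n (fun P : ℍ[ℝ] × ℝ × ℝ => (fun i j =>
      (rot P.1 * refMatrix P.2.1 (-P.2.1 - P.2.2) P.2.2 * (rot P.1)ᵀ) i j)) P := by
    refine contDiffAt_pi.2 fun i => contDiffAt_pi.2 fun j => ?_
    simp only [Matrix.mul_apply, Matrix.transpose_apply]
    exact ContDiffAt.sum fun k _ => (ContDiffAt.sum fun l _ => (hr i l).mul (hd l k)).mul (hr j k)
  have hl : ContDiff ℝ n (conjSpinor 1) := (LinearMap.toContinuousLinearMap (conjSpinor 1)).contDiff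
  have := hl.contDiffAt.comp P hA
  refine this.congr_of_eventuallyEq (Filter.Eventually.of_forall fun P => ?_)
  simp only [Function.comp, conjSpinor, LinearMap.coe_mk, AddHom.coe_mk, Matrix.transpose_one,
    one_mul, mul_one]
  rfl

lemma hasDerivAt_quadratic (a b c : ℝ) : HasDerivAt (fun t : ℝ => a + b * t + c * t ^ 2) b 0 := by
  have h : HasDerivAt (fun t : ℝ => t) 1 0 := hasDerivAt_id 0
  exact (((h.const_mul b).const_add a).fun_add ((h.fun_pow 2).const_mul c)).congr_deriv (by simp)

/-- The derivative of the rotation matrix at the identity. -/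
def rotDeriv (s : ℍ[ℝ]) : Matrix (Fin 3) (Fin 3) ℝ :=
  !![0, 2 * s.imK, -(2 * s.imJ); -(2 * s.imK), 0, -(2 * s.imI); 2 * s.imJ, 2 * s.imI, 0]

lemma hasDerivAt_rot (s : ℍ[ℝ]) (i j : Fin 3) :
    HasDerivAt (fun t : ℝ => rot (1 + t • s) i j) (rotDeriv s i j) 0 := by
  have hn : HasDerivAt (fun t : ℝ => qn (1 + t • s)) (2 * s.re) 0 := by
    refine (hasDerivAt_quadratic 1 (2 * s.re) (qn s)).congr_of_eventuallyEq
      (Filter.Eventually.of_forall fun t => ?_)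
    simp [qn]; ring
  have h1 : qn (1 + (0 : ℝ) • s) = 1 := by simp [qn]
  have hi := hn.inv (by rw [h1]; exact one_ne_zero)
  rw [h1] at hi
  have key (f : ℝ → ℝ) (a b c : ℝ) (hf : ∀ t, f t = a + b * t + c * t ^ 2) :
      HasDerivAt (fun t => (qn (1 + t • s))⁻¹ * f t) (b - 2 * s.re * a) 0 := by
    have hf' : HasDerivAt f b 0 := (hasDerivAt_quadratic a b c).congr_of_eventuallyEq
      (Filter.Eventually.of_forall hf)
    refine (hi.mul hf').congr_deriv ?_
    rw [Pi.inv_apply, h1, hf 0]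
    ring
  unfold rot
  simp only [Matrix.smul_apply, smul_eq_mul]
  fin_cases i <;> fin_cases j <;>
    simp only [Fin.zero_eta, Fin.mk_one, Fin.reduceFinMk, Matrix.of_apply, Matrix.cons_val]
  · exact (key _ 1 (2 * s.re) (s.re ^ 2 + s.imI ^ 2 - s.imJ ^ 2 - s.imK ^ 2)
      (fun t => by simp; ring)).congr_deriv (by simp [rotDeriv])
  · exact (key _ 0 (2 * s.imK) (-(2 * (s.imI * s.imJ - s.re * s.imK)))
      (fun t => by simp; ring)).congr_deriv (by simp [rotDeriv])
  · exact (key _ 0 (-(2 * s.imJ)) (-(2 * (s.imI * s.imK + s.re * s.imJ)))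
      (fun t => by simp; ring)).congr_deriv (by simp [rotDeriv])
  · exact (key _ 0 (-(2 * s.imK)) (-(2 * (s.imI * s.imJ + s.re * s.imK)))
      (fun t => by simp; ring)).congr_deriv (by simp [rotDeriv])
  · exact (key _ 1 (2 * s.re) (s.re ^ 2 - s.imI ^ 2 + s.imJ ^ 2 - s.imK ^ 2)
      (fun t => by simp; ring)).congr_deriv (by simp [rotDeriv])
  · exact (key _ 0 (-(2 * s.imI)) (2 * (s.imJ * s.imK - s.re * s.imI))
      (fun t => by simp; ring)).congr_deriv (by simp [rotDeriv])
  · exact (key _ 0 (2 * s.imJ) (-(2 * (s.imI * s.imK - s.re * s.imJ)))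
      (fun t => by simp; ring)).congr_deriv (by simp [rotDeriv])
  · exact (key _ 0 (2 * s.imI) (2 * (s.imJ * s.imK + s.re * s.imI))
      (fun t => by simp; ring)).congr_deriv (by simp [rotDeriv])
  · exact (key _ 1 (2 * s.re) (s.re ^ 2 - s.imI ^ 2 - s.imJ ^ 2 + s.imK ^ 2)
      (fun t => by simp; ring)).congr_deriv (by simp [rotDeriv])

lemma rot_one : rot 1 = !![1, 0, 0; 0, 1, 0; 0, 0, 1] := by
  ext i j
  fin_cases i <;> fin_cases j <;> simp [rot, qn]

/-- The differential of the symmetric matrix, in the rotated frame. -/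
def frameMatrix (s : ℍ[ℝ]) (e₁ e₃ f₁ f₃ : ℝ) : Matrix (Fin 3) (Fin 3) ℝ :=
  !![f₃, 2 * (e₁ - e₃) * s.imK, 2 * (e₁ + 2 * e₃) * s.imJ;
    2 * (e₁ - e₃) * s.imK, f₁, 2 * (2 * e₁ + e₃) * s.imI;
    2 * (e₁ + 2 * e₃) * s.imJ, 2 * (2 * e₁ + e₃) * s.imI, -f₃ - f₁]

lemma fderiv_paramSpinor {q : ℍ[ℝ]} (hq : q ≠ 0) (e₁ e₃ : ℝ) (q' : ℍ[ℝ]) (f₁ f₃ : ℝ) :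
    fderiv ℝ paramSpinor (q, e₁, e₃) (q', f₁, f₃)
      = spinor (rot q * frameMatrix (q⁻¹ * q') e₁ e₃ f₁ f₃ * (rot q)ᵀ) := by
  set s := q⁻¹ * q' with hs
  have hline : HasDerivAt (fun t : ℝ => ((q, e₁, e₃) : ℍ[ℝ] × ℝ × ℝ) + t • (q', f₁, f₃))
      (q', f₁, f₃) 0 := by
    simpa using ((hasDerivAt_id (0 : ℝ)).smul_const
      ((q', f₁, f₃) : ℍ[ℝ] × ℝ × ℝ)).const_add (q, e₁, e₃)
  have h1 : HasFDerivAt paramSpinor (fderiv ℝ paramSpinor (q, e₁, e₃))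
      (((q, e₁, e₃) : ℍ[ℝ] × ℝ × ℝ) + (0 : ℝ) • (q', f₁, f₃)) := by
    rw [zero_smul, add_zero]
    exact ((contDiffAt_paramSpinor (n := 1) hq).differentiableAt one_ne_zero).hasFDerivAt
  have h2 := h1.comp_hasDerivAt (0 : ℝ) hline
  have hd (i j : Fin 3) : HasDerivAt (fun t : ℝ =>
      refMatrix (e₁ + t * f₁) (-(e₁ + t * f₁) - (e₃ + t * f₃)) (e₃ + t * f₃) i j)
      (refMatrix f₁ (-f₁ - f₃) f₃ i j) 0 := by
    have hlin (a b : ℝ) : HasDerivAt (fun t : ℝ => a + t * b) b 0 := by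
      simpa using ((hasDerivAt_id (0 : ℝ)).mul_const b).const_add a
    unfold refMatrix
    fin_cases i <;> fin_cases j <;>
      simp only [Fin.zero_eta, Fin.mk_one, Fin.reduceFinMk, Matrix.of_apply, Matrix.cons_val]
    · exact hlin _ _
    · exact hasDerivAt_const _ _
    · exact hasDerivAt_const _ _
    · exact hasDerivAt_const _ _
    · exact hlin _ _
    · exact hasDerivAt_const _ _
    · exact hasDerivAt_const _ _
    · exact hasDerivAt_const _ _
    · exact (hlin e₁ f₁).neg.sub (hlin e₃ f₃)
  have hM : HasDerivAt (fun t : ℝ => (fun i j => (rot (1 + t • s) *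
      refMatrix (e₁ + t * f₁) (-(e₁ + t * f₁) - (e₃ + t * f₃)) (e₃ + t * f₃) *
      (rot (1 + t • s))ᵀ) i j)) (fun i j => frameMatrix s e₁ e₃ f₁ f₃ i j) 0 := by
    refine hasDerivAt_pi.2 fun i => hasDerivAt_pi.2 fun j => ?_
    simp only [Matrix.mul_apply, Matrix.transpose_apply]
    refine (HasDerivAt.fun_sum fun k _ => (HasDerivAt.fun_sum fun l _ =>
      (hasDerivAt_rot s i l).mul (hd l k)).mul (hasDerivAt_rot s j k)).congr_deriv ?_
    simp only [zero_smul, add_zero, zero_mul]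
    fin_cases i <;> fin_cases j <;>
    · simp [frameMatrix, rotDeriv, refMatrix, Fin.sum_univ_three, rot_one]
      try ring
  have h3 := ((LinearMap.toContinuousLinearMap (conjSpinor (rot q))).hasFDerivAt
    (x := fun i j => (rot (1 + (0 : ℝ) • s) * refMatrix (e₁ + 0 * f₁)
      (-(e₁ + 0 * f₁) - (e₃ + 0 * f₃)) (e₃ + 0 * f₃) *
      (rot (1 + (0 : ℝ) • s))ᵀ) i j)).comp_hasDerivAt (0 : ℝ) hM
  refine h2.unique (h3.congr_of_eventuallyEq (Filter.Eventually.of_forall fun t => ?_))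
  -- Multiplicativity of `rot` moves the derivative to the identity, where only q⁻¹q' enters. The
  -- result is the commutator of `rotDeriv` with the diagonal matrix plus the variation of the
  -- eigenvalues.
  have hq' : q + t • q' = q * (1 + t • s) := by
    rw [mul_add, mul_one, mul_smul_comm, hs, mul_inv_cancel_left₀ hq]
  simp only [Function.comp, paramSpinor, Prod.fst_add, Prod.smul_fst, Prod.snd_add, Prod.smul_snd,
    smul_eq_mul, hq', rot_mul]
  change _ = spinor (rot q * Matrix.of _ * (rot q)ᵀ)
  congr 1
  have hof (N : Matrix (Fin 3) (Fin 3) ℝ) : Matrix.of (fun i j => N i j) = N := rfl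
  rw [Matrix.transpose_mul, hof]
  simp only [mul_assoc]

/-- Real coordinates of a real spin-2 object. -/
def spinCoords : (Fin 5 → ℂ) →L[ℝ] Fin 5 → ℝ :=
  LinearMap.toContinuousLinearMap
    { toFun := fun y => ![(y 4).re, (y 4).im, (y 3).re, (y 3).im, (y 2).re]
      map_add' := fun x y => by ext i; fin_cases i <;> simp
      map_smul' := fun r y => by ext i; fin_cases i <;> simp }

lemma spinCoords_apply (y : Fin 5 → ℂ) :
    spinCoords y = ![(y 4).re, (y 4).im, (y 3).re, (y 3).im, (y 2).re] := rfl

lemma eq_of_spinCoords_eq {x y : Fin 5 → ℂ} (hx : IsAltReal x) (hy : IsAltReal y)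
    (h : spinCoords x = spinCoords y) : x = y := by
  rw [← spinor_spinorMatrix hx, ← spinor_spinorMatrix hy]
  rw [spinCoords_apply, spinCoords_apply] at h
  have h0 : (x 4).re = (y 4).re := congrFun h 0
  have h1 : (x 4).im = (y 4).im := congrFun h 1
  have h2 : (x 3).re = (y 3).re := congrFun h 2
  have h3 : (x 3).im = (y 3).im := congrFun h 3
  have h4 : (x 2).re = (y 2).re := congrFun h 4
  rw [spinorMatrix, spinorMatrix, h0, h1, h2, h3, h4]

lemma isAltReal_paramSpinor (P : ℍ[ℝ] × ℝ × ℝ) : IsAltReal (paramSpinor P) := isAltReal_spinor _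

lemma isSymTraceless_frameMatrix (s : ℍ[ℝ]) (e₁ e₃ f₁ f₃ : ℝ) :
    IsSymTraceless (frameMatrix s e₁ e₃ f₁ f₃) := isSymTraceless_of _ _ _ _ _

lemma spinor_conj_injective {q : ℍ[ℝ]} (hq : q ≠ 0) {A B : Matrix (Fin 3) (Fin 3) ℝ}
    (hA : IsSymTraceless A) (hB : IsSymTraceless B)
    (h : spinor (rot q * A * (rot q)ᵀ) = spinor (rot q * B * (rot q)ᵀ)) : A = B := by
  have hR := mul_eq_one_comm.1 (rot_mul_transpose hq)
  have h1 := congrArg spinorMatrix h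
  rw [spinorMatrix_spinor (hA.conj hR), spinorMatrix_spinor (hB.conj hR)] at h1
  have h2 (X : Matrix (Fin 3) (Fin 3) ℝ) : (rot q)ᵀ * (rot q * X * (rot q)ᵀ) * rot q = X := by
    calc _ = ((rot q)ᵀ * rot q) * X * ((rot q)ᵀ * rot q) := by simp only [mul_assoc]
      _ = X := by rw [hR, one_mul, mul_one]
  rw [← h2 A, h1, h2]

/-- The quaternionic parametrization, completed by a normalization of the quaternion to a local
diffeomorphism. -/
def paramCoords (q₀ : ℍ[ℝ]) (P : ℍ[ℝ] × ℝ × ℝ) : ℝ × (Fin 5 → ℝ) :=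
  (quatComponents (q₀⁻¹ * P.1) 0, spinCoords (paramSpinor P))

lemma contDiffAt_paramCoords {n : WithTop ℕ∞} (q₀ : ℍ[ℝ]) {P : ℍ[ℝ] × ℝ × ℝ} (hP : P.1 ≠ 0) :
    ContDiffAt ℝ n (paramCoords q₀) P := by
  refine ContDiffAt.prodMk ?_ (spinCoords.contDiff.contDiffAt.comp P (contDiffAt_paramSpinor hP))
  exact (contDiff_pi.1 (contDiff_quatComponents.comp
    (contDiff_const.mul contDiff_fst)) 0).contDiffAt

lemma fderiv_paramCoords {q : ℍ[ℝ]} (hq : q ≠ 0) (e₁ e₃ : ℝ) (q' : ℍ[ℝ]) (f₁ f₃ : ℝ) :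
    fderiv ℝ (paramCoords q) (q, e₁, e₃) (q', f₁, f₃) = ((q⁻¹ * q').re,
      spinCoords (spinor (rot q * frameMatrix (q⁻¹ * q') e₁ e₃ f₁ f₃ * (rot q)ᵀ))) := by
  let l : ℍ[ℝ] × ℝ × ℝ →L[ℝ] ℝ := LinearMap.toContinuousLinearMap
    ((LinearMap.proj 0 : (Fin 4 → ℝ) →ₗ[ℝ] ℝ) ∘ₗ quatComponents ∘ₗ
      LinearMap.mulLeft ℝ q⁻¹ ∘ₗ LinearMap.fst ℝ ℍ[ℝ] (ℝ × ℝ))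
  have h2 : HasFDerivAt paramSpinor (fderiv ℝ paramSpinor (q, e₁, e₃)) (q, e₁, e₃) :=
    ((contDiffAt_paramSpinor (n := 1) hq).differentiableAt one_ne_zero).hasFDerivAt
  have h3 : HasFDerivAt (paramCoords q)
      (l.prod (spinCoords.comp (fderiv ℝ paramSpinor (q, e₁, e₃)))) (q, e₁, e₃) :=
    l.hasFDerivAt.prodMk (spinCoords.hasFDerivAt.comp _ h2)
  rw [h3.fderiv, ContinuousLinearMap.prod_apply, ContinuousLinearMap.comp_apply,
    fderiv_paramSpinor hq]
  rfl

/-- The off-diagonal entries of `frameMatrix` are σ₁, σ₂, σ₃ multiplied by twice the eigenvalue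
differences e₁ - e₂, e₃ - e₂, e₁ - e₃. The remaining direction, rescaling q, is detected by the
added coordinate. -/
lemma fderiv_paramCoords_injective {q : ℍ[ℝ]} (hq : q ≠ 0) {e₁ e₃ : ℝ} (h₁₂ : -e₁ - e₃ < e₁)
    (h₂₃ : e₃ < -e₁ - e₃) :
    Function.Injective (fderiv ℝ (paramCoords q) (q, e₁, e₃)) := by
  rw [injective_iff_map_eq_zero]
  rintro ⟨q', f₁, f₃⟩ h
  rw [fderiv_paramCoords hq, Prod.mk_eq_zero] at h
  obtain ⟨h0, h1⟩ := h
  have hz : spinor (rot q * 0 * (rot q)ᵀ) = 0 := by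
    rw [mul_zero, zero_mul]
    simpa using spinor_smul 0 0
  have h2 : frameMatrix (q⁻¹ * q') e₁ e₃ f₁ f₃ = 0 := by
    refine spinor_conj_injective hq (isSymTraceless_frameMatrix _ _ _ _ _) ⟨by simp, by simp⟩ ?_
    refine eq_of_spinCoords_eq (isAltReal_spinor _) (isAltReal_spinor _) ?_
    rw [h1, hz, map_zero]
  have a00 := congrFun (congrFun h2 0) 0
  have a11 := congrFun (congrFun h2 1) 1
  have a01 := congrFun (congrFun h2 0) 1
  have a02 := congrFun (congrFun h2 0) 2
  have a12 := congrFun (congrFun h2 1) 2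
  simp only [frameMatrix, Matrix.of_apply, Matrix.cons_val, Matrix.zero_apply] at a00 a11 a01 a02 a12
  have b3 := (mul_eq_zero.1 a01).resolve_left (by linarith)
  have b2 := (mul_eq_zero.1 a02).resolve_left (by linarith)
  have b1 := (mul_eq_zero.1 a12).resolve_left (by linarith)
  have hs : q⁻¹ * q' = 0 := by
    ext
    · exact h0
    · exact b1
    · exact b2
    · exact b3
  have hq' : q' = 0 := by
    rw [← mul_inv_cancel_left₀ hq q', hs, mul_zero]
  rw [hq', a00, a11]
  rfl

lemma exists_local_params {x₀ : Fin 5 → ℂ} {q : ℍ[ℝ]} {e₁ e₂ e₃ : ℝ}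
    (hp : IsQuatParam x₀ q e₁ e₂ e₃) (h₁₂ : e₂ < e₁) (h₂₃ : e₃ < e₂) :
    ∃ (W : Set (Fin 5 → ℂ)) (ψ : (Fin 5 → ℂ) → ℍ[ℝ] × ℝ × ℝ), IsOpen W ∧ x₀ ∈ W ∧
      ∀ y ∈ W, ContDiffAt ℝ ∞ ψ y ∧ -(ψ y).2.1 - (ψ y).2.2 < (ψ y).2.1 ∧
        (ψ y).2.2 < -(ψ y).2.1 - (ψ y).2.2 ∧
        (IsAltReal y → IsQuatParam y (ψ y).1 (ψ y).2.1 (-(ψ y).2.1 - (ψ y).2.2) (ψ y).2.2) := by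
  have hq := hp.q_ne
  obtain rfl : e₂ = -e₁ - e₃ := by linarith [hp.sum_eq]
  have hx₀ : paramSpinor (q, e₁, e₃) = x₀ := (eq_spinor_of_isQuatParam hp).symm
  -- Order `ω` is used because analyticity at a point extends to a neighbourhood, which `ContDiffAt`
  -- of order `∞` does not provide.
  have hf : ContDiffAt ℝ ω (paramCoords q) (q, e₁, e₃) := contDiffAt_paramCoords q hq
  have hdim : Module.finrank ℝ (ℍ[ℝ] × ℝ × ℝ) = Module.finrank ℝ (ℝ × (Fin 5 → ℝ)) := by
    simp [Quaternion.finrank_eq_four]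
  let f' : (ℍ[ℝ] × ℝ × ℝ) ≃L[ℝ] ℝ × (Fin 5 → ℝ) :=
    (LinearMap.linearEquivOfInjective
      (fderiv ℝ (paramCoords q) (q, e₁, e₃) : (ℍ[ℝ] × ℝ × ℝ) →ₗ[ℝ] ℝ × (Fin 5 → ℝ))
      (fderiv_paramCoords_injective hq h₁₂ h₂₃) hdim).toContinuousLinearEquiv
  have hf' : HasFDerivAt (paramCoords q) (f' : (ℍ[ℝ] × ℝ × ℝ) →L[ℝ] ℝ × (Fin 5 → ℝ))
      (q, e₁, e₃) :=
    (hf.differentiableAt (by simp)).hasFDerivAt.congr_fderiv (by ext v <;> rfl)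
  have h0 : (ω : WithTop ℕ∞) ≠ 0 := by simp
  set Φ := hf.toOpenPartialHomeomorph (paramCoords q) hf' h0 with hΦ
  have hsymm : ContDiffAt ℝ ω Φ.symm (paramCoords q (q, e₁, e₃)) := hf.to_localInverse hf' h0
  have hval : Φ.symm (paramCoords q (q, e₁, e₃)) = (q, e₁, e₃) :=
    hf.localInverse_apply_image hf' h0
  -- The first entry 1 is the value of Re(q₀⁻¹q) at q = q₀; keeping it constant fixes the scale of
  -- the quaternion.
  let ι : (Fin 5 → ℂ) → ℝ × (Fin 5 → ℝ) := fun y => (1, spinCoords y)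
  have hι : ContDiff ℝ ∞ ι := contDiff_const.prodMk spinCoords.contDiff
  have hι₀ : ι x₀ = paramCoords q (q, e₁, e₃) := by
    simp only [ι, paramCoords, hx₀, inv_mul_cancel₀ hq]
    rfl
  have hc : ContinuousAt Φ.symm (ι x₀) := by rw [hι₀]; exact hsymm.continuousAt
  have hev : ∀ᶠ z in nhds (ι x₀), ContDiffAt ℝ ω Φ.symm z ∧ z ∈ Φ.target ∧ (Φ.symm z).1 ≠ 0 ∧
      -(Φ.symm z).2.1 - (Φ.symm z).2.2 < (Φ.symm z).2.1 ∧
      (Φ.symm z).2.2 < -(Φ.symm z).2.1 - (Φ.symm z).2.2 := by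
    refine Filter.Eventually.and ?_ (Filter.Eventually.and ?_ (Filter.Eventually.and ?_
      (Filter.Eventually.and ?_ ?_)))
    · rw [hι₀]; exact hsymm.eventually (by simp)
    · rw [hι₀]
      exact Φ.open_target.mem_nhds (hf.image_mem_toOpenPartialHomeomorph_target hf' h0)
    · exact hc.fst.eventually_ne (by rw [hι₀, hval]; exact hq)
    · refine (hc.snd.fst.neg.sub hc.snd.snd).eventually_lt hc.snd.fst ?_
      simp only [Pi.sub_apply, Pi.neg_apply, hι₀, hval]; exact h₁₂
    · refine hc.snd.snd.eventually_lt (hc.snd.fst.neg.sub hc.snd.snd) ?_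
      rw [hι₀, hval]; exact h₂₃
  obtain ⟨W, hW, hWo, hxW⟩ := eventually_nhds_iff.1 (hι.continuous.continuousAt.eventually hev)
  refine ⟨W, fun y => Φ.symm (ι y), hWo, hxW, fun y hy => ?_⟩
  obtain ⟨k1, k2, k3, k4, k5⟩ := hW y hy
  refine ⟨(k1.of_le le_top).comp y hι.contDiffAt, k4, k5, fun hyr => ?_⟩
  have hr : paramCoords q (Φ.symm (ι y)) = ι y := Φ.right_inv k2
  have hr2 : spinCoords (paramSpinor (Φ.symm (ι y))) = spinCoords y := congrArg Prod.snd hr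
  exact isQuatParam_of_eq_spinor k3 (by ring) k4.le k5.le
    (eq_of_spinCoords_eq (isAltReal_paramSpinor _) hyr hr2).symm

lemma discr_eq {y : Fin 5 → ℂ} {q : ℍ[ℝ]} {e₁ e₂ e₃ : ℝ} (h : IsQuatParam y q e₁ e₂ e₃) :
    discr y = (((e₁ - e₂) * (e₂ - e₃) * (e₁ - e₃)) ^ 2 : ℝ) := by
  have h0 := cubic_eq_of_isQuatParam h 0
  -- The values of the cubic at 0 and 1 determine g₃ and then g₂.
  have h1 := cubic_eq_of_isQuatParam h 1
  have hs : (e₃ : ℂ) = -e₁ - e₂ := by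
    have : e₃ = -e₁ - e₂ := by linarith [h.sum_eq]
    exact_mod_cast this
  have g3 : g₃ y = e₁ * e₂ * e₃ := by linear_combination -h0
  have g2 : g₂ y = e₁ ^ 2 + e₁ * e₂ + e₂ ^ 2 := by
    rw [g3, hs] at h1
    linear_combination -h1
  rw [discr, g2, g3]
  push_cast
  rw [hs]
  ring

section SmoothParameters

variable {M : Type*} [TopologicalSpace M] [ChartedSpace (EuclideanSpace ℝ (Fin 4)) M]

theorem exists_isQuatFrameOn {x : M → Fin 5 → ℂ}
    (hx : ContMDiff (𝓡 4) 𝓘(ℝ, Fin 5 → ℂ) ∞ x) (hxr : ∀ p, IsAltReal (x p)) {p : M}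
    (hp : discr (x p) ≠ 0) :
    ∃ (V : Set M) (q : M → ℍ[ℝ]) (e₁ e₂ e₃ : M → ℝ), p ∈ V ∧ IsQuatFrameOn V x q e₁ e₂ e₃ := by
  obtain ⟨q, e₁, e₂, e₃, h⟩ := exists_isQuatParam (hxr p)
  rw [discr_eq h] at hp
  have h₁₂ : e₂ < e₁ := lt_of_le_of_ne h.le₁₂ fun he => hp (by rw [he]; simp)
  have h₂₃ : e₃ < e₂ := lt_of_le_of_ne h.le₂₃ fun he => hp (by rw [he]; simp)
  obtain ⟨W, ψ, hW, hpW, hψ⟩ := exists_local_params h h₁₂ h₂₃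
  have hs (r : M) (hr : r ∈ x ⁻¹' W) :
      ContMDiffAt (𝓡 4) 𝓘(ℝ, ℍ[ℝ] × ℝ × ℝ) ∞ (fun r => ψ (x r)) r :=
    (hψ _ hr).1.contMDiffAt.comp r (hx r)
  have hl {F : Type} [NormedAddCommGroup F] [NormedSpace ℝ F] (l : ℍ[ℝ] × ℝ × ℝ →L[ℝ] F) :
      ContMDiffOn (𝓡 4) 𝓘(ℝ, F) ∞ (fun r => l (ψ (x r))) (x ⁻¹' W) := fun r hr =>
    (l.contDiff.contDiffAt.contMDiffAt.comp r (hs r hr)).contMDiffWithinAt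
  refine ⟨x ⁻¹' W, fun r => (ψ (x r)).1, fun r => (ψ (x r)).2.1,
    fun r => -(ψ (x r)).2.1 - (ψ (x r)).2.2, fun r => (ψ (x r)).2.2, hpW,
    hW.preimage hx.continuous, fun r hr => (hψ _ hr).2.2.2 (hxr r), fun r hr => (hψ _ hr).2.1,
    fun r hr => (hψ _ hr).2.2.1, ?_, ?_, ?_, ?_⟩
  · exact hl (ContinuousLinearMap.fst ℝ ℍ[ℝ] (ℝ × ℝ))
  · exact hl ((ContinuousLinearMap.fst ℝ ℝ ℝ).comp (ContinuousLinearMap.snd ℝ ℍ[ℝ] (ℝ × ℝ)))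
  · exact hl (-((ContinuousLinearMap.fst ℝ ℝ ℝ).comp (ContinuousLinearMap.snd ℝ ℍ[ℝ] (ℝ × ℝ))) -
      (ContinuousLinearMap.snd ℝ ℝ ℝ).comp (ContinuousLinearMap.snd ℝ ℍ[ℝ] (ℝ × ℝ)))
  · exact hl ((ContinuousLinearMap.snd ℝ ℝ ℝ).comp (ContinuousLinearMap.snd ℝ ℍ[ℝ] (ℝ × ℝ)))

end SmoothParameters

/-! ### Passage to h̊ and to the frame dρ, σ₁, σ₂, σ₃. -/

/-- Every real spin-2 object is the dual spinor of a symmetric traceless matrix. -/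
lemma exists_dualSpinor_eq {h : Fin 5 → ℂ} (hh : IsAltReal h) :
    ∃ B, IsSymTraceless B ∧ dualSpinor B = h := by
  refine ⟨_, isSymTraceless_spinorMatrix fun a => ((sphNorm 2 a ^ 2 : ℝ) : ℂ)⁻¹ * h a, ?_⟩
  ext a
  rw [dualSpinor, spinor_spinorMatrix]
  · have h0 : (sphNorm 2 a : ℂ) ≠ 0 := by exact_mod_cast (sphNorm_pos 2 a).ne'
    simp only [normalize]
    push_cast
    field_simp
  · simp only [fun a => congrFun sphNorm_two_sq a]
    rw [isAltReal_iff]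
    simp [hh.conj_two, hh.conj_three, hh.conj_four, Complex.conj_ofNat]

/-- The pairing of h with dx is a quarter of the invariant trace pairing, so the constraint is
rotation invariant and takes the form required by `spinForms_eq`. -/
lemma constraint_dualSpinor_iff {A B : Matrix (Fin 3) (Fin 3) ℝ} (hB : IsSymTraceless B)
    (hA : IsSymTraceless A) : Constraint (dualSpinor B) (spinor A) ↔ (B * A).trace = 0 := by
  have h : ∑ a, conj (dualSpinor B a) * spinor A a = (((B * A).trace / 4 : ℝ) : ℂ) := by
    rw [dualSpinor_eq]
    obtain ⟨b₁, b₂, b₃, b₄, b₅, rfl⟩ := hB.exists_eq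
    obtain ⟨a₁, a₂, a₃, a₄, a₅, rfl⟩ := hA.exists_eq
    apply Complex.ext <;>
    · simp [Fin.sum_univ_five, spinor, Matrix.trace_fin_three]
      ring
  rw [Constraint, h, Complex.ofReal_eq_zero]
  constructor <;> intro h <;> linarith

/-- The symplectic forms are covariant under rotations of the spin-2 objects. -/
lemma spinForms_ringed {h : Fin 5 → ℂ} (hh : IsAltReal h) {q : ℍ[ℝ]} (hq : q ≠ 0) :
    IsAltReal (ringed q h) ∧ ∀ A C, IsSymTraceless A → IsSymTraceless C →
      Constraint h (spinor (rot q * A * (rot q)ᵀ)) →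
      Constraint h (spinor (rot q * C * (rot q)ᵀ)) →
      Constraint (ringed q h) (spinor A) ∧
      spinForms h (spinor (rot q * A * (rot q)ᵀ)) (spinor (rot q * C * (rot q)ᵀ))
        = wignerE 1 q *ᵥ spinForms (ringed q h) (spinor A) (spinor C) := by
  obtain ⟨B, hB, rfl⟩ := exists_dualSpinor_eq hh
  have hR := rot_mul_transpose hq
  have hR' := mul_eq_one_comm.1 hR
  rw [ringed_dualSpinor hq]
  refine ⟨isAltReal_dualSpinor _, fun A C hA hC hBA hBC => ?_⟩
  set B' := (rot q)ᵀ * B * rot q with hB'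
  have hBs : IsSymTraceless B' := by
    have := hB.conj (R := (rot q)ᵀ) (by rwa [Matrix.transpose_transpose])
    rwa [Matrix.transpose_transpose] at this
  have hBB : B = rot q * B' * (rot q)ᵀ := by
    calc B = (rot q * (rot q)ᵀ) * B * (rot q * (rot q)ᵀ) := by rw [hR, one_mul, mul_one]
      _ = _ := by rw [hB']; simp only [mul_assoc]
  have ht {X : Matrix (Fin 3) (Fin 3) ℝ} (hX : IsSymTraceless X)
      (h : Constraint (dualSpinor B) (spinor (rot q * X * (rot q)ᵀ))) : (B' * X).trace = 0 := by
    rw [constraint_dualSpinor_iff hB (hX.conj hR'), ← mul_assoc, Matrix.trace_mul_comm,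
      ← mul_assoc, ← mul_assoc] at h
    exact h
  refine ⟨(constraint_dualSpinor_iff hBs hA).2 (ht hA hBA), ?_⟩
  rw [spinForms_eq hBs hA hC (ht hA hBA) (ht hC hBC), wignerE_one_spinVec, hBB,
    spinForms_rot hq hBs hA hC (ht hA hBA) (ht hC hBC)]

lemma det_quatToChi (ρ e₂ : ℝ) :
    (quatToChi ρ e₂).det = ((ρ * (9 * e₂ ^ 2 - ρ ^ 2) : ℝ) : ℂ) := by
  have hI := Complex.I_mul_I
  simp [quatToChi, Matrix.det_succ_row_zero, Fin.sum_univ_succ, Fin.succAbove]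
  linear_combination (-(9 * e₂ ^ 2 - ρ ^ 2) * ρ) * hI

/-- For vanishing sum, 3e₂ + ρ = 2(e₂ - e₃) and 3e₂ - ρ = 2(e₂ - e₁), so the determinant is -4 times
the product of the eigenvalue differences. -/
lemma det_quatToChi_ne_zero {e₁ e₂ e₃ : ℝ} (hs : e₁ + e₂ + e₃ = 0) (h₁₂ : e₂ < e₁)
    (h₂₃ : e₃ < e₂) : (quatToChi (e₁ - e₃) e₂).det ≠ 0 := by
  rw [det_quatToChi]
  have h : (e₁ - e₃) * (9 * e₂ ^ 2 - (e₁ - e₃) ^ 2)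
      = -(4 * (e₁ - e₃) * (e₁ - e₂) * (e₂ - e₃)) := by
    obtain rfl : e₂ = -e₁ - e₃ := by linarith
    ring
  rw [h]
  have h1 := sub_pos.2 h₁₂
  have h2 := sub_pos.2 h₂₃
  have h3 : 0 < e₁ - e₃ := by linarith
  exact_mod_cast (neg_lt_zero.2 (by positivity)).ne

/-- This explains the first change of frame: the χ_m are the components of labels ±2, ±1 of the
differential of the coefficients, seen in the rotated frame. -/
lemma quatToChi_mulVec {e₁ e₂ e₃ ρ : ℝ} (hs : e₁ + e₂ + e₃ = 0) (hρ : ρ = e₁ - e₃) (s : ℍ[ℝ])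
    (f₁ f₃ : ℝ) :
    (quatToChi ρ e₂ *ᵥ fun a => ((![f₁ - f₃, s.imI, s.imJ, s.imK] a : ℝ) : ℂ))
      = ![spinor (frameMatrix s e₁ e₃ f₁ f₃) 4, spinor (frameMatrix s e₁ e₃ f₁ f₃) 3,
        spinor (frameMatrix s e₁ e₃ f₁ f₃) 1, spinor (frameMatrix s e₁ e₃ f₁ f₃) 0] := by
  obtain rfl : e₂ = -e₁ - e₃ := by linarith
  subst hρ
  ext a
  fin_cases a <;> apply Complex.ext <;>
  · simp [quatToChi, Matrix.mulVec, dotProduct, Fin.sum_univ_four, frameMatrix, spinor]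
    try first
      | ring1
      | exact Or.inl (by ring)

/-- A constraint with `h_0 = 0` is a linear relation in the quaternionic frame. -/
lemma eq_zero_of_constraint_frameMatrix {T : Type*} {h : Fin 5 → ℂ} (hh : IsAltReal h)
    (h2 : h 2 = 0) {e₁ e₂ e₃ : ℝ} (hs : e₁ + e₂ + e₃ = 0) (h₁₂ : e₂ < e₁) (h₂₃ : e₃ < e₂)
    {s : T → ℍ[ℝ]} {f₁ f₃ : T → ℝ}
    (hli : LinearIndependent ℝ ![fun X => f₁ X - f₃ X, fun X => (s X).imI, fun X => (s X).imJ,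
      fun X => (s X).imK])
    (hc : ∀ X, Constraint h (spinor (frameMatrix (s X) e₁ e₃ (f₁ X) (f₃ X)))) : h = 0 := by
  rw [Fintype.linearIndependent_iff] at hli
  -- These are half the coefficients of the constraint: with h_0 = 0 the trace directions drop out
  -- and only f₁ - f₃ and the three σ's remain. The eigenvalue factors are non-zero, so independence
  -- kills h_1 and h_2.
  have h0 := hli ![(h 4).re / 4, -2 * (2 * e₁ + e₃) * (h 3).im, -2 * (e₁ + 2 * e₃) * (h 3).re,
    -(e₁ - e₃) * (h 4).im] (by
      ext X
      have := (hc X).eq hh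
      rw [h2, ← hh.conj_four, ← neg_eq_iff_eq_neg.2 hh.conj_three] at this
      have := congrArg Complex.re this
      simp [frameMatrix, spinor] at this
      simp [Fin.sum_univ_four]
      linear_combination this / 2)
  have a0 := h0 0
  have a1 := h0 1
  have a2 := h0 2
  have a3 := h0 3
  simp only [Matrix.cons_val] at a0 a1 a2 a3
  have b1 := (mul_eq_zero.1 a1).resolve_left (by linarith)
  have b2 := (mul_eq_zero.1 a2).resolve_left (by linarith)
  have b3 := (mul_eq_zero.1 a3).resolve_left (by linarith)
  have e4 : h 4 = 0 := Complex.ext (by simpa using a0) b3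
  have e3 : h 3 = 0 := Complex.ext b2 b1
  have e0 : h 0 = 0 := by rw [← hh.conj_four, e4, map_zero]
  have e1 : h 1 = 0 := by rw [← neg_eq_zero, ← hh.conj_three, e3, map_zero]
  ext a
  fin_cases a
  exacts [e0, e1, h2, e3, e4]

lemma pfaffianPairing_sum {T : Type*} (e : Fin 4 → T) (F : Fin 3 → T → T → ℂ) (c c' : Fin 3 → ℂ) :
    pfaffianPairing e (fun X Y => ∑ k, c k * F k X Y) (fun X Y => ∑ k, c' k * F k X Y)
      = ∑ k, ∑ l, c k * c' l * pfaffianPairing e (F k) (F l) := by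
  simp only [pfaffianPairing, Fin.sum_univ_three]
  ring

/-! ### Differentials on the manifold. -/

section Manifold

variable {M : Type*} [TopologicalSpace M] [ChartedSpace (EuclideanSpace ℝ (Fin 4)) M]
  {F G : Type*} [NormedAddCommGroup F] [NormedSpace ℝ F] [NormedAddCommGroup G] [NormedSpace ℝ G]

lemma d_comp {x : M → F} {p : M} (hx : MDifferentiableAt (𝓡 4) 𝓘(ℝ, F) x p) {f : F → G}
    {f' : F →L[ℝ] G} (hf : HasFDerivAt f f' (x p)) (X : TangentSpace (𝓡 4) p) :
    d (fun r => f (x r)) p X = f' (d x p X) := by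
  have h : HasMFDerivAt (𝓡 4) 𝓘(ℝ, G) (fun r => f (x r)) p (f'.comp (d x p)) :=
    HasMFDerivAt.comp (I' := 𝓘(ℝ, F)) p hf.hasMFDerivAt hx.hasMFDerivAt
  rw [d, h.mfderiv]
  rfl

variable {U : Set (Fin 5 → ℂ)} {L : (Fin 5 → ℂ) → ℂ} {x : M → Fin 5 → ℂ}

lemma IsGLTSpace.mdifferentiableAt (hM : IsGLTSpace U L x) (p : M) :
    MDifferentiableAt (𝓡 4) 𝓘(ℝ, Fin 5 → ℂ) x p :=
  (hM.smooth p).mdifferentiableAt (by simp)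

lemma IsGLTSpace.d_apply (hM : IsGLTSpace U L x) (p : M) (a : Fin 5) (X : TangentSpace (𝓡 4) p) :
    d (fun r => x r a) p X = d x p X a :=
  d_comp (hM.mdifferentiableAt p) (hasFDerivAt_apply (𝕜 := ℝ) a (x p)) X

lemma IsGLTSpace.d_pd (hM : IsGLTSpace U L x) (p : M) (a : Fin 5) (c : ℂ)
    (X : TangentSpace (𝓡 4) p) :
    d (fun r => c * pd L a (x r)) p X = c * ∑ b, d x p X b * pd (pd L a) b (x p) := by
  have h := ((hM.contour.differentiableAt_pd (hM.mem p) a).hasFDerivAt.const_mul c)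
  rw [d_comp (hM.mdifferentiableAt p) (h.restrictScalars ℝ) X, ← fderiv_apply_eq_sum_pd]
  rfl

lemma IsGLTSpace.constraint_d (hM : IsGLTSpace U L x) (p : M) (X : TangentSpace (𝓡 4) p) :
    Constraint (hfun L (x p)) (d x p X) := by
  have h := hM.d_pd p 2 1 X
  simp only [hM.constraint, mul_zero, one_mul] at h
  rw [constraint_hfun_iff, fderiv_apply_eq_sum_pd, ← h, d, mfderiv_const]
  rfl

/-- The symplectic forms in terms of the differential of the coefficients. -/
lemma IsGLTSpace.gltForms_eq (hM : IsGLTSpace U L x) (p : M) (X Y : TangentSpace (𝓡 4) p) :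
    (fun m => gltForms L x p m X Y) = spinForms (hfun L (x p)) (d x p X) (d x p Y) := by
  have hpd {a b c : Fin 5} (h : (a : ℕ) + b = 2 + c) :
      pd (pd L a) b (x p) = conj (hfun L (x p) c) := by
    rw [hfun, Complex.conj_conj]
    exact hM.contour.pd_pd_eq (hM.mem p) h
  have hdz (X : TangentSpace (𝓡 4) p) : d (zCoord x) p X = d x p X 4 := hM.d_apply p 4 X
  have hdx (X : TangentSpace (𝓡 4) p) : d (fun r => x r 3) p X = d x p X 3 := hM.d_apply p 3 X
  have hdu (X : TangentSpace (𝓡 4) p) : d (uCoord L x) p X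
      = Complex.I * ∑ b, d x p X b * pd (pd L 3) b (x p) := hM.d_pd p 3 Complex.I X
  have hdp (X : TangentSpace (𝓡 4) p) : d (pNext L x) p X
      = Complex.I * ∑ b, d x p X b * pd (pd L 4) b (x p) := hM.d_pd p 4 Complex.I X
  -- This derivative is not one of the h's. Its contribution to du drops out of du ∧ dz, and in ω₀
  -- it cancels against the dx₁ term of dp₋₂ ∧ dz.
  have h34 : pd (pd L 3) 4 (x p) = pd (pd L 4) 3 (x p) :=
    hM.contour.pd_pd_eq (hM.mem p) rfl
  simp only [Fin.sum_univ_five] at hdu hdp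
  rw [hpd (c := 1) rfl, hpd (c := 2) rfl, hpd (c := 3) rfl, hpd (c := 4) rfl, h34] at hdu
  rw [hpd (c := 2) rfl, hpd (c := 3) rfl, hpd (c := 4) rfl] at hdp
  have h2 : gltForms L x p 2 X Y = spinForms (hfun L (x p)) (d x p X) (d x p Y) 2 := by
    simp only [gltForms, spinForms, wedge, Matrix.cons_val, hdz, hdu]
    ring
  ext m
  fin_cases m
  · rw [Fin.zero_eta, spinForms_zero, ← h2]
    rfl
  · simp only [gltForms, spinForms, wedge, Matrix.cons_val, hdz, hdu, hdx, hdp, Fin.mk_one]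
    ring
  · exact h2

/-- The form `ω_+ = du ∧ dz` is a non-degenerate complex form. -/
lemma IsGLTSpace.exists_frame (hM : IsGLTSpace U L x) (p : M) :
    ∃ e : Fin 4 → TangentSpace (𝓡 4) p,
      pfaffianPairing e (gltForms L x p 2) (gltForms L x p 0) ≠ 0 := by
  have hs (w : ℂ × ℂ) := (hM.coords p).2 w
  choose f hf using hs
  have h1 (w : ℂ × ℂ) : d (zCoord x) p (f w) = w.1 := congrArg Prod.fst (hf w)
  have h2 (w : ℂ × ℂ) : d (uCoord L x) p (f w) = w.2 := congrArg Prod.snd (hf w)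
  -- On the real basis dual to Re z, Im z, Re u, Im u the product of ω₊ and ω₋ is evaluated
  -- explicitly.
  refine ⟨fun i => f (![(1, 0), (Complex.I, 0), (0, 1), (0, Complex.I)] i), ?_⟩
  simp only [pfaffianPairing, gltForms, wedge, Matrix.cons_val, h1, h2]
  simp [Complex.conj_ofNat]
  norm_num [Complex.ext_iff]

lemma IsGLTSpace.eq_zero_of_gltForms (hM : IsGLTSpace U L x) (p : M) {X : TangentSpace (𝓡 4) p}
    (hX : ∀ Y, gltForms L x p 2 X Y = 0) : X = 0 := by
  obtain ⟨Y, hY⟩ := (hM.coords p).2 (1, 0)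
  obtain ⟨Z, hZ⟩ := (hM.coords p).2 (0, 1)
  have hXY := hX Y
  have hXZ := hX Z
  simp only [Prod.mk.injEq] at hY hZ
  simp only [gltForms, wedge, Matrix.cons_val, hY.1, hY.2, hZ.1, hZ.2] at hXY hXZ
  refine (hM.coords p).1 ?_
  have hu : d (uCoord L x) p X = 0 := by linear_combination 2 * hXY
  have hz : d (zCoord x) p X = 0 := by linear_combination (-2) * hXZ
  simp only [hu, hz, map_zero]

variable {V : Set M} {q : M → ℍ[ℝ]} {e₁ e₂ e₃ ρ : M → ℝ}

/-- The differential of the coefficients in the quaternionic frame. -/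
lemma IsQuatFrameOn.d_eq (hF : IsQuatFrameOn V x q e₁ e₂ e₃) (hρ : ∀ p, ρ p = e₁ p - e₃ p)
    {p : M} (hp : p ∈ V) :
    ∃ f₁ f₃ : TangentSpace (𝓡 4) p → ℝ,
      (quatFrame q ρ p = ![fun X => f₁ X - f₃ X, fun X => ((q p)⁻¹ * d q p X).imI,
        fun X => ((q p)⁻¹ * d q p X).imJ, fun X => ((q p)⁻¹ * d q p X).imK]) ∧
      ∀ X, d x p X = spinor (rot (q p) *
        frameMatrix ((q p)⁻¹ * d q p X) (e₁ p) (e₃ p) (f₁ X) (f₃ X) * (rot (q p))ᵀ) := by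
  have hV := hF.isOpen.mem_nhds hp
  have hP : MDifferentiableAt (𝓡 4) 𝓘(ℝ, ℍ[ℝ] × ℝ × ℝ) (fun r => (q r, e₁ r, e₃ r)) p :=
    ((hF.smooth_q.contMDiffAt hV).mdifferentiableAt (by simp)).prodMk_space
      (((hF.smooth_e₁.contMDiffAt hV).mdifferentiableAt (by simp)).prodMk_space
        ((hF.smooth_e₃.contMDiffAt hV).mdifferentiableAt (by simp)))
  have hl {G : Type} [NormedAddCommGroup G] [NormedSpace ℝ G] (l : ℍ[ℝ] × ℝ × ℝ →L[ℝ] G)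
      (X : TangentSpace (𝓡 4) p) : d (fun r => l (q r, e₁ r, e₃ r)) p X
        = l (d (fun r => (q r, e₁ r, e₃ r)) p X) := d_comp hP l.hasFDerivAt X
  have hq := (hF.param p hp).q_ne
  refine ⟨fun X => (d (fun r => (q r, e₁ r, e₃ r)) p X).2.1,
    fun X => (d (fun r => (q r, e₁ r, e₃ r)) p X).2.2, ?_, fun X => ?_⟩
  · have h := hl ((ContinuousLinearMap.fst ℝ ℝ ℝ).comp (ContinuousLinearMap.snd ℝ ℍ[ℝ] (ℝ × ℝ)) -
      (ContinuousLinearMap.snd ℝ ℝ ℝ).comp (ContinuousLinearMap.snd ℝ ℍ[ℝ] (ℝ × ℝ)))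
    have hρ' : ρ = fun r => e₁ r - e₃ r := funext hρ
    rw [quatFrame, hρ']
    congr 1
    exact funext h
  · have hqX : d q p X = (d (fun r => (q r, e₁ r, e₃ r)) p X).1 :=
      hl (ContinuousLinearMap.fst ℝ ℍ[ℝ] (ℝ × ℝ)) X
    rw [hqX, ← fderiv_paramSpinor hq, ← d_comp hP
      ((contDiffAt_paramSpinor (n := 1) hq).differentiableAt one_ne_zero).hasFDerivAt]
    -- The parametrization holds on a neighbourhood, so it may be differentiated; e₂ is eliminated
    -- by the vanishing sum.
    have he : x =ᶠ[nhds p] fun r => paramSpinor (q r, e₁ r, e₃ r) := by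
      filter_upwards [hV] with r hr
      have h := hF.param r hr
      rw [eq_spinor_of_isQuatParam h, paramSpinor,
        show e₂ r = -e₁ r - e₃ r by linarith [h.sum_eq]]
    rw [d, he.mfderiv_eq]
    rfl

end Manifold

/-! ### Assembly of the canonical form. -/

section CanonicalForm

variable {M : Type*} [TopologicalSpace M] [ChartedSpace (EuclideanSpace ℝ (Fin 4)) M]

lemma quatFrame_add (q : M → ℍ[ℝ]) (ρ : M → ℝ) (p : M) (X Y : TangentSpace (𝓡 4) p) (a : Fin 4) :
    quatFrame q ρ p a (X + Y) = quatFrame q ρ p a X + quatFrame q ρ p a Y := by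
  fin_cases a <;> simp [quatFrame, mul_add] <;> ring

lemma quatFrame_smul (q : M → ℍ[ℝ]) (ρ : M → ℝ) (p : M) (r : ℝ) (X : TangentSpace (𝓡 4) p)
    (a : Fin 4) : quatFrame q ρ p a (r • X) = r * quatFrame q ρ p a X := by
  fin_cases a <;> simp [quatFrame] <;> ring

/-- The `θ`-frame as a linear map. -/
def thetaMap (h : Fin 5 → ℂ) (q : M → ℍ[ℝ]) (ρ e₂ : M → ℝ) (p : M) :
    TangentSpace (𝓡 4) p →ₗ[ℝ] Fin 4 → ℂ where
  toFun := thetaFrame h q ρ e₂ p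
  map_add' X Y := by
    simp only [thetaFrame, quatFrame_add, ← Matrix.mulVec_add]
    congr 2
    ext a
    simp
  map_smul' r X := by
    simp only [thetaFrame, quatFrame_smul, ← Matrix.mulVec_smul, RingHom.id_apply]
    congr 2
    ext a
    simp

/-- The canonical form of the symplectic forms and of the hyperkähler metric. -/
theorem canonicalForm {U : Set (Fin 5 → ℂ)} {L : (Fin 5 → ℂ) → ℂ} {x : M → Fin 5 → ℂ}
    (hM : IsGLTSpace U L x) {V : Set M} {q : M → ℍ[ℝ]} {e₁ e₂ e₃ ρ : M → ℝ}
    (hF : IsQuatFrameOn V x q e₁ e₂ e₃) (hρ : ∀ p, ρ p = e₁ p - e₃ p) {p : M} (hp : p ∈ V)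
    (hli : LinearIndependent ℝ (quatFrame q ρ p)) {h : Fin 5 → ℂ}
    (hh : h = ringed (q p) (hfun L (x p))) :
    IsUnit (quatToChi (ρ p) (e₂ p)).det ∧ IsUnit (thetaToChi h).det ∧
      ∃ lam : ℝ, (lam : ℂ) = r₃ (dualNormalize 2 h) * Hprime h ∧
        ∀ θ₁ θ₂ : TangentSpace (𝓡 4) p → ℂ, (∀ X, θ₂ X = thetaFrame h q ρ e₂ p X 0) →
          (∀ X, θ₁ X = thetaFrame h q ρ e₂ p X 1) →
          (∀ X Y, normalize 1 (fun m => gltForms L x p m X Y) =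
            wignerD 1 (q p) *ᵥ normalize 1 (fun m => canonicalForms lam θ₁ θ₂ m X Y)) ∧
          ∀ g : TangentSpace (𝓡 4) p → TangentSpace (𝓡 4) p → ℝ,
            IsHyperkahlerMetric (gltForms L x p) g ↔
              ∀ X Y, g X Y = lam * (θ₁ X * conj (θ₁ Y) + θ₂ X * conj (θ₂ Y)).re := by
  have hparam := hF.param p hp
  have hq := hparam.q_ne
  have h₁₂ := hF.lt₁₂ p hp
  have h₂₃ := hF.lt₂₃ p hp
  obtain ⟨f₁, f₃, hquat, hdx⟩ := hF.d_eq hρ hp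
  have hh₀ : IsAltReal (hfun L (x p)) :=
    isAltReal_hfun hM.isOpen hM.contour hM.real (hM.mem p) (hM.altReal p)
  obtain ⟨hhr, hcov⟩ := spinForms_ringed hh₀ hq
  rw [← hh] at hhr hcov
  set s : TangentSpace (𝓡 4) p → ℍ[ℝ] := fun X => (q p)⁻¹ * d q p X with hs
  set Ξ : TangentSpace (𝓡 4) p → Matrix (Fin 3) (Fin 3) ℝ := fun X =>
    frameMatrix (s X) (e₁ p) (e₃ p) (f₁ X) (f₃ X) with hΞ
  have hΞs (X) : IsSymTraceless (Ξ X) := isSymTraceless_frameMatrix _ _ _ _ _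
  have hc (X) : Constraint (hfun L (x p)) (spinor (rot (q p) * Ξ X * (rot (q p))ᵀ)) := by
    rw [hΞ, ← hdx]
    exact hM.constraint_d p X
  have hcr (X) : Constraint h (spinor (Ξ X)) := (hcov _ _ (hΞs X) (hΞs X) (hc X) (hc X)).1
  have hform (X Y) : (fun m => gltForms L x p m X Y)
      = wignerE 1 (q p) *ᵥ spinForms h (spinor (Ξ X)) (spinor (Ξ Y)) := by
    rw [hM.gltForms_eq, hdx, hdx]
    exact (hcov _ _ (hΞs X) (hΞs Y) (hc X) (hc Y)).2
  -- At the fixed point p, each ω_m is a constant combination of the rotated forms, so its products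
  -- are combinations of theirs.
  have hform' (m : Fin 3) : gltForms L x p m = fun X Y =>
      ∑ k, wignerE 1 (q p) m k * spinForms h (spinor (Ξ X)) (spinor (Ξ Y)) k := by
    ext X Y
    exact congrFun (hform X Y) m
  obtain ⟨e, he⟩ := hM.exists_frame p
  rw [hform', hform', pfaffianPairing_sum e
    (fun k X Y => spinForms h (spinor (Ξ X)) (spinor (Ξ Y)) k)] at he
  -- Here the independence of dρ, σ₁, σ₂, σ₃ enters: otherwise h̊ = 0 and every form vanishes.
  have h2 : h 2 ≠ 0 := by
    intro h2
    have h0 : h = 0 := eq_zero_of_constraint_frameMatrix hhr h2 hparam.sum_eq h₁₂ h₂₃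
      (hquat ▸ hli) hcr
    apply he
    have hz (y z : Fin 5 → ℂ) (k : Fin 3) : spinForms h y z k = 0 := by
      rw [h0]
      fin_cases k <;> simp [spinForms, wedge]
    simp [pfaffianPairing, hz]
  have hk : hankelDet h ≠ 0 := fun h0 => he <|
    Finset.sum_eq_zero fun k _ => Finset.sum_eq_zero fun l _ => by
      rw [pfaffianPairing_spinForms_eq_zero hhr h2 (fun X => isAltReal_spinor (Ξ X)) hcr h0 e k l,
        mul_zero]
  have hP := Hprime_ne_zero hhr h2
  have hdet : (thetaToChi h).det ≠ 0 := by
    rw [det_thetaToChi hhr]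
    exact neg_ne_zero.2 (mul_ne_zero (pow_ne_zero 2 hP) (mul_ne_zero h2 hk))
  obtain ⟨lam, hlam⟩ : ∃ lam : ℝ, (lam : ℂ) = hankelDet h * Hprime h := by
    have : conj (hankelDet h * Hprime h) = hankelDet h * Hprime h := by
      rw [map_mul, conj_hankelDet hhr, conj_Hprime hhr]
    obtain ⟨r, hr⟩ := Complex.conj_eq_iff_real.1 this
    exact ⟨r, hr.symm⟩
  have hl : lam ≠ 0 := by
    rintro rfl
    exact mul_ne_zero hk hP (hlam.symm.trans Complex.ofReal_zero)
  refine ⟨?_, isUnit_iff_ne_zero.2 hdet, lam, by rw [hlam, r₃_dualNormalize], ?_⟩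
  · rw [hρ]
    exact isUnit_iff_ne_zero.2 (det_quatToChi_ne_zero hparam.sum_eq h₁₂ h₂₃)
  intro θ₁ θ₂ hθ₂ hθ₁
  obtain rfl : θ₁ = fun X => thetaFrame h q ρ e₂ p X 1 := funext hθ₁
  obtain rfl : θ₂ = fun X => thetaFrame h q ρ e₂ p X 0 := funext hθ₂
  have ht (X) : thetaToChi h *ᵥ thetaFrame h q ρ e₂ p X
      = ![spinor (Ξ X) 4, spinor (Ξ X) 3, spinor (Ξ X) 1, spinor (Ξ X) 0] := by
    rw [thetaFrame, Matrix.mulVec_mulVec, Matrix.mul_nonsing_inv _ (isUnit_iff_ne_zero.2 hdet),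
      Matrix.one_mulVec, ← quatToChi_mulVec hparam.sum_eq (hρ p), hquat]
    congr 1
    ext a
    fin_cases a <;> rfl
  have hcan (X Y) : (fun m => gltForms L x p m X Y) = wignerE 1 (q p) *ᵥ fun m =>
      canonicalForms lam (fun X => thetaFrame h q ρ e₂ p X 1)
        (fun X => thetaFrame h q ρ e₂ p X 0) m X Y := by
    rw [hform]
    congr 1
    ext m
    exact spinForms_eq_canonicalForms hhr h2 hdet (fun X => isAltReal_spinor (Ξ X)) hcr ht hlam X Y m
  refine ⟨fun X Y => by rw [wignerD_mulVec_normalize, hcan], ?_⟩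
  let θ : TangentSpace (𝓡 4) p →ₗ[ℝ] ℂ × ℂ :=
    (LinearMap.proj 1 ∘ₗ thetaMap h q ρ e₂ p).prod (LinearMap.proj 0 ∘ₗ thetaMap h q ρ e₂ p)
  -- A vector killed by θ₁ and θ₂ is in the kernel of ω₊, which is trivial. By dimension (θ₁, θ₂) is
  -- then a real isomorphism onto ℂ².
  have hθ : Function.Injective θ := by
    rw [injective_iff_map_eq_zero]
    intro X hX
    have h1 : thetaFrame h q ρ e₂ p X 1 = 0 := congrArg Prod.fst hX
    have h0 : thetaFrame h q ρ e₂ p X 0 = 0 := congrArg Prod.snd hX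
    refine hM.eq_zero_of_gltForms p fun Y => ?_
    have hz : (fun m => canonicalForms lam (fun X => thetaFrame h q ρ e₂ p X 1)
        (fun X => thetaFrame h q ρ e₂ p X 0) m X Y) = 0 := by
      ext m
      fin_cases m <;> simp [canonicalForms, wedge, h0, h1]
    have := congrFun (hcan X Y) 2
    rwa [hz, Matrix.mulVec_zero] at this
  have : FiniteDimensional ℝ (TangentSpace (𝓡 4) p) :=
    inferInstanceAs (FiniteDimensional ℝ (EuclideanSpace ℝ (Fin 4)))
  have hdim : Module.finrank ℝ (TangentSpace (𝓡 4) p) = Module.finrank ℝ (ℂ × ℂ) := by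
    change Module.finrank ℝ (EuclideanSpace ℝ (Fin 4)) = _
    simp
  exact isHyperkahlerMetric_canonicalForms_iff hl (LinearMap.linearEquivOfInjective θ hθ hdim) hq hcan

end CanonicalForm

end GLT

end

theorem mainTheorem2 {M : Type*} [TopologicalSpace M]
    [ChartedSpace (EuclideanSpace ℝ (Fin 4)) M] [IsManifold (𝓡 4) ∞ M]
    (U : Set (Fin 5 → ℂ)) (L : (Fin 5 → ℂ) → ℂ) (x : M → Fin 5 → ℂ)
    (hM : GLT.IsGLTSpace U L x) :
    -- every real quintuple of coefficients has quaternionic parameters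
    (∀ y : Fin 5 → ℂ, GLT.IsAltReal y →
      ∃ (q : ℍ[ℝ]) (e₁ e₂ e₃ : ℝ), GLT.IsQuatParam y q e₁ e₂ e₃) ∧
    -- and the `e_i` are then the roots of the Weierstrass cubic
    (∀ (y : Fin 5 → ℂ) (q : ℍ[ℝ]) (e₁ e₂ e₃ : ℝ), GLT.IsQuatParam y q e₁ e₂ e₃ →
      ∀ X : ℂ, X ^ 3 - GLT.g₂ y * X - GLT.g₃ y = (X - e₁) * (X - e₂) * (X - e₃)) ∧
    -- the parameters can be chosen smoothly near any point with non-zero discriminant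
    (∀ p : M, GLT.discr (x p) ≠ 0 →
      ∃ (V : Set M) (q : M → ℍ[ℝ]) (e₁ e₂ e₃ : M → ℝ),
        p ∈ V ∧ GLT.IsQuatFrameOn V x q e₁ e₂ e₃) ∧
    -- canonical form of the symplectic forms and of the metric
    (∀ (V : Set M) (q : M → ℍ[ℝ]) (e₁ e₂ e₃ ρ : M → ℝ),
      GLT.IsQuatFrameOn V x q e₁ e₂ e₃ → (∀ p, ρ p = e₁ p - e₃ p) →
      ∀ p ∈ V, LinearIndependent ℝ (GLT.quatFrame q ρ p) →
        ∀ hr : Fin 5 → ℂ, hr = GLT.ringed (q p) (GLT.hfun L (x p)) →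
          IsUnit (GLT.quatToChi (ρ p) (e₂ p)).det ∧
          IsUnit (GLT.thetaToChi hr).det ∧
          ∃ lam : ℝ, (lam : ℂ) = GLT.r₃ (GLT.dualNormalize 2 hr) * GLT.Hprime hr ∧
            ∀ θ₁ θ₂ : TangentSpace (𝓡 4) p → ℂ,
              (∀ X, θ₂ X = GLT.thetaFrame hr q ρ e₂ p X 0) →
              (∀ X, θ₁ X = GLT.thetaFrame hr q ρ e₂ p X 1) →
              (∀ X Y, GLT.normalize 1 (fun m => GLT.gltForms L x p m X Y) =
                GLT.wignerD 1 (q p) *ᵥ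
                  GLT.normalize 1 (fun m => GLT.canonicalForms lam θ₁ θ₂ m X Y)) ∧
              (∀ g : TangentSpace (𝓡 4) p → TangentSpace (𝓡 4) p → ℝ,
                GLT.IsHyperkahlerMetric (GLT.gltForms L x p) g ↔
                  ∀ X Y, g X Y =
                    lam * (θ₁ X * conj (θ₁ Y) + θ₂ X * conj (θ₂ Y)).re)) := by
  exact ⟨fun y hy => GLT.exists_isQuatParam hy,
    fun y q e₁ e₂ e₃ h X => GLT.cubic_eq_of_isQuatParam h X,
    fun p hp => GLT.exists_isQuatFrameOn hM.smooth hM.altReal hp,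
    fun V q e₁ e₂ e₃ ρ hF hρ p hp hli hr hh => GLT.canonicalForm hM hF hρ hp hli hh⟩
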